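/- **Theorem (Learning to predict a quantum evolution).** *Setting.* Let $\mathrm{stab}_1=\{|0\rangle,|1\rangle,|+\rangle,|-\rangle,|y+\rangle,|y-\rangle\}$. For a CPTP map $\mathcal E$ on $n$ qubits, a classical shadow $S_N(\mathcal E)=\{(|\psi^{\rm in}_\ell\rangle,|\psi^{\rm out}_\ell\rangle)\}_{\ell=1}^N$ consists of the outcomes of $N$ independent experiments: $|\psi^{\rm in}_\ell\rangle=\bigotimes_i|s^{\rm in}_{\ell,i}\rangle$ is uniform over $\mathrm{stab}_1^{\,n}$, and $|\psi^{\rm out}_\ell\rangle=\bigotimes_i|s^{\rm out}_{\ell,i}\rangle$ is the outcome of the POVM $\{3^{-n}\bigotimes_i|s_i\rangle\langle s_i|\}_{s\in\mathrm{stab}_1^n}$ on $\mathcal E(|\psi^{\rm in}_\ell\rangle\langle\psi^{\rm in}_\ell|)$. Write $|P|$ for the number of non-identity factors of $P\in\{I,X,Y,Z\}^{\otimes n}$ and $\|\cdot\|$ for the spectral norm. An observable has *degree bound* $(\kappa,d)$ if it is a finite sum of Hermitian operators, each acting on at most $\kappa$ qubits, such that every qubit is acted on by at most $d$ of them. Let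 $\lg x=\max(1,\log_2x)$, and for $0<\epsilon<1$ let $k=\lceil\log_{1.5}(1/\epsilon)\rceil$ and $r=2k/(k+1)\in[1,2)$. *Algorithm.* With hyperparameters $K\in\mathbb N$, $\tau>0$, and for $O=\sum_Q a_QQ$ with $\eta=\sum_Q|a_Q|$, the algorithm uses $$\hat x_P(O)=\frac1N\sum_{\ell=1}^N\operatorname{Tr}\big(P|\psi^{\rm in}_\ell\rangle\langle\psi^{\rm in}_\ell|\big)\operatorname{Tr}\Big(O\bigotimes_{i=1}^n\big(3|s^{\rm out}_{\ell,i}\rangle\langle s^{\rm out}_{\ell,i}|-I\big)\Big),$$ sets $\hat\alpha_P(O)=3^{|P|}\hat x_P(O)$ if $3^{-|P|}>2\tau$ and $3^{|P|/2}|\hat x_P(O)|>2\eta\sqrt{\tau}$, and $\hat\alpha_P(O)=0$ otherwise, and learns $h(\rho,O)=\sum_{|P|\le K}\hat\alpha_P(O)\operatorname{Tr}(P\rho)$. *Statement.* For all $\kappa,d\in\mathbb N$ there are two programs (for training and for prediction) and a constant $C$, depending only on $\kappa,d$, such that for all $n\ge1$, $0<\epsilon<1$, $\epsilon'>0$ there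 are hyperparameters $K\le k$ and $\tau>0$ with the following properties. 1. *Running time.* For every $N\ge1$ and every dataset of size $N$, the training program, given $n,N,\epsilon,\epsilon'$ and the dataset, halts after at most $C\,k\,n^kN$ steps; and the prediction program, started in the resulting memory and given a list of the nonzero Pauli coefficients of an observable $O$ with degree bound $(\kappa,d)$ and access to $\operatorname{Tr}(P\rho)$ for $|P|\le k$ (a query costs $O(1)$ plus the length of the description of $P$), outputs $h(\rho,O)$ after at most $C\,k\,n^kN$ steps, for every $n$-qubit state $\rho$. In particular, for fixed $\epsilon,\epsilon',\delta$ and with the smallest $N$ allowed in part 2, both times are polynomial in $n$. Programs run on a random access machine with exact real arithmetic ($+,-,\times,\div$, comparison) and integer addition, subtraction, comparison and indexing at unit cost. 2. *Accuracy.* For every $\delta>0$, every $$N\ \ge\ \lg\!\Big(\frac n\delta\Big)\cdot\min\Big(2^{\,C\lg(1/\epsilon)\,(\lg\lg(1/\epsilon)+\lg(1/\epsilon'))},\ 2^{\,C\lg(1/\epsilon)\lg n}\Big)$$ and every CPTP map $\mathcal E$ on $n$ qubits, with probability at least $1-\delta$ over $S_N(\mathcal E)$ the following holds: for every probability distribution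 $\mathcal D$ over $n$-qubit states that is invariant under the gates $H$ and $S$ on every single qubit, and every observable $O$ with degree bound $(\kappa,d)$, $$\mathbb E_{\rho\sim\mathcal D}\big|h(\rho,O)-\operatorname{Tr}(O\,\mathcal E(\rho))\big|^2\ \le\ \Big(\epsilon+\epsilon'\Big(\frac{\|O^{\rm (low)}\|}{\|O\|}\Big)^{r}\Big)\|O\|^2 .$$ Here $O^{\rm (low)}=\sum_{|P|\le k}\alpha_PP$ is the truncation of $\mathcal E^\dagger(O)=\sum_P\alpha_PP$ to Pauli weight at most $k$ (for $O=0$ the right-hand side is read as $0$). -/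

import Mathlib

open scoped Matrix ComplexOrder

namespace QEvo

noncomputable section

/-! ### Operators on `n` qubits -/

/-- Operators on `n` qubits, in the computational basis. -/
abbrev Op (n : ℕ) : Type := Matrix (Fin n → Fin 2) (Fin n → Fin 2) ℂ

/-- The tensor product `A 0 ⊗ A 1 ⊗ ⋯ ⊗ A (n - 1)` of one-qubit operators. -/
def tensorOp {n : ℕ} (A : Fin n → Matrix (Fin 2) (Fin 2) ℂ) : Op n :=
  Matrix.of fun x y => ∏ i, A i (x i) (y i)

/-- The one-qubit Pauli operators `I, X, Y, Z`, numbered `0, 1, 2, 3`. -/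
def pauli : Fin 4 → Matrix (Fin 2) (Fin 2) ℂ :=
  ![1, !![0, 1; 1, 0], !![0, -Complex.I; Complex.I, 0], !![1, 0; 0, -1]]

/-- Labels of the `n`-qubit Pauli observables `{I, X, Y, Z}^{⊗ n}`. -/
abbrev PauliString (n : ℕ) : Type := Fin n → Fin 4

/-- The set of qubits on which a Pauli observable acts nontrivially. -/
def dom {n : ℕ} (P : PauliString n) : Finset (Fin n) := Finset.univ.filter fun i => P i ≠ 0

/-- The weight `|P|`. -/
def weight {n : ℕ} (P : PauliString n) : ℕ := (dom P).card

/-- The Pauli observable with label `P`. -/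
def pauliOp {n : ℕ} (P : PauliString n) : Op n := tensorOp fun i => pauli (P i)

/-- The coefficient of `P` in the Pauli expansion of `M`. -/
def pauliCoeff {n : ℕ} (P : PauliString n) (M : Op n) : ℂ :=
  (pauliOp P * M).trace / 2 ^ n

/-- The truncation of the Pauli expansion of `M` to the terms of weight at most `k`. -/
def lowDegree {n : ℕ} (k : ℕ) (M : Op n) : Op n :=
  ∑ P : PauliString n with weight P ≤ k, pauliCoeff P M • pauliOp P

/-- The Pauli-1 norm `∑_Q |a_Q|` of `O = ∑_Q a_Q Q`. -/
def pauliL1 {n : ℕ} (O : Op n) : ℝ := ∑ Q : PauliString n, ‖pauliCoeff Q O‖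

/-- The spectral norm. -/
def opNorm {n : ℕ} (M : Op n) : ℝ := ‖Matrix.toEuclideanCLM (𝕜 := ℂ) M‖

/-- Density matrices. -/
def IsState {n : ℕ} (ρ : Op n) : Prop := ρ.PosSemidef ∧ ρ.trace = 1

/-- `M` acts only on the qubits in `A`, that is, `M = B ⊗ I` with `B` an operator on `A`. -/
def ActsOn {n : ℕ} (A : Finset (Fin n)) (M : Op n) : Prop :=
  ∃ B : Matrix (A → Fin 2) (A → Fin 2) ℂ, ∀ x y : Fin n → Fin 2,
    M x y = if ∀ i, i ∉ A → x i = y i then B (fun i => x i) (fun i => y i) else 0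

/-- `O` is a sum of observables on at most `κ` qubits each, where each qubit is acted on by at
most `d` of them. -/
def IsBoundedDegree {n : ℕ} (κ d : ℕ) (O : Op n) : Prop :=
  ∃ (m : ℕ) (A : Fin m → Finset (Fin n)) (B : Fin m → Op n),
    (∀ j, (A j).card ≤ κ ∧ (B j).IsHermitian ∧ ActsOn (A j) (B j)) ∧
    (∀ i, (Finset.univ.filter fun j => i ∈ A j).card ≤ d) ∧
    O = ∑ j, B j

/-! ### Quantum processes -/

/-- `id ⊗ E` on `ℂ^m ⊗ (ℂ²)^{⊗ n}`. -/
def ampliation {n : ℕ} (m : ℕ) (E : Op n →ₗ[ℂ] Op n)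
    (X : Matrix (Fin m × (Fin n → Fin 2)) (Fin m × (Fin n → Fin 2)) ℂ) :
    Matrix (Fin m × (Fin n → Fin 2)) (Fin m × (Fin n → Fin 2)) ℂ :=
  Matrix.of fun p q => E (Matrix.of fun u v => X (p.1, u) (q.1, v)) p.2 q.2

/-- Completely positive and trace-preserving maps. -/
structure IsCPTP {n : ℕ} (E : Op n →ₗ[ℂ] Op n) : Prop where
  completelyPositive : ∀ (m : ℕ)
    (X : Matrix (Fin m × (Fin n → Fin 2)) (Fin m × (Fin n → Fin 2)) ℂ),
    X.PosSemidef → (ampliation m E X).PosSemidef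
  tracePreserving : ∀ X : Op n, (E X).trace = X.trace

/-- The Heisenberg evolution `E†(O)` of `O`: the operator with `tr (E†(O) X) = tr (O E(X))`
for all `X`. -/
def heisenberg {n : ℕ} (E : Op n →ₗ[ℂ] Op n) (O : Op n) : Op n :=
  Matrix.of fun x y => (O * E (Matrix.single y x 1)).trace

theorem trace_heisenberg_mul {n : ℕ} (E : Op n →ₗ[ℂ] Op n) (O X : Op n) :
    (heisenberg E O * X).trace = (O * E X).trace := by
  conv_rhs => rw [Matrix.matrix_eq_sum_single X]
  simp only [map_sum, Matrix.mul_sum, Matrix.trace_sum]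
  have h : ∀ (i j : Fin n → Fin 2),
      (O * E (Matrix.single i j (X i j))).trace = heisenberg E O j i * X i j := by
    intro i j
    have : Matrix.single i j (X i j) = X i j • Matrix.single i j (1 : ℂ) := by
      rw [Matrix.smul_single]; simp
    rw [this, map_smul, Matrix.mul_smul, Matrix.trace_smul, smul_eq_mul, mul_comm]
    rfl
  simp only [h]
  rw [Finset.sum_comm]
  simp [Matrix.trace, Matrix.mul_apply]

/-! ### Classical shadows of a process -/

/-- The single-qubit stabilizer states `|0⟩, |1⟩, |+⟩, |-⟩, |y+⟩, |y-⟩`. -/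
def stabKet : Fin 6 → Fin 2 → ℂ :=
  ![![1, 0], ![0, 1],
    ![1 / (√2 : ℝ), 1 / (√2 : ℝ)], ![1 / (√2 : ℝ), -1 / (√2 : ℝ)],
    ![1 / (√2 : ℝ), Complex.I / (√2 : ℝ)], ![1 / (√2 : ℝ), -Complex.I / (√2 : ℝ)]]

/-- The projector `|s⟩⟨s|`. -/
def stabProj (s : Fin 6) : Matrix (Fin 2) (Fin 2) ℂ :=
  Matrix.vecMulVec (stabKet s) (star (stabKet s))

/-- The projector on the product state `⊗_i |s_i⟩`. -/
def stabProd {n : ℕ} (s : Fin n → Fin 6) : Op n := tensorOp fun i => stabProj (s i)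

/-- The outcomes of `N` randomized experiments: for each one the labels of the input and of the
output product stabilizer state. -/
abbrev Shadow (n N : ℕ) : Type := Fin N → (Fin n → Fin 6) × (Fin n → Fin 6)

/-- The probability that one randomized experiment on `E` yields the pair `s`: the input is uniform
over the product stabilizer states, and the output is measured with the POVM
`{3^{-n} ⊗_i |s_i⟩⟨s_i|}`. -/
def experimentProb {n : ℕ} (E : Op n →ₗ[ℂ] Op n) (s : (Fin n → Fin 6) × (Fin n → Fin 6)) : ℝ :=
  (1 / 6) ^ n * ((1 / 3) ^ n * (stabProd s.2 * E (stabProd s.1)).trace.re)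

open Classical in
/-- The probability that the outcomes of `N` independent randomized experiments on `E` lie
in `A`. -/
def shadowProb {n N : ℕ} (E : Op n →ₗ[ℂ] Op n) (A : Set (Shadow n N)) : ℝ :=
  ∑ S : Shadow n N with S ∈ A, ∏ l, experimentProb E (S l)

/-! ### The learning algorithm -/

/-- The estimate `x̂_P(O)`. -/
def xHat {n N : ℕ} (S : Shadow n N) (P : PauliString n) (O : Op n) : ℝ :=
  (1 / N) * ∑ l, (pauliOp P * stabProd (S l).1).trace.re *
    (O * tensorOp fun i => (3 : ℂ) • stabProj ((S l).2 i) - 1).trace.re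

/-- The filtered estimate `α̂_P(O)` of the coefficient of `P` in `E†(O)`, with filter
parameter `τ`. -/
def alphaHat {n N : ℕ} (S : Shadow n N) (τ : ℝ) (P : PauliString n) (O : Op n) : ℝ :=
  if 2 * τ < (1 / 3) ^ weight P ∧
      2 * pauliL1 O * √τ < |xHat S P O| / √((1 / 3) ^ weight P)
  then xHat S P O / (1 / 3) ^ weight P else 0

/-- The learned function `h(ρ, O) = ∑_{|P| ≤ K} α̂_P(O) tr(P ρ)`, with the hyperparameters
`K` (degree) and `τ` (filter parameter). -/
def learned {n N : ℕ} (S : Shadow n N) (K : ℕ) (τ : ℝ) (ρ O : Op n) : ℝ :=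
  ∑ P : PauliString n with weight P ≤ K, alphaHat S τ P O * (pauliOp P * ρ).trace.re

/-! ### State distributions -/

/-- The Borel σ-algebra, as the product over the matrix entries. -/
instance {n : ℕ} : MeasurableSpace (Op n) :=
  inferInstanceAs (MeasurableSpace ((Fin n → Fin 2) → (Fin n → Fin 2) → ℂ))

/-- The gate `U` applied to qubit `i`. -/
def localGate {n : ℕ} (i : Fin n) (U : Matrix (Fin 2) (Fin 2) ℂ) : Op n :=
  tensorOp (Function.update (fun _ => 1) i U)

/-- The Hadamard gate. -/
def gateH : Matrix (Fin 2) (Fin 2) ℂ := ((1 / √2 : ℝ) : ℂ) • !![1, 1; 1, -1]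

/-- The phase gate. -/
def gateS : Matrix (Fin 2) (Fin 2) ℂ := !![1, 0; 0, Complex.I]

/-- The distribution `D` is invariant under the unitary `U`. -/
def IsInvariantUnder {n : ℕ} (D : MeasureTheory.Measure (Op n)) (U : Op n) : Prop :=
  D.map (fun ρ => U * ρ * Uᴴ) = D

/-- `D` is a probability distribution over `n`-qubit states that is invariant under the
`H` and `S` gates (hence under all Clifford gates) on single qubits. -/
structure IsLocallyFlat {n : ℕ} (D : MeasureTheory.Measure (Op n)) : Prop where
  prob : MeasureTheory.IsProbabilityMeasure D
  states : ∀ᵐ ρ ∂D, IsState ρ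
  invariantH : ∀ i, IsInvariantUnder D (localGate i gateH)
  invariantS : ∀ i, IsInvariantUnder D (localGate i gateS)

/-! ### Parameters -/

/-- The binary logarithm, cut off below at `1`. -/
def lg (x : ℝ) : ℝ := max 1 (Real.logb 2 x)

/-- The truncation degree `⌈log_{1.5} (1/ε)⌉`. -/
def degree (ε : ℝ) : ℕ := ⌈Real.logb 1.5 (1 / ε)⌉₊

/-- The exponent `2k/(k+1)` for `k = ⌈log_{1.5} (1/ε)⌉`. -/
def exponent (ε : ℝ) : ℝ := 2 * degree ε / (degree ε + 1)

/-- The number of experiments, with constant `C` in the `O`-notation. -/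
def sampleSize (C : ℝ) (n : ℕ) (ε ε' δ : ℝ) : ℝ :=
  lg (n / δ) * min ((2 : ℝ) ^ (C * (lg (1 / ε) * (lg (lg (1 / ε)) + lg (1 / ε')))))
    ((2 : ℝ) ^ (C * (lg (1 / ε) * lg n)))

/-! ### A random access machine over the reals -/

namespace RAM

/-- The memory: two-dimensional arrays of natural numbers and of real numbers; the first argument
is the name of the array. -/
structure Store where
  nat : ℕ → ℕ → ℕ → ℕ
  real : ℕ → ℕ → ℕ → ℝ

/-- Integer expressions. There is no multiplication; subtraction is truncated. -/
inductive NExp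
  | lit (c : ℕ)
  | get (a : ℕ) (i j : NExp)
  | add (e f : NExp)
  | sub (e f : NExp)

def NExp.eval (σ : Store) : NExp → ℕ
  | lit c => c
  | get a i j => σ.nat a (i.eval σ) (j.eval σ)
  | add e f => e.eval σ + f.eval σ
  | sub e f => e.eval σ - f.eval σ

/-- The number of steps of an evaluation. -/
def NExp.cost : NExp → ℕ
  | lit _ => 1
  | get _ i j => i.cost + j.cost + 1
  | add e f => e.cost + f.cost + 1
  | sub e f => e.cost + f.cost + 1

/-- Real expressions, over the field operations. -/
inductive RExp
  | cast (e : NExp)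
  | get (a : ℕ) (i j : NExp)
  | add (e f : RExp)
  | sub (e f : RExp)
  | mul (e f : RExp)
  | div (e f : RExp)

def RExp.eval (σ : Store) : RExp → ℝ
  | cast e => (e.eval σ : ℝ)
  | get a i j => σ.real a (i.eval σ) (j.eval σ)
  | add e f => e.eval σ + f.eval σ
  | sub e f => e.eval σ - f.eval σ
  | mul e f => e.eval σ * f.eval σ
  | div e f => e.eval σ / f.eval σ

def RExp.cost : RExp → ℕ
  | cast e => e.cost + 1
  | get _ i j => i.cost + j.cost + 1
  | add e f => e.cost + f.cost + 1
  | sub e f => e.cost + f.cost + 1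
  | mul e f => e.cost + f.cost + 1
  | div e f => e.cost + f.cost + 1

/-- Tests. -/
inductive Test
  | natLe (e f : NExp)
  | realLe (e f : RExp)

def Test.Holds (σ : Store) : Test → Prop
  | natLe e f => e.eval σ ≤ f.eval σ
  | realLe e f => e.eval σ ≤ f.eval σ

def Test.cost : Test → ℕ
  | natLe e f => e.cost + f.cost + 1
  | realLe e f => e.cost + f.cost + 1

/-- Programs. The command `query a b w c i j` asks the oracle about the list of pairs
`(nat a 0 s, nat b 0 s)`, `s < w`, and writes the answer to `real c i j`. -/
inductive Cmd
  | setNat (a : ℕ) (i j : NExp) (e : NExp)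
  | setReal (a : ℕ) (i j : NExp) (e : RExp)
  | query (a b : ℕ) (w : NExp) (c : ℕ) (i j : NExp)
  | seq (p q : Cmd)
  | ite (b : Test) (p q : Cmd)
  | loop (b : Test) (p : Cmd)

/-- Writing to one cell of the integer memory. -/
def Store.setNat (σ : Store) (a i j v : ℕ) : Store :=
  { σ with nat := fun a' i' j' => if a' = a ∧ i' = i ∧ j' = j then v else σ.nat a' i' j' }

/-- Writing to one cell of the real memory. -/
def Store.setReal (σ : Store) (a i j : ℕ) (v : ℝ) : Store :=
  { σ with real := fun a' i' j' => if a' = a ∧ i' = i ∧ j' = j then v else σ.real a' i' j' }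

/-- An oracle answers a query that consists of the first `w` entries of two lists. -/
abbrev Oracle : Type := (w : ℕ) → (Fin w → ℕ × ℕ) → ℝ

/-- `Exec Ω p σ t σ'`: started in `σ`, the program `p` with the oracle `Ω` halts in `σ'` after
exactly `t` steps. A query of length `w` takes `w + 1` steps. -/
inductive Exec (Ω : Oracle) : Cmd → Store → ℕ → Store → Prop
  | setNat (a : ℕ) (i j e : NExp) (σ : Store) :
      Exec Ω (.setNat a i j e) σ (i.cost + j.cost + e.cost + 1)
        (σ.setNat a (i.eval σ) (j.eval σ) (e.eval σ))
  | setReal (a : ℕ) (i j : NExp) (e : RExp) (σ : Store) :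
      Exec Ω (.setReal a i j e) σ (i.cost + j.cost + e.cost + 1)
        (σ.setReal a (i.eval σ) (j.eval σ) (e.eval σ))
  | query (a b : ℕ) (w : NExp) (c : ℕ) (i j : NExp) (σ : Store) :
      Exec Ω (.query a b w c i j) σ (w.cost + i.cost + j.cost + w.eval σ + 1)
        (σ.setReal c (i.eval σ) (j.eval σ)
          (Ω (w.eval σ) fun s => (σ.nat a 0 s, σ.nat b 0 s)))
  | seq {p q : Cmd} {σ σ₁ σ₂ : Store} {t₁ t₂ : ℕ} :
      Exec Ω p σ t₁ σ₁ → Exec Ω q σ₁ t₂ σ₂ → Exec Ω (.seq p q) σ (t₁ + t₂) σ₂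
  | iteTrue {b : Test} {p q : Cmd} {σ σ₁ : Store} {t : ℕ} :
      b.Holds σ → Exec Ω p σ t σ₁ → Exec Ω (.ite b p q) σ (b.cost + t) σ₁
  | iteFalse {b : Test} {p q : Cmd} {σ σ₁ : Store} {t : ℕ} :
      ¬ b.Holds σ → Exec Ω q σ t σ₁ → Exec Ω (.ite b p q) σ (b.cost + t) σ₁
  | loopTrue {b : Test} {p : Cmd} {σ σ₁ σ₂ : Store} {t₁ t₂ : ℕ} :
      b.Holds σ → Exec Ω p σ t₁ σ₁ → Exec Ω (.loop b p) σ₁ t₂ σ₂ →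
      Exec Ω (.loop b p) σ (b.cost + t₁ + t₂) σ₂
  | loopFalse {b : Test} {p : Cmd} {σ : Store} :
      ¬ b.Holds σ → Exec Ω (.loop b p) σ b.cost σ

end RAM

/-! ### Input and output of the machine -/

/-- The input for training: `n` and `N` in the integer array `0`, the input and output labels of
the experiments in the integer arrays `1` and `2`, and `ε, ε'` in the real array `0`. -/
def trainInput {n N : ℕ} (ε ε' : ℝ) (S : Shadow n N) : RAM.Store where
  nat a i j :=
    if a = 0 ∧ i = 0 then (if j = 0 then n else if j = 1 then N else 0)
    else if h : i < N ∧ j < n then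
      (if a = 1 then ((S ⟨i, h.1⟩).1 ⟨j, h.2⟩ : ℕ)
        else if a = 2 then ((S ⟨i, h.1⟩).2 ⟨j, h.2⟩ : ℕ) else 0)
    else 0
  real a i j := if a = 0 ∧ i = 0 then (if j = 0 then ε else if j = 1 then ε' else 0) else 0

/-- `Q` lists, in some order and without repetition, the Pauli observables with nonzero coefficient
in `O`. -/
def IsListing {n m : ℕ} (O : Op n) (Q : Fin m → PauliString n) : Prop :=
  Function.Injective Q ∧ Set.range Q = {P | pauliCoeff P O ≠ 0}

/-- The memory `σ` with the sparse Pauli expansion of `O` loaded into it: the number `m` of terms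
in the integer array `3`, their weights in the integer array `4`, the qubits on which
term `i` acts (in increasing order) and the Pauli labels on them in row `i` of the integer arrays
`5` and `6`, and the coefficients in the real array `1`. -/
def predictInput {n m : ℕ} (σ : RAM.Store) (O : Op n) (Q : Fin m → PauliString n) :
    RAM.Store where
  nat a i j :=
    if a = 3 then (if i = 0 ∧ j = 0 then m else 0)
    else if a = 4 then (if h : i < m ∧ j = 0 then weight (Q ⟨i, h.1⟩) else 0)
    else if a = 5 then
      (if h : i < m then (((dom (Q ⟨i, h⟩)).sort (· ≤ ·)).map fun q => (q : ℕ)).getD j 0 else 0)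
    else if a = 6 then
      (if h : i < m then
        (((dom (Q ⟨i, h⟩)).sort (· ≤ ·)).map fun q => (Q ⟨i, h⟩ q : ℕ)).getD j 0 else 0)
    else σ.nat a i j
  real a i j :=
    if a = 1 then (if h : i < m ∧ j = 0 then (pauliCoeff (Q ⟨i, h.1⟩) O).re else 0)
    else σ.real a i j

/-- The Pauli observable described by a list of pairs (qubit, label). -/
def decode (n : ℕ) {w : ℕ} (L : Fin w → ℕ × ℕ) : PauliString n :=
  fun i => Fin.ofNat 4 (∑ s with (L s).1 = (i : ℕ), (L s).2)

/-- Access to the reduced density matrices of `ρ` on at most `k` qubits: the answer to a query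
is `tr (P ρ)` if the Pauli observable `P` has weight at most `k`. -/
def stateOracle {n : ℕ} (ρ : Op n) (k : ℕ) : RAM.Oracle := fun _ L =>
  if weight (decode n L) ≤ k then (pauliOp (decode n L) * ρ).trace.re else 0

/-- The oracle without information. -/
def noOracle : RAM.Oracle := fun _ _ => 0

/-- The result of a computation, in the real array `2`. -/
def output (σ : RAM.Store) : ℝ := σ.real 2 0 0

/-- The bound `C k n^k N` on running times, with `k = ⌈log_{1.5} (1/ε)⌉`. -/
def timeBound (C : ℝ) (n N : ℕ) (ε : ℝ) : ℝ := C * (degree ε * (n : ℝ) ^ degree ε * N)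

end

end QEvo

open QEvo

/-!
The learned function has degree `K = k` and the filter parameter `τ = (b y)^{-10 (k + 1)}` with
`y = min (k / min ε' 1) n`, where `b` depends on `κ, d` only.

*Accuracy.* Let `M = E†(O)` with Pauli coefficients `α_P`. Over a random experiment, the estimator
behind `x̂_P(O)` has mean `3^{-|P|} α_P`; since it is linear in `O`, Hoeffding's inequality for the
Pauli observables `Q` of weight at most `κ` and a union bound give `|x̂_P(O) - 3^{-|P|} α_P| ≤ η τ`
for all `O` at once (`le_shadowProb_goodShadows`, `abs_xHat_sub_le`). The filter then makes the
error of a coefficient at most `min (α_P²) (9 · 3^k η² τ)` (`sq_alphaHat_sub_le`). Local flatness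
makes the random variables `tr (P ρ)` orthogonal with second moment at most `(2/3)^{|P|}`
(`integral_sq_sum_pauliExp_le`): by the symmetries `X, Z` and `S, H` this follows from the bound on
the purity of reduced states. So the levels above `k` cost at most `2ε/3`, and the levels below are
summed with a Bohnenblust–Hille type inequality of weak type (`sum_min_sq_le_rpow`).

That inequality, and the bound of `η` by the spectral norm (`IsBoundedDegree.pauliL1_le`), rest on
influences. The function `s ↦ tr (M |s⟩⟨s|)` on product stabilizer states is a polynomial in local
variables. Along the segment from `|s⟩` to a partly depolarized state it is a polynomial of degree
`k` in one variable that is bounded by `‖M‖`, so Markov's inequality (on Chebyshev extremality)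
bounds the sum of the `L¹` influences by `2 k² ‖M‖`, and hypercontractivity
(`sum_stabPoly_pow_four_le`) turns `L¹` into `L²` influences. Only few qubits are influential; the
Pauli observables supported on them are few, the other ones have small total square sum.

*Running time.* Training enumerates the Pauli observables of weight at most `k` by a breadth-first
search, in which each one is extended by a factor after its last qubit (`exists_queue_complete`).
A new row of the table is obtained from that of its parent in time `O(k + N)`, and there are at
most `21 n^k` rows (`card_weight_le`). Prediction computes the shadow of `O` in each experiment from
the `O(n)` terms of `O`, and then the estimate for each row in time `O(k + N)`. The correctness of
the programs is proved with loop invariants, for the predicate `RAM.Runs` that bounds the number of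
steps; `RAM.Frame` provides the cells that a program leaves alone.
-/


namespace QEvo

noncomputable section

section


/-! ### One-qubit identities -/

/-- The expectation value `⟨s| P_a |s⟩` of the one-qubit Pauli observable with label `a` in the
stabilizer state with label `s`. -/
def stabExp : Fin 4 → Fin 6 → ℝ :=
  ![![1, 1, 1, 1, 1, 1], ![0, 0, 1, -1, 0, 0], ![0, 0, 0, 0, 1, -1], ![1, -1, 0, 0, 0, 0]]

theorem ofReal_sqrt_two_mul_self : ((√2 : ℝ) : ℂ) * ((√2 : ℝ) : ℂ) = 2 := by
  rw [← Complex.ofReal_mul, Real.mul_self_sqrt (by norm_num)]; norm_num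

/-- The Bloch representation of the stabilizer states. -/
theorem stabProj_eq (s : Fin 6) :
    stabProj s = (1 / 2 : ℂ) • ∑ a, ((stabExp a s : ℝ) : ℂ) • pauli a := by
  have h2 := ofReal_sqrt_two_mul_self
  have h3 : (((√2 : ℝ) : ℂ))⁻¹ * (((√2 : ℝ) : ℂ))⁻¹ = 1 / 2 := by
    rw [← mul_inv, h2]; norm_num
  ext i j
  fin_cases s <;> fin_cases i <;> fin_cases j <;>
    simp [stabProj, stabKet, stabExp, pauli, Fin.sum_univ_four, Matrix.vecMulVec_apply, h3,
      div_eq_mul_inv, mul_mul_mul_comm, -Matrix.smul_of, -mul_eq_mul_left_iff] <;>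
    (ring_nf; try (rw [inv_pow, pow_two, h2]; ring))

theorem trace_pauli_mul_pauli (a b : Fin 4) :
    (pauli a * pauli b).trace = if a = b then 2 else 0 := by
  fin_cases a <;> fin_cases b <;>
    simp [pauli, Matrix.trace, Fin.sum_univ_two, one_add_one_eq_two]

theorem trace_pauli (a : Fin 4) : (pauli a).trace = if a = 0 then 2 else 0 := by
  have := trace_pauli_mul_pauli a 0
  rwa [show pauli 0 = 1 from rfl, mul_one] at this

theorem pauli_conjTranspose (a : Fin 4) : (pauli a)ᴴ = pauli a := by
  ext i j
  fin_cases a <;> fin_cases i <;> fin_cases j <;> simp [pauli]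

/-- Completeness of the Pauli basis. -/
theorem sum_pauli_mul_pauli (x y z w : Fin 2) :
    ∑ a, pauli a x y * pauli a z w = if x = w ∧ y = z then 2 else 0 := by
  fin_cases x <;> fin_cases y <;> fin_cases z <;> fin_cases w <;>
    simp [pauli, Fin.sum_univ_four, one_add_one_eq_two]

theorem trace_pauli_mul_stabProj (a : Fin 4) (s : Fin 6) :
    (pauli a * stabProj s).trace = (stabExp a s : ℝ) := by
  rw [stabProj_eq]
  simp [Matrix.trace_sum, trace_pauli_mul_pauli, Finset.mul_sum]
  ring

theorem stabExp_zero (s : Fin 6) : stabExp 0 s = 1 := by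
  fin_cases s <;> rfl

theorem abs_stabExp_le_one (a : Fin 4) (s : Fin 6) : |stabExp a s| ≤ 1 := by
  fin_cases a <;> fin_cases s <;> simp [stabExp]

theorem trace_stabProj (s : Fin 6) : (stabProj s).trace = 1 := by
  have := trace_pauli_mul_stabProj 0 s
  rwa [show pauli 0 = 1 from rfl, one_mul, stabExp_zero, Complex.ofReal_one] at this

theorem trace_pauli_mul_shadow (a : Fin 4) (s : Fin 6) :
    (pauli a * ((3 : ℂ) • stabProj s - 1)).trace =
      (((if a = 0 then 1 else 3) * stabExp a s : ℝ) : ℂ) := by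
  rw [mul_sub, mul_one, Matrix.trace_sub, trace_pauli, Matrix.mul_smul, Matrix.trace_smul,
    trace_pauli_mul_stabProj]
  by_cases h : a = 0
  · subst h; rw [stabExp_zero]; norm_num
  · simp [h]

/-- The second moments of the single-qubit shadow. -/
theorem sum_stabExp_mul_stabExp (a b : Fin 4) :
    ∑ s, stabExp a s * stabExp b s = if a = b then 6 * (if a = 0 then 1 else 1 / 3) else 0 := by
  fin_cases a <;> fin_cases b <;> simp [stabExp, Fin.sum_univ_six] <;> norm_num

theorem sum_stabExp_smul_stabProj (a : Fin 4) :
    ∑ s, ((stabExp a s : ℝ) : ℂ) • stabProj s =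
      (((if a = 0 then 1 else 1 / 3 : ℝ) : ℂ) * 3) • pauli a := by
  simp_rw [stabProj_eq, Finset.smul_sum, smul_smul]
  rw [Finset.sum_comm]
  have : ∀ b : Fin 4, ∑ s : Fin 6, (((stabExp a s : ℝ) : ℂ) * (1 / 2) * ((stabExp b s : ℝ) : ℂ)) •
      pauli b = (((∑ s, stabExp a s * stabExp b s : ℝ) : ℂ) / 2) • pauli b := by
    intro b
    rw [← Finset.sum_smul]
    congr 1
    push_cast
    rw [Finset.sum_div]
    exact Finset.sum_congr rfl fun s _ => by ring
  simp only [mul_assoc] at this ⊢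
  simp_rw [this, sum_stabExp_mul_stabExp]
  rw [Finset.sum_eq_single a]
  · congr 1
    rw [if_pos rfl]
    split_ifs <;> push_cast <;> norm_num
  · intro b _ hb
    simp [Ne.symm hb]
  · simp

/-! ### Tensor products -/

variable {n : ℕ}

theorem tensorOp_mul (A B : Fin n → Matrix (Fin 2) (Fin 2) ℂ) :
    tensorOp A * tensorOp B = tensorOp fun i => A i * B i := by
  ext x y
  simp only [tensorOp, Matrix.mul_apply, Matrix.of_apply]
  rw [Finset.prod_univ_sum]
  simp [Finset.prod_mul_distrib]

theorem trace_tensorOp (A : Fin n → Matrix (Fin 2) (Fin 2) ℂ) :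
    (tensorOp A).trace = ∏ i, (A i).trace := by
  simp only [tensorOp, Matrix.trace, Matrix.diag, Matrix.of_apply]
  rw [Finset.prod_univ_sum]
  simp

theorem tensorOp_conjTranspose (A : Fin n → Matrix (Fin 2) (Fin 2) ℂ) :
    (tensorOp A)ᴴ = tensorOp fun i => (A i)ᴴ := by
  ext x y
  simp [tensorOp]

theorem tensorOp_one : tensorOp (fun _ : Fin n => (1 : Matrix (Fin 2) (Fin 2) ℂ)) = 1 := by
  ext x y
  simp only [tensorOp, Matrix.of_apply, Matrix.one_apply]
  by_cases h : x = y
  · simp [h]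
  · obtain ⟨i, hi⟩ := Function.ne_iff.mp h
    rw [if_neg h]
    exact Finset.prod_eq_zero (Finset.mem_univ i) (if_neg hi)

/-- Multilinearity of the tensor product. -/
theorem tensorOp_sum_smul {ι : Type*} [Fintype ι] [DecidableEq ι] (c : Fin n → ι → ℂ)
    (A : Fin n → ι → Matrix (Fin 2) (Fin 2) ℂ) :
    tensorOp (fun i => ∑ a, c i a • A i a) =
      ∑ p : Fin n → ι, (∏ i, c i (p i)) • tensorOp fun i => A i (p i) := by
  ext x y
  simp only [tensorOp, Matrix.of_apply, Matrix.sum_apply, Matrix.smul_apply, smul_eq_mul]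
  rw [Finset.prod_univ_sum]
  simp [Finset.prod_mul_distrib]

theorem tensorOp_smul (c : Fin n → ℂ) (A : Fin n → Matrix (Fin 2) (Fin 2) ℂ) :
    tensorOp (fun i => c i • A i) = (∏ i, c i) • tensorOp A := by
  ext x y
  simp [tensorOp, Finset.prod_mul_distrib]

open scoped MatrixOrder in
theorem tensorOp_posSemidef {A : Fin n → Matrix (Fin 2) (Fin 2) ℂ}
    (hA : ∀ i, (A i).PosSemidef) : (tensorOp A).PosSemidef := by
  choose B hB using fun i => (CStarAlgebra.nonneg_iff_eq_star_mul_self (a := A i)).mp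
    (Matrix.nonneg_iff_posSemidef.mpr (hA i))
  have : tensorOp A = (tensorOp B)ᴴ * tensorOp B := by
    rw [tensorOp_conjTranspose, tensorOp_mul]
    exact congrArg tensorOp (funext hB)
  rw [this]
  exact Matrix.posSemidef_conjTranspose_mul_self _

/-! ### The Pauli expansion -/

theorem trace_pauliOp_mul_pauliOp (P Q : PauliString n) :
    (pauliOp P * pauliOp Q).trace = if P = Q then 2 ^ n else 0 := by
  simp only [pauliOp, tensorOp_mul, trace_tensorOp, trace_pauli_mul_pauli]
  by_cases h : P = Q
  · simp [h]
  · obtain ⟨i, hi⟩ := Function.ne_iff.mp h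
    rw [if_neg h]
    exact Finset.prod_eq_zero (Finset.mem_univ i) (if_neg hi)

theorem pauliOp_conjTranspose (P : PauliString n) : (pauliOp P)ᴴ = pauliOp P := by
  simp [pauliOp, tensorOp_conjTranspose, pauli_conjTranspose]

theorem sum_pauliOp_mul_pauliOp (x y z w : Fin n → Fin 2) :
    ∑ P : PauliString n, pauliOp P x y * pauliOp P z w =
      if x = w ∧ y = z then 2 ^ n else 0 := by
  simp only [pauliOp, tensorOp, Matrix.of_apply, ← Finset.prod_mul_distrib]
  have := Finset.prod_univ_sum (fun _ : Fin n => (Finset.univ : Finset (Fin 4)))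
    (fun i a => pauli a (x i) (y i) * pauli a (z i) (w i))
  rw [Fintype.piFinset_univ] at this
  rw [← this]
  simp only [sum_pauli_mul_pauli]
  by_cases h : x = w ∧ y = z
  · simp [h]
  · rw [if_neg h]
    rw [not_and_or] at h
    rcases h with h | h
    · obtain ⟨i, hi⟩ := Function.ne_iff.mp h
      exact Finset.prod_eq_zero (Finset.mem_univ i) (if_neg fun h => hi h.1)
    · obtain ⟨i, hi⟩ := Function.ne_iff.mp h
      exact Finset.prod_eq_zero (Finset.mem_univ i) (if_neg fun h => hi h.2)

theorem sum_pauliCoeff_smul (M : Op n) : ∑ P : PauliString n, pauliCoeff P M • pauliOp P = M := by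
  ext x y
  simp only [Matrix.sum_apply, Matrix.smul_apply, smul_eq_mul, pauliCoeff, Matrix.trace,
    Matrix.diag, Matrix.mul_apply, Finset.sum_div, Finset.sum_mul]
  rw [Finset.sum_comm]
  simp_rw [Finset.sum_comm (s := (Finset.univ : Finset (PauliString n)))]
  have h : ∀ z w : Fin n → Fin 2, ∑ P : PauliString n,
      pauliOp P z w * M w z / 2 ^ n * pauliOp P x y =
        if z = y ∧ w = x then M w z else 0 := by
    intro z w
    have h2 : (2 : ℂ) ^ n ≠ 0 := by positivity
    calc _ = (∑ P : PauliString n, pauliOp P z w * pauliOp P x y) * (M w z / 2 ^ n) := by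
            rw [Finset.sum_mul]; exact Finset.sum_congr rfl fun _ _ => by ring
      _ = _ := by
            rw [sum_pauliOp_mul_pauliOp]; split_ifs
            · field_simp
            · simp
  simp_rw [h]
  rw [Finset.sum_eq_single y, Finset.sum_eq_single x] <;> simp +contextual

theorem pauliCoeff_sum_smul (c : PauliString n → ℂ) (P : PauliString n) :
    pauliCoeff P (∑ Q, c Q • pauliOp Q) = c P := by
  simp [pauliCoeff, Matrix.mul_sum, Matrix.trace_sum, trace_pauliOp_mul_pauliOp]

theorem lowDegree_eq (k : ℕ) (M : Op n) :
    lowDegree k M = ∑ P, (if weight P ≤ k then pauliCoeff P M else 0) • pauliOp P := by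
  rw [lowDegree, Finset.sum_filter]
  exact Finset.sum_congr rfl fun P _ => by split_ifs <;> simp

theorem pauliCoeff_lowDegree (k : ℕ) (M : Op n) (P : PauliString n) :
    pauliCoeff P (lowDegree k M) = if weight P ≤ k then pauliCoeff P M else 0 := by
  rw [lowDegree_eq, pauliCoeff_sum_smul]

theorem pauliCoeff_sum {ι : Type*} (P : PauliString n) (s : Finset ι) (A : ι → Op n) :
    pauliCoeff P (∑ i ∈ s, A i) = ∑ i ∈ s, pauliCoeff P (A i) := by
  simp [pauliCoeff, Matrix.mul_sum, Matrix.trace_sum, Finset.sum_div]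

theorem trace_mul_eq_sum_pauliCoeff (A B : Op n) :
    (A * B).trace = ∑ P, pauliCoeff P A * (pauliOp P * B).trace := by
  conv_lhs => rw [← sum_pauliCoeff_smul A]
  simp [Finset.sum_mul, Matrix.trace_sum]

/-- Parseval's identity for the Pauli expansion of a Hermitian operator. -/
theorem trace_mul_self_eq (M : Op n) :
    (M * M).trace = 2 ^ n * ∑ P, pauliCoeff P M * pauliCoeff P M := by
  rw [trace_mul_eq_sum_pauliCoeff, Finset.mul_sum]
  refine Finset.sum_congr rfl fun P _ => ?_
  rw [pauliCoeff]
  have h2 : (2 : ℂ) ^ n ≠ 0 := by positivity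
  field_simp

theorem trace_mul_im_eq_zero {A B : Op n} (hA : A.IsHermitian) (hB : B.IsHermitian) :
    (A * B).trace.im = 0 := by
  have h : star (A * B).trace = (A * B).trace := by
    rw [← Matrix.trace_conjTranspose, Matrix.conjTranspose_mul, hA.eq, hB.eq, Matrix.trace_mul_comm]
  exact Complex.conj_eq_iff_im.mp h

theorem pauliOp_isHermitian (P : PauliString n) : (pauliOp P).IsHermitian :=
  pauliOp_conjTranspose P

theorem pauliCoeff_eq_re {M : Op n} (hM : M.IsHermitian) (P : PauliString n) :
    pauliCoeff P M = ((pauliCoeff P M).re : ℂ) := by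
  have h : (pauliCoeff P M).im = 0 := by
    rw [pauliCoeff, show (2 : ℂ) ^ n = ((2 ^ n : ℝ) : ℂ) by push_cast; rfl, Complex.div_ofReal_im,
      trace_mul_im_eq_zero (pauliOp_isHermitian P) hM, zero_div]
  exact Complex.ext rfl (by simp [h])

theorem isHermitian_of_pauliCoeff_real {M : Op n} (h : ∀ P, (pauliCoeff P M).im = 0) :
    M.IsHermitian := by
  rw [Matrix.IsHermitian, ← sum_pauliCoeff_smul M, Matrix.conjTranspose_sum]
  refine Finset.sum_congr rfl fun P _ => ?_
  rw [Matrix.conjTranspose_smul, pauliOp_conjTranspose]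
  congr 1
  exact Complex.conj_eq_iff_im.mpr (h P)

end

section


/-! ### Norms and expectation values -/

variable {n : ℕ}

theorem norm_trace_mul_le_opNorm (M : Op n) {ρ : Op n} (hρ : IsState ρ) :
    ‖(M * ρ).trace‖ ≤ opNorm M := by
  obtain ⟨m, v, hv⟩ := Matrix.posSemidef_iff_eq_sum_vecMulVec.mp hρ.1
  have key : ∀ w : (Fin n → Fin 2) → ℂ, (M * Matrix.vecMulVec w (star w)).trace =
      inner ℂ (WithLp.toLp 2 w) (Matrix.toEuclideanCLM (𝕜 := ℂ) M (WithLp.toLp 2 w)) := by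
    intro w
    rw [Matrix.mul_vecMulVec, Matrix.trace_vecMulVec, EuclideanSpace.inner_eq_star_dotProduct]
    rfl
  have h1 : ∑ i, ‖WithLp.toLp 2 (v i)‖ ^ 2 = 1 := by
    have := hρ.2
    rw [hv, Matrix.trace_sum] at this
    have h2 : ∀ i, (Matrix.vecMulVec (v i) (star (v i))).trace =
        ((‖WithLp.toLp 2 (v i)‖ ^ 2 : ℝ) : ℂ) := by
      intro i
      rw [Matrix.trace_vecMulVec]
      have := inner_self_eq_norm_sq_to_K (𝕜 := ℂ) (WithLp.toLp 2 (v i))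
      rw [EuclideanSpace.inner_eq_star_dotProduct] at this
      rw [this]; push_cast; rfl
    simp_rw [h2] at this
    exact_mod_cast this
  rw [hv, Finset.mul_sum, Matrix.trace_sum]
  calc ‖∑ i, (M * Matrix.vecMulVec (v i) (star (v i))).trace‖
      ≤ ∑ i, ‖(M * Matrix.vecMulVec (v i) (star (v i))).trace‖ := norm_sum_le _ _
    _ ≤ ∑ i, opNorm M * ‖WithLp.toLp 2 (v i)‖ ^ 2 := by
        refine Finset.sum_le_sum fun i _ => ?_
        rw [key]
        refine (norm_inner_le_norm _ _).trans ?_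
        have := (Matrix.toEuclideanCLM (𝕜 := ℂ) M).le_opNorm (WithLp.toLp 2 (v i))
        calc _ ≤ ‖WithLp.toLp 2 (v i)‖ * (opNorm M * ‖WithLp.toLp 2 (v i)‖) := by
              gcongr; exact this
          _ = _ := by ring
    _ = opNorm M := by rw [← Finset.mul_sum, h1, mul_one]

/-- `B` bounds the expectation value of `M` in every state. -/
def StateBound (M : Op n) (B : ℝ) : Prop := ∀ ρ, IsState ρ → |(M * ρ).trace.re| ≤ B

theorem stateBound_opNorm (M : Op n) : StateBound M (opNorm M) := fun _ hρ =>
  (Complex.abs_re_le_norm _).trans (norm_trace_mul_le_opNorm M hρ)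

theorem opNorm_nonneg (M : Op n) : 0 ≤ opNorm M := norm_nonneg _

theorem isState_vecMulVec {v : EuclideanSpace ℂ (Fin n → Fin 2)} (hv : ‖v‖ = 1) :
    IsState (Matrix.vecMulVec (WithLp.ofLp v) (star (WithLp.ofLp v)) : Op n) := by
  refine ⟨Matrix.posSemidef_vecMulVec_self_star _, ?_⟩
  rw [Matrix.trace_vecMulVec]
  have := inner_self_eq_norm_sq_to_K (𝕜 := ℂ) v
  rw [EuclideanSpace.inner_eq_star_dotProduct] at this
  rw [this, hv]; simp

/-- The normalized Hilbert–Schmidt norm is at most the largest expectation value. -/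
theorem sum_pauliCoeff_re_sq_le {M : Op n} (hM : M.IsHermitian) {B : ℝ} (hB : StateBound M B) :
    ∑ P, (pauliCoeff P M).re ^ 2 ≤ B ^ 2 := by
  have hev : ∀ i, |hM.eigenvalues i| ≤ B := by
    intro i
    have h := hB _ (isState_vecMulVec (hM.eigenvectorBasis.orthonormal.1 i))
    rw [Matrix.mul_vecMulVec, Matrix.trace_vecMulVec] at h
    rw [hM.eigenvalues_eq i, dotProduct_comm]
    exact h
  have htr : (M * M).trace = ((∑ i, hM.eigenvalues i ^ 2 : ℝ) : ℂ) := by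
    have h := hM.spectral_theorem
    have h2 : M * M = Unitary.conjStarAlgAut ℂ _ hM.eigenvectorUnitary
        (Matrix.diagonal (RCLike.ofReal ∘ hM.eigenvalues) *
          Matrix.diagonal (RCLike.ofReal ∘ hM.eigenvalues)) := by
      rw [map_mul, ← h]
    rw [h2, Unitary.conjStarAlgAut_apply, Matrix.trace_mul_comm, ← mul_assoc,
      Unitary.coe_star_mul_self, one_mul, Matrix.diagonal_mul_diagonal, Matrix.trace_diagonal]
    simp [pow_two]
  have h3 : (2 : ℝ) ^ n * ∑ P, (pauliCoeff P M).re ^ 2 = ∑ i, hM.eigenvalues i ^ 2 := by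
    have h := trace_mul_self_eq M
    rw [htr] at h
    have h4 : ∀ P, pauliCoeff P M * pauliCoeff P M = (((pauliCoeff P M).re ^ 2 : ℝ) : ℂ) := by
      intro P
      rw [pauliCoeff_eq_re hM P]; simp [pow_two]
    simp_rw [h4] at h
    exact_mod_cast h.symm
  have h5 : ∑ i, hM.eigenvalues i ^ 2 ≤ (2 : ℝ) ^ n * B ^ 2 := by
    calc _ ≤ ∑ _i : Fin n → Fin 2, B ^ 2 :=
          Finset.sum_le_sum fun i _ => sq_le_sq' (neg_le_of_abs_le (hev i)) (le_of_abs_le (hev i))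
      _ = _ := by simp
  rw [← h3] at h5
  exact le_of_mul_le_mul_left h5 (by positivity)

theorem isState_tensorOp {A : Fin n → Matrix (Fin 2) (Fin 2) ℂ}
    (hA : ∀ i, (A i).PosSemidef ∧ (A i).trace = 1) : IsState (tensorOp A) :=
  ⟨tensorOp_posSemidef fun i => (hA i).1, by simp [trace_tensorOp, hA]⟩

theorem stabProj_posSemidef (s : Fin 6) : (stabProj s).PosSemidef :=
  Matrix.posSemidef_vecMulVec_self_star _

theorem stabProd_isState (s : Fin n → Fin 6) : IsState (stabProd s) :=
  isState_tensorOp fun _ => ⟨stabProj_posSemidef _, trace_stabProj _⟩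

/-- The state with Bloch vector shrunk by a factor `u ∈ [-1, 1]`. -/
theorem depolarized_isState {u : ℝ} (hu : u ∈ Set.Icc (-1 : ℝ) 1) (s : Fin 6) :
    ((u : ℂ) • stabProj s + (((1 - u) / 2 : ℝ) : ℂ) • (1 : Matrix (Fin 2) (Fin 2) ℂ)).PosSemidef ∧
    ((u : ℂ) • stabProj s +
      (((1 - u) / 2 : ℝ) : ℂ) • (1 : Matrix (Fin 2) (Fin 2) ℂ)).trace = 1 := by
  constructor
  · -- the orthogonal state `1 - |s⟩⟨s|` is again a stabilizer state
    have hperp : (1 - stabProj s).PosSemidef := by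
      have : stabProj (![1, 0, 3, 2, 5, 4] s) = 1 - stabProj s := by
        rw [stabProj_eq, stabProj_eq]
        ext i j
        fin_cases s <;> fin_cases i <;> fin_cases j <;>
          simp [stabExp, Fin.sum_univ_four, pauli] <;> ring
      rw [← this]; exact stabProj_posSemidef _
    have h1 : ((u : ℂ) • stabProj s +
        (((1 - u) / 2 : ℝ) : ℂ) • (1 : Matrix (Fin 2) (Fin 2) ℂ)) =
        (((1 + u) / 2 : ℝ) : ℂ) • stabProj s + (((1 - u) / 2 : ℝ) : ℂ) • (1 - stabProj s) := by
      push_cast; module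
    rw [h1]
    refine Matrix.PosSemidef.add ((stabProj_posSemidef s).smul ?_) (hperp.smul ?_)
    · exact_mod_cast (by linarith [hu.1] : 0 ≤ (1 + u) / 2)
    · exact_mod_cast (by linarith [hu.2] : 0 ≤ (1 - u) / 2)
  · rw [Matrix.trace_add, Matrix.trace_smul, Matrix.trace_smul, trace_stabProj, Matrix.trace_one]
    simp

/-! ### The functions `s ↦ tr (P |s⟩⟨s|)` -/

/-- The expectation value of the Pauli observable `P` in the product stabilizer state `s`. -/
def stabChar (P : PauliString n) (s : Fin n → Fin 6) : ℝ := ∏ i, stabExp (P i) (s i)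

theorem trace_pauliOp_mul_stabProd (P : PauliString n) (s : Fin n → Fin 6) :
    (pauliOp P * stabProd s).trace = (stabChar P s : ℝ) := by
  simp [pauliOp, stabProd, tensorOp_mul, trace_tensorOp, trace_pauli_mul_stabProj, stabChar]

theorem abs_stabChar_le_one (P : PauliString n) (s : Fin n → Fin 6) : |stabChar P s| ≤ 1 := by
  rw [stabChar, Finset.abs_prod]
  exact Finset.prod_le_one (fun _ _ => abs_nonneg _) fun _ _ => abs_stabExp_le_one _ _

theorem prod_ite_eq_pow_weight (P : PauliString n) (c : ℝ) :
    ∏ i, (if P i = 0 then 1 else c) = c ^ weight P := by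
  simp [weight, dom, Finset.prod_ite]

theorem sum_stabChar_mul_stabChar (P Q : PauliString n) :
    ∑ s, stabChar P s * stabChar Q s = if P = Q then 6 ^ n * (1 / 3) ^ weight P else 0 := by
  simp only [stabChar, ← Finset.prod_mul_distrib]
  have := Finset.prod_univ_sum (fun _ : Fin n => (Finset.univ : Finset (Fin 6)))
    (fun i a => stabExp (P i) a * stabExp (Q i) a)
  rw [Fintype.piFinset_univ] at this
  rw [← this]
  simp only [sum_stabExp_mul_stabExp]
  by_cases h : P = Q
  · simp only [h, if_true]
    rw [Finset.prod_mul_distrib, prod_ite_eq_pow_weight]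
    simp
  · obtain ⟨i, hi⟩ := Function.ne_iff.mp h
    rw [if_neg h]
    exact Finset.prod_eq_zero (Finset.mem_univ i) (if_neg hi)

/-- Averaging `tr (P ψ) ψ` over the product stabilizer states `ψ` gives back `P` up to a factor. -/
theorem sum_stabChar_smul_stabProd (P : PauliString n) :
    ∑ s, ((stabChar P s : ℝ) : ℂ) • (stabProd s : Op n) =
      ((((1 / 3) ^ weight P * 3 ^ n : ℝ)) : ℂ) • pauliOp P := by
  have h := tensorOp_sum_smul (n := n) (fun i a => ((stabExp (P i) a : ℝ) : ℂ))
    (fun _ a => stabProj a)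
  simp only [sum_stabExp_smul_stabProj] at h
  rw [tensorOp_smul] at h
  simp only [stabChar, stabProd, Complex.ofReal_prod]
  rw [← h, pauliOp]
  congr 1
  rw [Finset.prod_mul_distrib, ← prod_ite_eq_pow_weight]
  simp

end

section


/-! ### Influences -/

variable {n : ℕ}

/-- The function `s ↦ ∑_P β_P tr (P |s⟩⟨s|)` on product stabilizer states. -/
def stabPoly (β : PauliString n → ℝ) (s : Fin n → Fin 6) : ℝ := ∑ P, β P * stabChar P s

/-- The part of `β` that acts nontrivially on qubit `a`. -/
def partAt (a : Fin n) (β : PauliString n → ℝ) (P : PauliString n) : ℝ :=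
  if P a ≠ 0 then β P else 0

theorem weight_eq_sum (P : PauliString n) : weight P = ∑ a, if P a ≠ 0 then 1 else 0 := by
  rw [weight, dom, Finset.card_filter]

theorem stabChar_zero (s : Fin n → Fin 6) : stabChar 0 s = 1 := by
  simp [stabChar, stabExp_zero]

theorem weight_zero : weight (0 : PauliString n) = 0 := by simp [weight, dom]

theorem sum_stabPoly_mul_stabChar (β : PauliString n → ℝ) (P : PauliString n) :
    ∑ s, stabPoly β s * stabChar P s = 6 ^ n * ((1 / 3) ^ weight P * β P) := by
  simp only [stabPoly, Finset.sum_mul]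
  rw [Finset.sum_comm]
  simp only [mul_assoc, ← Finset.mul_sum, sum_stabChar_mul_stabChar]
  simp
  ring

theorem sum_stabPoly (β : PauliString n → ℝ) : ∑ s, stabPoly β s = 6 ^ n * β 0 := by
  simpa [stabChar_zero, weight_zero] using sum_stabPoly_mul_stabChar β 0

theorem sum_stabPoly_sq (β : PauliString n → ℝ) :
    ∑ s, stabPoly β s ^ 2 = 6 ^ n * ∑ P, (1 / 3) ^ weight P * β P ^ 2 := by
  have : ∀ s, stabPoly β s ^ 2 = ∑ P, β P * (stabPoly β s * stabChar P s) := by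
    intro s
    rw [pow_two]
    conv_lhs => rw [stabPoly, Finset.sum_mul]
    exact Finset.sum_congr rfl fun P _ => by rw [stabPoly]; ring
  simp_rw [this]
  rw [Finset.sum_comm, Finset.mul_sum]
  refine Finset.sum_congr rfl fun P _ => ?_
  rw [← Finset.mul_sum, sum_stabPoly_mul_stabChar]
  ring

/-- Shrinking the Bloch vectors of the qubits in `A` by a factor `u` leaves a state. -/
theorem abs_sum_pow_mul_stabChar_le {M : Op n} {B : ℝ} (hB : StateBound M B)
    (A : Finset (Fin n)) (s : Fin n → Fin 6) {u : ℝ} (hu : u ∈ Set.Icc (-1 : ℝ) 1) :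
    |∑ P, (pauliCoeff P M).re * stabChar P s * u ^ (dom P ∩ A).card| ≤ B := by
  set ρ : Op n := tensorOp fun i => if i ∈ A then
    (u : ℂ) • stabProj (s i) + (((1 - u) / 2 : ℝ) : ℂ) • (1 : Matrix (Fin 2) (Fin 2) ℂ)
    else stabProj (s i) with hρ
  have hst : IsState ρ := by
    refine isState_tensorOp fun i => ?_
    split_ifs
    · exact depolarized_isState hu _
    · exact ⟨stabProj_posSemidef _, trace_stabProj _⟩
  have h1 : ∀ P, (pauliOp P * ρ).trace = ((stabChar P s * u ^ (dom P ∩ A).card : ℝ) : ℂ) := by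
    intro P
    rw [hρ, pauliOp, tensorOp_mul, trace_tensorOp]
    have h2 : u ^ (dom P ∩ A).card = ∏ i, if P i ≠ 0 ∧ i ∈ A then u else 1 := by
      rw [Finset.prod_ite, Finset.prod_const, Finset.prod_const_one, mul_one]
      congr 2
      ext i
      simp [dom]
    rw [h2, stabChar, ← Finset.prod_mul_distrib, Complex.ofReal_prod]
    refine Finset.prod_congr rfl fun i _ => ?_
    by_cases hi : i ∈ A
    · simp only [hi, if_true, and_true]
      rw [mul_add, Matrix.trace_add, Matrix.mul_smul, Matrix.mul_smul, Matrix.trace_smul,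
        Matrix.trace_smul, trace_pauli_mul_stabProj, mul_one, trace_pauli]
      by_cases hz : P i = 0
      · simp [hz, stabExp_zero]
      · simp [hz, mul_comm]
    · simp [hi, trace_pauli_mul_stabProj]
  have h3 := hB ρ hst
  rw [trace_mul_eq_sum_pauliCoeff] at h3
  simp_rw [h1] at h3
  convert h3 using 2
  rw [Complex.re_sum]
  refine Finset.sum_congr rfl fun P _ => ?_
  rw [Complex.re_mul_ofReal]; ring

/-- The derivative bound for polynomials of degree `k` at an endpoint, applied to the dependence
of the expectation value on the Bloch vectors of the qubits in `A`. -/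
theorem sum_stabPoly_partAt_le {M : Op n} (hM : M.IsHermitian) {B : ℝ} (hB : StateBound M B)
    {k : ℕ} (hk : ∀ P, k < weight P → (pauliCoeff P M).re = 0) (A : Finset (Fin n))
    (s : Fin n → Fin 6) :
    ∑ a ∈ A, stabPoly (partAt a fun P => (pauliCoeff P M).re) s ≤ k ^ 2 * B := by
  set β : PauliString n → ℝ := fun P => (pauliCoeff P M).re with hβ
  have hsum : ∑ a ∈ A, stabPoly (partAt a β) s =
      ∑ P, β P * stabChar P s * (dom P ∩ A).card := by
    simp only [stabPoly]
    rw [Finset.sum_comm]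
    refine Finset.sum_congr rfl fun P _ => ?_
    have : (((dom P ∩ A).card : ℕ) : ℝ) = ∑ a ∈ A, if P a ≠ 0 then (1 : ℝ) else 0 := by
      rw [Finset.sum_ite, Finset.sum_const_zero, add_zero, Finset.sum_const, nsmul_one]
      congr 2
      ext i
      simp [dom, and_comm]
    rw [this, Finset.mul_sum]
    refine Finset.sum_congr rfl fun a _ => ?_
    simp only [partAt]
    split_ifs <;> simp
  have hB0 : 0 ≤ B := (abs_nonneg _).trans (hB _ (stabProd_isState s))
  rcases hB0.eq_or_lt with hB0 | hB0
  · have h0 : ∀ P, β P = 0 := by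
      intro P
      have h := sum_pauliCoeff_re_sq_le hM hB
      rw [← hB0] at h
      have h2 := Finset.single_le_sum (f := fun P => (pauliCoeff P M).re ^ 2)
        (fun P _ => sq_nonneg _) (Finset.mem_univ P)
      exact pow_eq_zero_iff (two_ne_zero) |>.mp (le_antisymm (by linarith) (sq_nonneg _))
    rw [hsum]
    simp [h0, ← hB0]
  · set p : Polynomial ℝ :=
      ∑ P, Polynomial.C (β P * stabChar P s / B) * Polynomial.X ^ (dom P ∩ A).card with hp
    have hdeg : p.degree ≤ k := by
      refine (Polynomial.degree_sum_le _ _).trans (Finset.sup_le fun P _ => ?_)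
      by_cases hw : weight P ≤ k
      · refine (Polynomial.degree_C_mul_X_pow_le _ _).trans ?_
        exact_mod_cast (Finset.card_le_card Finset.inter_subset_left).trans hw
      · simp [hβ, hk P (by omega)]
    have hbd : ∀ x ∈ Set.Icc (-1 : ℝ) 1, |p.eval x| ≤ 1 := by
      intro x hx
      have : p.eval x = (∑ P, β P * stabChar P s * x ^ (dom P ∩ A).card) / B := by
        rw [hp, Polynomial.eval_finsetSum, Finset.sum_div]
        exact Finset.sum_congr rfl fun P _ => by simp; ring
      rw [this, abs_div, abs_of_pos hB0, div_le_one hB0]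
      exact abs_sum_pow_mul_stabChar_le hB A s hx
    have hmain := Polynomial.Chebyshev.eval_iterate_derivative_le_of_forall_abs_le_one (k := 1)
      le_rfl hdeg hbd
    simp only [Function.iterate_one] at hmain
    rw [Polynomial.Chebyshev.derivative_T_eval_one] at hmain
    have hd : (Polynomial.derivative p).eval 1 =
        (∑ P, β P * stabChar P s * (dom P ∩ A).card) / B := by
      rw [hp, Polynomial.derivative_sum, Polynomial.eval_finsetSum, Finset.sum_div]
      refine Finset.sum_congr rfl fun P _ => ?_
      simp [Polynomial.derivative_X_pow]
      ring
    rw [hd, div_le_iff₀ hB0, ← hsum] at hmain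
    exact_mod_cast hmain

/-- The total `L¹` influence of an observable of degree `k` is at most `2 k²` times its norm. -/
theorem sum_abs_stabPoly_partAt_le {M : Op n} (hM : M.IsHermitian) {B : ℝ} (hB : StateBound M B)
    {k : ℕ} (hk : ∀ P, k < weight P → (pauliCoeff P M).re = 0) :
    ∑ a, ∑ s, |stabPoly (partAt a fun P => (pauliCoeff P M).re) s| ≤ 6 ^ n * (2 * k ^ 2 * B) := by
  set β : PauliString n → ℝ := fun P => (pauliCoeff P M).re with hβ
  have h0 : ∀ a, ∑ s, stabPoly (partAt a β) s = 0 := by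
    intro a; rw [sum_stabPoly]; simp [partAt]
  have h1 : ∀ a, ∑ s, |stabPoly (partAt a β) s| = ∑ s, 2 * max (stabPoly (partAt a β) s) 0 := by
    intro a
    have h : ∀ x : ℝ, |x| = 2 * max x 0 - x := by
      intro x
      rcases le_total 0 x with h | h
      · rw [abs_of_nonneg h, max_eq_left h]; ring
      · rw [abs_of_nonpos h, max_eq_right h]; ring
    rw [Finset.sum_congr rfl fun s _ => h _, Finset.sum_sub_distrib, h0 a, sub_zero]
  simp_rw [h1]
  rw [Finset.sum_comm]
  have h2 : ∀ s, ∑ a, 2 * max (stabPoly (partAt a β) s) 0 ≤ 2 * k ^ 2 * B := by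
    intro s
    rw [← Finset.mul_sum, mul_assoc]
    refine mul_le_mul_of_nonneg_left ?_ (by norm_num)
    refine le_trans (le_of_eq ?_) (sum_stabPoly_partAt_le hM hB hk
      (Finset.univ.filter fun a => 0 < stabPoly (partAt a β) s) s)
    rw [Finset.sum_filter]
    refine Finset.sum_congr rfl fun a _ => ?_
    split_ifs with h
    · exact max_eq_left h.le
    · exact max_eq_right (not_lt.mp h)
  calc _ ≤ ∑ _s : Fin n → Fin 6, 2 * k ^ 2 * B := Finset.sum_le_sum fun s _ => h2 s
    _ = _ := by simp

/-! ### Hypercontractivity -/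

theorem stabChar_cons (c : Fin 4) (P : PauliString n) (a : Fin 6) (s : Fin n → Fin 6) :
    stabChar (Fin.cons c P : PauliString (n + 1)) (Fin.cons a s) = stabExp c a * stabChar P s := by
  simp [stabChar, Fin.prod_univ_succ]

theorem weight_cons (c : Fin 4) (P : PauliString n) :
    weight (Fin.cons c P : PauliString (n + 1)) = (if c ≠ 0 then 1 else 0) + weight P := by
  simp [weight_eq_sum, Fin.sum_univ_succ]

theorem sum_fin_succ_eq {α : Type*} [Fintype α] (f : (Fin (n + 1) → α) → ℝ) :
    ∑ s, f s = ∑ a, ∑ s : Fin n → α, f (Fin.cons a s) := by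
  rw [← Fintype.sum_prod_type']
  exact (Fintype.sum_equiv (Fin.consEquiv fun _ => α) _ _ fun _ => rfl).symm

theorem stabPoly_cons (β : PauliString (n + 1) → ℝ) (a : Fin 6) (s : Fin n → Fin 6) :
    stabPoly β (Fin.cons a s) = ∑ c, stabExp c a * stabPoly (fun P => β (Fin.cons c P)) s := by
  simp only [stabPoly, sum_fin_succ_eq, stabChar_cons, Finset.mul_sum]
  exact Finset.sum_congr rfl fun c _ => Finset.sum_congr rfl fun P _ => by ring

/-- Hypercontractivity: the fourth moment of a function of degree `k`. -/
theorem sum_stabPoly_pow_four_le : ∀ (n k : ℕ) (β : PauliString n → ℝ),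
    (∀ P, k < weight P → β P = 0) →
    6 ^ n * ∑ s, stabPoly β s ^ 4 ≤ 9 ^ k * (∑ s, stabPoly β s ^ 2) ^ 2 := by
  intro n
  induction n with
  | zero =>
    intro k β _
    simp only [Finset.univ_unique, Finset.sum_singleton]
    have h9 : (1 : ℝ) ≤ 9 ^ k := one_le_pow₀ (by norm_num)
    nlinarith [pow_nonneg (sq_nonneg (stabPoly β default)) 2]
  | succ n ih =>
    intro k β hβ
    set g : Fin 4 → (Fin n → Fin 6) → ℝ := fun c => stabPoly fun P => β (Fin.cons c P) with hg
    have h4 : ∑ s, stabPoly β s ^ 4 = 6 * ∑ s, g 0 s ^ 4 +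
        (12 * ∑ s, g 0 s ^ 2 * g 1 s ^ 2 + 2 * ∑ s, g 1 s ^ 4) +
        (12 * ∑ s, g 0 s ^ 2 * g 2 s ^ 2 + 2 * ∑ s, g 2 s ^ 4) +
        (12 * ∑ s, g 0 s ^ 2 * g 3 s ^ 2 + 2 * ∑ s, g 3 s ^ 4) := by
      rw [sum_fin_succ_eq, Finset.sum_comm]
      simp only [Finset.mul_sum, ← Finset.sum_add_distrib]
      refine Finset.sum_congr rfl fun s _ => ?_
      simp only [stabPoly_cons, Fin.sum_univ_six, Fin.sum_univ_four, hg]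
      simp [stabExp]
      ring
    have h2 : ∑ s, stabPoly β s ^ 2 = 6 * ∑ s, g 0 s ^ 2 +
        2 * ∑ s, g 1 s ^ 2 + 2 * ∑ s, g 2 s ^ 2 + 2 * ∑ s, g 3 s ^ 2 := by
      rw [sum_fin_succ_eq, Finset.sum_comm]
      simp only [Finset.mul_sum, ← Finset.sum_add_distrib]
      refine Finset.sum_congr rfl fun s _ => ?_
      simp only [stabPoly_cons, Fin.sum_univ_six, Fin.sum_univ_four, hg]
      simp [stabExp]
      ring
    have hA := ih k (fun P => β (Fin.cons 0 P)) fun P hP => hβ _ (by simpa [weight_cons] using hP)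
    have hC : ∀ c : Fin 4, c ≠ 0 →
        6 ^ n * ∑ s, g c s ^ 4 ≤ 9 ^ k / 9 * (∑ s, g c s ^ 2) ^ 2 := by
      intro c hc
      cases k with
      | zero =>
        have : ∀ s, g c s = 0 := by
          intro s
          refine Finset.sum_eq_zero fun P _ => ?_
          exact mul_eq_zero_of_left (hβ _ (by simp [weight_cons, hc])) _
        simp [this]
      | succ k =>
        rw [pow_succ, mul_div_assoc, div_self (by norm_num), mul_one]
        exact ih k (fun P => β (Fin.cons c P)) fun P hP =>
          hβ _ (by rw [weight_cons, if_pos hc]; omega)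
    have hX : ∀ c : Fin 4, c ≠ 0 →
        6 ^ n * ∑ s, g 0 s ^ 2 * g c s ^ 2 ≤
          9 ^ k / 3 * ((∑ s, g 0 s ^ 2) * ∑ s, g c s ^ 2) := by
      intro c hc
      have hcs := Finset.sum_mul_sq_le_sq_mul_sq Finset.univ (fun s => g 0 s ^ 2)
        (fun s => g c s ^ 2)
      have e : ∀ c, ∑ s, (g c s ^ 2) ^ 2 = ∑ s, g c s ^ 4 := fun c =>
        Finset.sum_congr rfl fun s _ => by ring
      rw [e, e] at hcs
      have hn : ∀ c, 0 ≤ ∑ s, g c s ^ 2 := fun c => Finset.sum_nonneg fun s _ => sq_nonneg _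
      have hn4 : ∀ c, 0 ≤ ∑ s, g c s ^ 4 := fun c => Finset.sum_nonneg fun s _ => by positivity
      refine abs_le_of_sq_le_sq' ?_ (by have := hn 0; have := hn c; positivity) |>.2
      calc (6 ^ n * ∑ s, g 0 s ^ 2 * g c s ^ 2) ^ 2
          = (6 ^ n) ^ 2 * (∑ s, g 0 s ^ 2 * g c s ^ 2) ^ 2 := by ring
        _ ≤ (6 ^ n) ^ 2 * ((∑ s, g 0 s ^ 4) * ∑ s, g c s ^ 4) := by gcongr
        _ = (6 ^ n * ∑ s, g 0 s ^ 4) * (6 ^ n * ∑ s, g c s ^ 4) := by ring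
        _ ≤ (9 ^ k * (∑ s, g 0 s ^ 2) ^ 2) * (9 ^ k / 9 * (∑ s, g c s ^ 2) ^ 2) := by
            have := hn4 c
            exact mul_le_mul hA (hC c hc) (by positivity) (by positivity)
        _ = _ := by ring
    rw [h4, h2, pow_succ]
    clear h2 h4
    have hC1 := hC 1 (by decide)
    have hC2 := hC 2 (by decide)
    have hC3 := hC 3 (by decide)
    have hX1 := hX 1 (by decide)
    have hX2 := hX 2 (by decide)
    have hX3 := hX 3 (by decide)
    have hn : ∀ c, 0 ≤ ∑ s, g c s ^ 2 := fun c => Finset.sum_nonneg fun s _ => sq_nonneg _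
    have h1 := hn 1
    have h2 := hn 2
    have h3 := hn 3
    set a := ∑ s, g 0 s ^ 2
    set b₁ := ∑ s, g 1 s ^ 2
    set b₂ := ∑ s, g 2 s ^ 2
    set b₃ := ∑ s, g 3 s ^ 2
    have hA' : 6 ^ n * ∑ s, g 0 s ^ 4 ≤ 9 ^ k * a ^ 2 := hA
    have h9 : (0 : ℝ) < 9 ^ k := by positivity
    have hb : 9 ^ k * ((4 / 3) * (b₁ ^ 2 + b₂ ^ 2 + b₃ ^ 2)) ≤ 9 ^ k * (4 * (b₁ + b₂ + b₃) ^ 2) := by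
      refine mul_le_mul_of_nonneg_left ?_ h9.le
      nlinarith [mul_nonneg h1 h2, mul_nonneg h1 h3, mul_nonneg h2 h3]
    nlinarith

/-- Comparison of the first and second moments of a function of degree `k`. -/
theorem sum_stabPoly_sq_le {k : ℕ} {β : PauliString n → ℝ} (hβ : ∀ P, k < weight P → β P = 0) :
    6 ^ n * ∑ s, stabPoly β s ^ 2 ≤ 9 ^ k * (∑ s, |stabPoly β s|) ^ 2 := by
  set f := stabPoly β
  have h4 := sum_stabPoly_pow_four_le n k β hβ
  have hcs : (∑ s, f s ^ 2) ^ 2 ≤ (∑ s, |f s|) * ∑ s, |f s| ^ 3 := by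
    refine Finset.sum_sq_le_sum_mul_sum_of_sq_le_mul _ (fun s _ => abs_nonneg _)
      (fun s _ => by positivity) fun s _ => ?_
    rw [← sq_abs (f s)]; exact le_of_eq (by ring)
  have hcs2 : (∑ s, |f s| ^ 3) ^ 2 ≤ (∑ s, f s ^ 2) * ∑ s, f s ^ 4 := by
    refine Finset.sum_sq_le_sum_mul_sum_of_sq_le_mul _ (fun s _ => sq_nonneg _)
      (fun s _ => by positivity) fun s _ => ?_
    rw [← sq_abs (f s), show f s ^ 4 = (f s ^ 2) ^ 2 by ring, ← sq_abs (f s)]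
    exact le_of_eq (by ring)
  have n1 : 0 ≤ ∑ s, |f s| := Finset.sum_nonneg fun s _ => abs_nonneg _
  have n2 : 0 ≤ ∑ s, f s ^ 2 := Finset.sum_nonneg fun s _ => sq_nonneg _
  have n3 : 0 ≤ ∑ s, |f s| ^ 3 := Finset.sum_nonneg fun s _ => by positivity
  change 6 ^ n * ∑ s, f s ^ 4 ≤ 9 ^ k * (∑ s, f s ^ 2) ^ 2 at h4
  rcases n2.eq_or_lt with h0 | h0
  · rw [← h0, mul_zero]; positivity
  set S1 := ∑ s, |f s|
  set S2 := ∑ s, f s ^ 2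
  set S3 := ∑ s, |f s| ^ 3
  set S4 := ∑ s, f s ^ 4
  have h6 : (0 : ℝ) < 6 ^ n := by positivity
  have hfin : S2 ^ 3 * (6 ^ n * S2) ≤ S2 ^ 3 * (9 ^ k * S1 ^ 2) := by
    calc S2 ^ 3 * (6 ^ n * S2) = 6 ^ n * (S2 ^ 2) ^ 2 := by ring
      _ ≤ 6 ^ n * (S1 * S3) ^ 2 := by gcongr
      _ = 6 ^ n * S1 ^ 2 * S3 ^ 2 := by ring
      _ ≤ 6 ^ n * S1 ^ 2 * (S2 * S4) := by gcongr
      _ = S1 ^ 2 * S2 * (6 ^ n * S4) := by ring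
      _ ≤ S1 ^ 2 * S2 * (9 ^ k * S2 ^ 2) := by gcongr
      _ = _ := by ring
  exact le_of_mul_le_mul_left hfin (by positivity)

end

section


/-! ### Counting Pauli observables -/

variable {n : ℕ}

theorem card_dom_eq (A : Finset (Fin n)) :
    (Finset.univ.filter fun P : PauliString n => dom P = A).card = 3 ^ A.card := by
  have heq : (Finset.univ.filter fun P : PauliString n => dom P = A) =
      Fintype.piFinset fun i => if i ∈ A then ({1, 2, 3} : Finset (Fin 4)) else {0} := by
    ext P
    simp only [Finset.mem_filter, Finset.mem_univ, true_and, Fintype.mem_piFinset, Finset.ext_iff,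
      dom]
    refine forall_congr' fun i => ?_
    by_cases h : i ∈ A
    · simp only [h, iff_true, if_true]
      generalize P i = c
      revert c
      decide
    · simp [h]
  rw [heq, Fintype.card_piFinset]
  have : ∀ i, (if i ∈ A then ({1, 2, 3} : Finset (Fin 4)) else {0}).card =
      if i ∈ A then 3 else 1 := by
    intro i; split_ifs <;> rfl
  simp [this]

/-- There are at most `21 g ^ K` Pauli observables of weight at most `K` on `g ≥ 1` qubits. -/
theorem card_dom_subset_le (G : Finset (Fin n)) (K : ℕ) {g : ℝ} (hg : 1 ≤ g) (hG : G.card ≤ g) :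
    ((Finset.univ.filter fun P : PauliString n => dom P ⊆ G ∧ weight P ≤ K).card : ℝ) ≤
      21 * g ^ K := by
  have h1 : (Finset.univ.filter fun P : PauliString n => dom P ⊆ G ∧ weight P ≤ K).card ≤
      ∑ A ∈ G.powerset, if A.card ≤ K then 3 ^ A.card else 0 := by
    rw [← Finset.sum_filter]
    rw [Finset.card_eq_sum_card_fiberwise (f := dom)
      (t := G.powerset.filter fun A => A.card ≤ K)]
    · refine Finset.sum_le_sum fun A _ => (Finset.card_le_card ?_).trans (card_dom_eq A).le
      intro P hP
      simp only [Finset.mem_filter, Finset.mem_univ, true_and] at hP ⊢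
      exact hP.2
    · intro P hP
      simpa [weight] using (Finset.mem_filter.mp (Finset.mem_coe.mp hP)).2
  have h2 : (∑ A ∈ G.powerset, if A.card ≤ K then 3 ^ A.card else 0) ≤
      ∑ j ∈ Finset.range (K + 1), G.card.choose j * 3 ^ j := by
    rw [Finset.sum_powerset_apply_card (f := fun j => if j ≤ K then 3 ^ j else 0)]
    simp only [smul_eq_mul, mul_ite, mul_zero]
    rw [← Finset.sum_filter]
    exact Finset.sum_le_sum_of_subset (fun j hj => by simp at hj ⊢; omega)
  calc _ ≤ ((∑ j ∈ Finset.range (K + 1), G.card.choose j * 3 ^ j : ℕ) : ℝ) := by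
        exact_mod_cast h1.trans h2
    _ = ∑ j ∈ Finset.range (K + 1), (G.card.choose j : ℝ) * 3 ^ j := by push_cast; rfl
    _ ≤ ∑ j ∈ Finset.range (K + 1), g ^ K * (3 ^ j / j.factorial) := by
        refine Finset.sum_le_sum fun j hj => ?_
        have hj : j ≤ K := by simp at hj; omega
        calc (G.card.choose j : ℝ) * 3 ^ j ≤ ((G.card : ℝ) ^ j / j.factorial) * 3 ^ j := by
              gcongr; exact Nat.choose_le_pow_div j G.card
          _ ≤ (g ^ K / j.factorial) * 3 ^ j := by
              gcongr
              exact (pow_le_pow_left₀ (by positivity) hG j).trans (pow_le_pow_right₀ hg hj)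
          _ = _ := by ring
    _ = g ^ K * ∑ j ∈ Finset.range (K + 1), (3 : ℝ) ^ j / j.factorial := by rw [Finset.mul_sum]
    _ ≤ g ^ K * Real.exp 3 := by
        gcongr; exact Real.sum_le_exp_of_nonneg (by norm_num) _
    _ ≤ g ^ K * 21 := by
        gcongr
        have : Real.exp 3 = Real.exp 1 ^ 3 := by rw [← Real.exp_nat_mul]; norm_num
        rw [this]
        calc Real.exp 1 ^ 3 ≤ 2.7182818286 ^ 3 := by
              gcongr; exact Real.exp_one_lt_d9.le
          _ ≤ 21 := by norm_num
    _ = _ := by ring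

theorem card_weight_le (hn : 1 ≤ n) (K : ℕ) :
    ((Finset.univ.filter fun P : PauliString n => weight P ≤ K).card : ℝ) ≤ 21 * (n : ℝ) ^ K := by
  have := card_dom_subset_le (Finset.univ : Finset (Fin n)) K (g := n) (by exact_mod_cast hn)
    (by simp)
  simpa using this

/-! ### A truncated Bohnenblust–Hille inequality -/

/-- The `L²` influences of an observable of degree `k` are summable with a bound of the
form `C ^ k` times the norm. -/
theorem sum_sqrt_influence_le {M : Op n} (hM : M.IsHermitian) {B : ℝ} (hB : StateBound M B)
    {k : ℕ} (hk : ∀ P, k < weight P → (pauliCoeff P M).re = 0) :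
    ∑ a, √(∑ P with P a ≠ 0, (1 / 3) ^ weight P * (pauliCoeff P M).re ^ 2) ≤
      3 ^ k * (2 * k ^ 2) * B := by
  have h6 : (0 : ℝ) < 6 ^ n := by positivity
  have h := sum_abs_stabPoly_partAt_le hM hB hk
  set β : PauliString n → ℝ := fun P => (pauliCoeff P M).re with hβ
  have h1 : ∀ a, √(∑ P with P a ≠ 0, (1 / 3) ^ weight P * β P ^ 2) ≤
      3 ^ k * ((∑ s, |stabPoly (partAt a β) s|) / 6 ^ n) := by
    intro a
    have e : ∑ P with P a ≠ 0, (1 / 3) ^ weight P * β P ^ 2 =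
        ∑ P, (1 / 3) ^ weight P * partAt a β P ^ 2 := by
      rw [Finset.sum_filter]
      refine Finset.sum_congr rfl fun P _ => ?_
      rw [partAt]
      split_ifs <;> simp
    have h2 := sum_stabPoly_sq_le (k := k) (β := partAt a β)
      (fun P hP => by rw [partAt, hβ]; simp [hk P hP])
    rw [sum_stabPoly_sq, ← e] at h2
    refine Real.sqrt_le_iff.mpr ⟨by positivity, ?_⟩
    rw [mul_pow, div_pow, ← pow_mul, mul_comm k, pow_mul, ← mul_div_assoc, le_div_iff₀ (by positivity)]
    calc _ = 6 ^ n * (6 ^ n * ∑ P with P a ≠ 0, (1 / 3) ^ weight P * β P ^ 2) := by ring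
      _ ≤ _ := h2.trans (le_of_eq (by norm_num))
  calc _ ≤ ∑ a, 3 ^ k * ((∑ s, |stabPoly (partAt a β) s|) / 6 ^ n) := Finset.sum_le_sum fun a _ => h1 a
    _ = 3 ^ k * ((∑ a, ∑ s, |stabPoly (partAt a β) s|) / 6 ^ n) := by
        rw [← Finset.mul_sum, Finset.sum_div]
    _ ≤ 3 ^ k * (2 * k ^ 2 * B) := by
        gcongr
        rw [div_le_iff₀ h6, mul_comm]; exact h
    _ = _ := by ring

/-- Splitting the Pauli observables according to whether they act only on qubits of large
influence. -/
theorem sum_min_sq_le {W y q : ℝ} (hW : 0 < W) (hy : 1 ≤ y) (hq : 0 ≤ q) (K : ℕ)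
    (β : PauliString n → ℝ)
    (h : ∑ a, √(∑ P with P a ≠ 0, (1 / 3) ^ weight P * β P ^ 2) ≤ W) :
    ∑ P with weight P ≤ K, min (β P ^ 2) q ≤ 3 ^ K * (W ^ 2 / y) + 21 * y ^ K * q := by
  set A : Fin n → ℝ := fun a => √(∑ P with P a ≠ 0, (1 / 3) ^ weight P * β P ^ 2) with hA
  set G : Finset (Fin n) := Finset.univ.filter fun a => W / y < A a with hG
  have hA0 : ∀ a, 0 ≤ A a := fun a => Real.sqrt_nonneg _
  have hGc : (G.card : ℝ) ≤ y := by
    have h1 : (G.card : ℝ) * (W / y) ≤ W := by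
      calc (G.card : ℝ) * (W / y) = ∑ a ∈ G, W / y := by simp
        _ ≤ ∑ a ∈ G, A a := Finset.sum_le_sum fun a ha => (Finset.mem_filter.mp ha).2.le
        _ ≤ ∑ a, A a := Finset.sum_le_univ_sum_of_nonneg hA0
        _ ≤ W := h
    rw [← mul_div_assoc, div_le_iff₀ (by linarith), mul_comm] at h1
    exact le_of_mul_le_mul_left h1 hW
  have hsplit : ∑ P with weight P ≤ K, min (β P ^ 2) q ≤
      ∑ P with weight P ≤ K, (∑ a ∈ Finset.univ.filter (fun a => a ∉ G),
        (if P a ≠ 0 then β P ^ 2 else 0) + if dom P ⊆ G then q else 0) := by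
    refine Finset.sum_le_sum fun P _ => ?_
    by_cases hP : dom P ⊆ G
    · rw [if_pos hP]
      have : 0 ≤ ∑ a ∈ Finset.univ.filter (fun a => a ∉ G), (if P a ≠ 0 then β P ^ 2 else 0) :=
        Finset.sum_nonneg fun a _ => by split_ifs <;> positivity
      exact (min_le_right _ _).trans (by linarith)
    · rw [if_neg hP, add_zero]
      obtain ⟨a, ha, haG⟩ := Finset.not_subset.mp hP
      refine (min_le_left _ _).trans ?_
      have := Finset.single_le_sum (s := Finset.univ.filter (fun a => a ∉ G))
        (f := fun a => if P a ≠ 0 then β P ^ 2 else 0)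
        (fun a _ => by split_ifs <;> positivity) (by simpa using haG : a ∈ _)
      simpa [(by simpa [dom] using ha : P a ≠ 0)] using this
  refine hsplit.trans ?_
  rw [Finset.sum_add_distrib]
  refine add_le_add ?_ ?_
  · rw [Finset.sum_comm]
    calc _ ≤ ∑ a ∈ Finset.univ.filter (fun a => a ∉ G), 3 ^ K * (A a * (W / y)) := by
          refine Finset.sum_le_sum fun a ha => ?_
          have ha : A a ≤ W / y := by simpa [hG] using ha
          calc ∑ P with weight P ≤ K, (if P a ≠ 0 then β P ^ 2 else 0)
              ≤ ∑ P with weight P ≤ K,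
                (if P a ≠ 0 then 3 ^ K * ((1 / 3) ^ weight P * β P ^ 2) else 0) := by
                refine Finset.sum_le_sum fun P hP => ?_
                have hP : weight P ≤ K := by simpa using hP
                split_ifs
                · rw [← mul_assoc]
                  refine le_mul_of_one_le_left (sq_nonneg _) ?_
                  rw [one_div, inv_pow, ← div_eq_mul_inv, one_le_div (by positivity)]
                  exact pow_le_pow_right₀ (by norm_num) hP
                · exact le_rfl
            _ ≤ ∑ P, (if P a ≠ 0 then 3 ^ K * ((1 / 3) ^ weight P * β P ^ 2) else 0) := by
                refine Finset.sum_le_univ_sum_of_nonneg fun P => ?_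
                split_ifs <;> positivity
            _ = 3 ^ K * (A a * A a) := by
                rw [← Finset.sum_filter, ← Finset.mul_sum, hA, Real.mul_self_sqrt]
                exact Finset.sum_nonneg fun P _ => by positivity
            _ ≤ _ := by
                gcongr
      _ = 3 ^ K * (W / y) * ∑ a ∈ Finset.univ.filter (fun a => a ∉ G), A a := by
          rw [Finset.mul_sum]; exact Finset.sum_congr rfl fun a _ => by ring
      _ ≤ 3 ^ K * (W / y) * W := by
          gcongr
          exact (Finset.sum_le_univ_sum_of_nonneg hA0).trans h
      _ = _ := by ring
  · rw [← Finset.sum_filter, Finset.filter_filter, Finset.sum_const, nsmul_eq_mul]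
    refine mul_le_mul_of_nonneg_right ?_ hq
    have := card_dom_subset_le G K hy hGc
    simpa only [and_comm] using this

/-- A truncated form of the Bohnenblust–Hille inequality, with a constant that is polynomial in
the degree `k` of the observable and exponential only in the degree `K` of the truncation. The
latter matters for the sample size: a constant exponential in `k` would be too weak. -/
theorem sum_min_sq_le_rpow {M : Op n} (hM : M.IsHermitian) {B : ℝ} (hB0 : 0 < B)
    (hB : StateBound M B) {k K : ℕ} (hk1 : 1 ≤ k) (hKk : K ≤ k)
    (hk : ∀ P, k < weight P → (pauliCoeff P M).re = 0) {q : ℝ} (hq : 0 ≤ q) :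
    ∑ P with weight P ≤ K, min ((pauliCoeff P M).re ^ 2) q ≤
      88 * 27 ^ K * k ^ 4 * (q / B ^ 2) ^ (1 / (k + 1) : ℝ) * B ^ 2 := by
  set β : PauliString n → ℝ := fun P => (pauliCoeff P M).re with hβ
  set F := ∑ P with weight P ≤ K, min (β P ^ 2) q with hF
  have hk1' : (1 : ℝ) ≤ k := by exact_mod_cast hk1
  have hF0 : 0 ≤ F := Finset.sum_nonneg fun P _ => le_min (sq_nonneg _) hq
  have hFB : F ≤ B ^ 2 := by
    calc F ≤ ∑ P with weight P ≤ K, β P ^ 2 := Finset.sum_le_sum fun P _ => min_le_left _ _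
      _ ≤ ∑ P, β P ^ 2 := Finset.sum_le_univ_sum_of_nonneg fun P => sq_nonneg _
      _ ≤ B ^ 2 := sum_pauliCoeff_re_sq_le hM hB
  have hC1 : (1 : ℝ) ≤ 88 * 27 ^ K * k ^ 4 := by
    have h1 : (1 : ℝ) ≤ 27 ^ K := one_le_pow₀ (by norm_num)
    have h2 : (1 : ℝ) ≤ (k : ℝ) ^ 4 := one_le_pow₀ hk1'
    nlinarith
  have hB2 : 0 < B ^ 2 := by positivity
  rcases hq.eq_or_lt with hq0 | hq0
  · have : F = 0 := by
      refine Finset.sum_eq_zero fun P _ => ?_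
      rw [← hq0]; exact min_eq_right (sq_nonneg _)
    rw [this]
    positivity
  by_cases hqB : B ^ 2 ≤ q
  · -- the truncation is void
    have h1 : (1 : ℝ) ≤ (q / B ^ 2) ^ (1 / (k + 1) : ℝ) :=
      Real.one_le_rpow ((one_le_div hB2).mpr hqB) (by positivity)
    calc F ≤ 1 * B ^ 2 := by linarith
      _ ≤ _ := by
        refine mul_le_mul_of_nonneg_right ?_ hB2.le
        nlinarith
  · push Not at hqB
    set L : ℝ := 3 ^ k * (2 * k ^ 2) with hL
    have hL1 : 1 ≤ L := by
      have h1 : (1 : ℝ) ≤ 3 ^ k := one_le_pow₀ (by norm_num)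
      have h2 : (1 : ℝ) ≤ (k : ℝ) ^ 2 := one_le_pow₀ hk1'
      nlinarith
    have hL0 : 0 < L := by linarith
    set W := L * B with hW
    have hW0 : 0 < W := by positivity
    set T := q / B ^ 2 with hT
    have hT0 : 0 < T := by positivity
    have hT1 : T ≤ 1 := (div_le_one hB2).mpr hqB.le
    -- this choice of the cutoff balances the two contributions
    set y : ℝ := (L ^ 2 / T) ^ (1 / (K + 1) : ℝ) with hy
    have hLT : 1 ≤ L ^ 2 / T := by
      rw [one_le_div hT0]
      exact hT1.trans (one_le_pow₀ hL1)
    have hy1 : 1 ≤ y := Real.one_le_rpow hLT (by positivity)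
    have hy0 : 0 < y := by linarith
    have hypow : y ^ (K + 1) = L ^ 2 / T := by
      rw [hy, ← Real.rpow_natCast, ← Real.rpow_mul (by positivity)]
      push_cast
      rw [one_div, inv_mul_cancel₀ (by positivity), Real.rpow_one]
    have hmain := sum_min_sq_le hW0 hy1 hq K β (sum_sqrt_influence_le hM hB hk)
    have hsecond : 21 * y ^ K * q = 21 * (W ^ 2 / y) := by
      have : y ^ K = L ^ 2 / T / y := by rw [← hypow, pow_succ]; field_simp
      rw [this, hW, hT]; field_simp
    rw [hsecond, ← add_mul] at hmain
    have h3K : (1 : ℝ) ≤ 3 ^ K := one_le_pow₀ (by norm_num)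
    have hφ : F / B ^ 2 ≤ 22 * 3 ^ K * (L ^ 2 / y) := by
      rw [div_le_iff₀ hB2]
      calc F ≤ (3 ^ K + 21) * (W ^ 2 / y) := hmain
        _ ≤ (22 * 3 ^ K) * (W ^ 2 / y) := by gcongr; linarith
        _ = _ := by rw [hW]; ring
    set φ := F / B ^ 2 with hφd
    have hφ0 : 0 ≤ φ := by positivity
    have hφ1 : φ ≤ 1 := (div_le_one hB2).mpr hFB
    -- interpolation with the Hilbert–Schmidt bound
    set θ : ℝ := (K + 1) / (k + 1) with hθ
    have hKk' : (K : ℝ) ≤ k := by exact_mod_cast hKk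
    have hθ0 : 0 < θ := by positivity
    have hθ1 : θ ≤ 1 := by rw [hθ, div_le_one (by positivity)]; linarith
    have h1 : φ ≤ (22 * 3 ^ K * (L ^ 2 / y)) ^ θ := by
      calc φ ≤ φ ^ θ := by
            rcases hφ0.eq_or_lt with h | h
            · rw [← h]; positivity
            · conv_lhs => rw [← Real.rpow_one φ]
              exact Real.rpow_le_rpow_of_exponent_ge h hφ1 hθ1
        _ ≤ _ := Real.rpow_le_rpow hφ0 hφ hθ0.le
    have hyθ : y ^ θ = (L ^ 2 / T) ^ (1 / (k + 1) : ℝ) := by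
      rw [hy, ← Real.rpow_mul (by positivity)]
      congr 1
      rw [hθ]; field_simp
    have h2 : (22 * 3 ^ K * (L ^ 2 / y)) ^ θ =
        (22 * 3 ^ K) ^ θ * (L ^ 2) ^ ((K : ℝ) / (k + 1)) * T ^ (1 / (k + 1) : ℝ) := by
      rw [Real.mul_rpow (by positivity) (by positivity), Real.div_rpow (by positivity) hy0.le, hyθ,
        Real.div_rpow (by positivity) hT0.le, mul_assoc]
      congr 1
      have : θ = (K : ℝ) / (k + 1) + 1 / (k + 1) := by rw [hθ]; ring
      rw [this, Real.rpow_add (by positivity)]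
      have h5 : (L ^ 2) ^ (1 / (k + 1) : ℝ) ≠ 0 := (Real.rpow_pos_of_pos (by positivity) _).ne'
      field_simp
    have h3 : ((22 : ℝ) * 3 ^ K) ^ θ ≤ 22 * 3 ^ K := by
      conv_rhs => rw [← Real.rpow_one (22 * 3 ^ K : ℝ)]
      exact Real.rpow_le_rpow_of_exponent_le (by linarith) hθ1
    have h4 : (L ^ 2) ^ ((K : ℝ) / (k + 1)) ≤ 9 ^ K * (4 * k ^ 4) := by
      have e : L ^ 2 = (9 : ℝ) ^ (k : ℝ) * (4 * k ^ 4) := by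
        rw [hL, Real.rpow_natCast, mul_pow, ← pow_mul, mul_comm k 2, pow_mul]; ring
      rw [e, Real.mul_rpow (by positivity) (by positivity), ← Real.rpow_mul (by norm_num)]
      refine mul_le_mul ?_ ?_ (by positivity) (by positivity)
      · rw [← Real.rpow_natCast]
        refine Real.rpow_le_rpow_of_exponent_le (by norm_num) ?_
        rw [← mul_div_assoc, div_le_iff₀ (by positivity)]
        nlinarith [Nat.cast_nonneg (α := ℝ) K]
      · conv_rhs => rw [← Real.rpow_one (4 * (k : ℝ) ^ 4)]
        refine Real.rpow_le_rpow_of_exponent_le ?_ ?_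
        · nlinarith [one_le_pow₀ (n := 4) hk1']
        · rw [div_le_one (by positivity)]; linarith
    have hfin : φ ≤ 88 * 27 ^ K * k ^ 4 * T ^ (1 / (k + 1) : ℝ) := by
      calc φ ≤ (22 * 3 ^ K) ^ θ * (L ^ 2) ^ ((K : ℝ) / (k + 1)) * T ^ (1 / (k + 1) : ℝ) := by
            rw [← h2]; exact h1
        _ ≤ (22 * 3 ^ K) * (9 ^ K * (4 * k ^ 4)) * T ^ (1 / (k + 1) : ℝ) := by
            have := Real.rpow_nonneg hT0.le (1 / (k + 1) : ℝ)
            gcongr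
        _ = _ := by
            have : (27 : ℝ) ^ K = 3 ^ K * 9 ^ K := by rw [← mul_pow]; norm_num
            rw [this]; ring
    rwa [hφd, div_le_iff₀ hB2] at hfin

/-! ### Observables of bounded degree -/

theorem pauliCoeff_eq_zero_of_actsOn {A : Finset (Fin n)} {M : Op n} (hM : ActsOn A M)
    {P : PauliString n} (hP : ¬ dom P ⊆ A) : pauliCoeff P M = 0 := by
  obtain ⟨B, hB⟩ := hM
  obtain ⟨i, hi, hiA⟩ := Finset.not_subset.mp hP
  have hi : P i ≠ 0 := by simpa [dom] using hi
  have htr : ∀ b, pauli (P i) b b + pauli (P i) (b + 1) (b + 1) = 0 := by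
    intro b
    have := trace_pauli (P i)
    rw [if_neg hi, Matrix.trace, Fin.sum_univ_two] at this
    fin_cases b
    · exact this
    · rw [add_comm]; exact this
  rw [pauliCoeff, div_eq_zero_iff]
  left
  simp only [Matrix.trace, Matrix.diag, Matrix.mul_apply]
  rw [← Fintype.sum_prod_type']
  have hne : ∀ b : Fin 2, b + 1 ≠ b := by decide
  have hadd : ∀ b : Fin 2, b + 1 + 1 = b := by decide
  -- the terms for `(x, y)` and for `(x, y)` with bit `i` flipped in both cancel
  refine Finset.sum_involution
    (fun p _ => (Function.update p.1 i (p.1 i + 1), Function.update p.2 i (p.2 i + 1))) ?_ ?_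
    (fun _ _ => Finset.mem_univ _) ?_
  · rintro ⟨x, y⟩ -
    dsimp only
    have hMeq : M (Function.update y i (y i + 1)) (Function.update x i (x i + 1)) = M y x := by
      rw [hB, hB]
      have h1 : (∀ j, j ∉ A → Function.update y i (y i + 1) j = Function.update x i (x i + 1) j) ↔
          ∀ j, j ∉ A → y j = x j := by
        refine forall_congr' fun j => imp_congr_right fun _ => ?_
        by_cases hj : j = i
        · subst hj; simp
        · simp [hj]
      have h2 : ∀ z : Fin n → Fin 2, (fun j : A => Function.update z i (z i + 1) j) =
          fun j : A => z j := by
        intro z; funext j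
        have hji : (j : Fin n) ≠ i := fun h => hiA (h ▸ j.2)
        exact Function.update_of_ne hji _ _
      simp only [h1, h2]
    rw [hMeq]
    by_cases hxy : y i = x i
    · rw [← add_mul]
      refine mul_eq_zero_of_left ?_ _
      have hp : ∀ z w : Fin n → Fin 2, pauliOp P z w =
          pauli (P i) (z i) (w i) * ∏ j ∈ Finset.univ.erase i, pauli (P j) (z j) (w j) :=
        fun z w => (Finset.mul_prod_erase _ _ (Finset.mem_univ i)).symm
      rw [hp, hp]
      have h3 : ∏ j ∈ Finset.univ.erase i, pauli (P j) (Function.update x i (x i + 1) j)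
          (Function.update y i (y i + 1) j) =
          ∏ j ∈ Finset.univ.erase i, pauli (P j) (x j) (y j) := by
        refine Finset.prod_congr rfl fun j hj => ?_
        have hj := Finset.ne_of_mem_erase hj
        rw [Function.update_of_ne hj, Function.update_of_ne hj]
      rw [h3, ← add_mul, Function.update_self, Function.update_self, hxy, htr, zero_mul]
    · have : M y x = 0 := by
        rw [hB, if_neg]
        exact fun h => hxy (h i hiA)
      rw [this, mul_zero, mul_zero, add_zero]
  · rintro ⟨x, y⟩ - - h
    exact hne (x i) (by simpa using congrFun (congrArg Prod.fst h) i)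
  · rintro ⟨x, y⟩ -
    simp [hadd]

theorem card_dom_subset_eq_le (A : Finset (Fin n)) :
    (Finset.univ.filter fun P : PauliString n => dom P ⊆ A).card ≤ 4 ^ A.card := by
  have hsub : (Finset.univ.filter fun P : PauliString n => dom P ⊆ A) ⊆
      Fintype.piFinset fun i => if i ∈ A then (Finset.univ : Finset (Fin 4)) else {0} := by
    intro P hP
    rw [Fintype.mem_piFinset]
    intro i
    have hP : dom P ⊆ A := by simpa using hP
    split_ifs with h
    · exact Finset.mem_univ _
    · by_contra h0
      exact h (hP (by simpa [dom] using h0))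
  refine (Finset.card_le_card hsub).trans (le_of_eq ?_)
  rw [Fintype.card_piFinset]
  have : ∀ i, (if i ∈ A then (Finset.univ : Finset (Fin 4)) else {0}).card =
      if i ∈ A then 4 else 1 := by
    intro i; split_ifs <;> rfl
  simp [this]

namespace IsBoundedDegree

variable {κ d : ℕ} {O : Op n}

theorem isHermitian (h : IsBoundedDegree κ d O) : O.IsHermitian := by
  obtain ⟨m, A, B, hB, -, rfl⟩ := h
  rw [Matrix.IsHermitian, Matrix.conjTranspose_sum]
  exact Finset.sum_congr rfl fun j _ => (hB j).2.1

theorem weight_le (h : IsBoundedDegree κ d O) {Q : PauliString n} (hQ : pauliCoeff Q O ≠ 0) :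
    weight Q ≤ κ := by
  obtain ⟨m, A, B, hB, -, rfl⟩ := h
  rw [pauliCoeff_sum] at hQ
  obtain ⟨j, -, hj⟩ := Finset.exists_ne_zero_of_sum_ne_zero hQ
  have : dom Q ⊆ A j := by
    by_contra hs; exact hj (pauliCoeff_eq_zero_of_actsOn (hB j).2.2 hs)
  exact (Finset.card_le_card this).trans (hB j).1

/-- Every qubit is acted on by at most `d 4^κ` terms of the Pauli expansion. -/
theorem card_le (h : IsBoundedDegree κ d O) (a : Fin n) :
    (Finset.univ.filter fun Q => pauliCoeff Q O ≠ 0 ∧ Q a ≠ 0).card ≤ d * 4 ^ κ := by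
  obtain ⟨m, A, B, hB, hd, rfl⟩ := h
  have hsub : (Finset.univ.filter fun Q => pauliCoeff Q (∑ j, B j) ≠ 0 ∧ Q a ≠ 0) ⊆
      (Finset.univ.filter fun j => a ∈ A j).biUnion
        fun j => Finset.univ.filter fun P : PauliString n => dom P ⊆ A j := by
    intro Q hQ
    obtain ⟨hQ, hQa⟩ := (Finset.mem_filter.mp hQ).2
    rw [pauliCoeff_sum] at hQ
    obtain ⟨j, -, hj⟩ := Finset.exists_ne_zero_of_sum_ne_zero hQ
    have : dom Q ⊆ A j := by
      by_contra hs; exact hj (pauliCoeff_eq_zero_of_actsOn (hB j).2.2 hs)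
    simp only [Finset.mem_biUnion, Finset.mem_filter, Finset.mem_univ, true_and]
    exact ⟨j, this (by simpa [dom] using hQa), this⟩
  refine (Finset.card_le_card hsub).trans (Finset.card_biUnion_le.trans ?_)
  calc _ ≤ ∑ j with a ∈ A j, 4 ^ κ := Finset.sum_le_sum fun j _ =>
        (card_dom_subset_eq_le (A j)).trans (Nat.pow_le_pow_right (by norm_num) (hB j).1)
    _ ≤ _ := by
        rw [Finset.sum_const, smul_eq_mul]
        exact Nat.mul_le_mul_right _ (hd a)

/-- The Pauli expansion of an observable of bounded degree has `O(n)` terms. -/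
theorem card_support_le (h : IsBoundedDegree κ d O) :
    (Finset.univ.filter fun Q => pauliCoeff Q O ≠ 0).card ≤ 1 + n * (d * 4 ^ κ) := by
  have hsub : (Finset.univ.filter fun Q => pauliCoeff Q O ≠ 0) ⊆
      {0} ∪ Finset.univ.biUnion fun a : Fin n =>
        Finset.univ.filter fun Q => pauliCoeff Q O ≠ 0 ∧ Q a ≠ 0 := by
    intro Q hQ
    by_cases h0 : Q = 0
    · simp [h0]
    · obtain ⟨a, ha⟩ := Function.ne_iff.mp h0
      refine Finset.mem_union_right _ ?_
      simp only [Finset.mem_biUnion, Finset.mem_filter, Finset.mem_univ, true_and] at hQ ⊢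
      exact ⟨a, hQ, ha⟩
  refine (Finset.card_le_card hsub).trans ((Finset.card_union_le _ _).trans ?_)
  refine Nat.add_le_add (by simp) (Finset.card_biUnion_le.trans ?_)
  calc _ ≤ ∑ _a : Fin n, d * 4 ^ κ := Finset.sum_le_sum fun a _ => h.card_le a
    _ = _ := by simp

/-- The Pauli-1 norm of an observable of bounded degree is controlled by its spectral norm,
since its `L¹` influences are. -/
theorem pauliL1_le (h : IsBoundedDegree κ d O) :
    pauliL1 O ≤ (1 + d * 12 ^ κ * (2 * κ ^ 2)) * opNorm O := by
  have hO := h.isHermitian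
  have h6 : (0 : ℝ) < 6 ^ n := by positivity
  set β : PauliString n → ℝ := fun P => (pauliCoeff P O).re with hβ
  have hnorm : ∀ Q, ‖pauliCoeff Q O‖ = |β Q| := by
    intro Q
    rw [pauliCoeff_eq_re hO Q, Complex.norm_real, Real.norm_eq_abs]
  have hdeg : ∀ P, κ < weight P → β P = 0 := by
    intro P hP
    by_contra h0
    have : pauliCoeff P O ≠ 0 := fun h1 => h0 (by rw [hβ]; simp [h1])
    exact absurd (h.weight_le this) (by omega)
  have hinf := sum_abs_stabPoly_partAt_le hO (stateBound_opNorm O) hdeg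
  have hone : ∀ a Q, Q a ≠ 0 → |β Q| ≤ 3 ^ κ * ((∑ s, |stabPoly (partAt a β) s|) / 6 ^ n) := by
    intro a Q hQ
    by_cases hw : weight Q ≤ κ
    · have h1 := sum_stabPoly_mul_stabChar (partAt a β) Q
      rw [partAt, if_pos hQ] at h1
      have h2 : 6 ^ n * ((1 / 3) ^ weight Q * |β Q|) ≤ ∑ s, |stabPoly (partAt a β) s| := by
        calc _ = |6 ^ n * ((1 / 3) ^ weight Q * β Q)| := by
              rw [abs_mul, abs_mul, abs_of_pos h6, abs_of_pos (by positivity : (0:ℝ) < (1/3) ^ _)]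
          _ ≤ _ := by
              rw [← h1]
              refine (Finset.abs_sum_le_sum_abs _ _).trans (Finset.sum_le_sum fun s _ => ?_)
              rw [abs_mul]
              exact mul_le_of_le_one_right (abs_nonneg _) (abs_stabChar_le_one _ _)
      have h3 : (1 : ℝ) ≤ 3 ^ κ * (1 / 3) ^ weight Q := by
        rw [one_div, inv_pow, ← div_eq_mul_inv, one_le_div (by positivity)]
        exact pow_le_pow_right₀ (by norm_num) hw
      calc |β Q| ≤ (3 ^ κ * (1 / 3) ^ weight Q) * |β Q| :=
            le_mul_of_one_le_left (abs_nonneg _) h3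
        _ = 3 ^ κ * ((1 / 3) ^ weight Q * |β Q|) := by ring
        _ ≤ _ := by
            gcongr
            rw [le_div_iff₀ h6, mul_comm]; exact h2
    · rw [hdeg Q (by omega), abs_zero]; positivity
  have hsum : ∀ a, ∑ Q with Q a ≠ 0, |β Q| ≤
      (d * 12 ^ κ) * ((∑ s, |stabPoly (partAt a β) s|) / 6 ^ n) := by
    intro a
    have e : ∑ Q with Q a ≠ 0, |β Q| = ∑ Q with pauliCoeff Q O ≠ 0 ∧ Q a ≠ 0, |β Q| := by
      refine (Finset.sum_subset (fun Q hQ => ?_) fun Q hQ hQ' => ?_).symm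
      · simp only [Finset.mem_filter, Finset.mem_univ, true_and] at hQ ⊢; exact hQ.2
      · simp only [Finset.mem_filter, Finset.mem_univ, true_and, not_and] at hQ hQ'
        have : pauliCoeff Q O = 0 := by by_contra h0; exact hQ' h0 hQ
        simp [hβ, this]
    rw [e]
    have h0 : 0 ≤ 3 ^ κ * ((∑ s, |stabPoly (partAt a β) s|) / 6 ^ n) := by positivity
    calc _ ≤ ∑ Q with pauliCoeff Q O ≠ 0 ∧ Q a ≠ 0,
          3 ^ κ * ((∑ s, |stabPoly (partAt a β) s|) / 6 ^ n) :=
          Finset.sum_le_sum fun Q hQ => hone a Q (Finset.mem_filter.mp hQ).2.2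
      _ ≤ ((d * 4 ^ κ : ℕ) : ℝ) * (3 ^ κ * ((∑ s, |stabPoly (partAt a β) s|) / 6 ^ n)) := by
          rw [Finset.sum_const, nsmul_eq_mul]
          exact mul_le_mul_of_nonneg_right (by exact_mod_cast h.card_le a) h0
      _ = _ := by
          push_cast
          rw [show (12 : ℝ) ^ κ = 4 ^ κ * 3 ^ κ by rw [← mul_pow]; norm_num]
          ring
  have hzero : |β 0| ≤ opNorm O := by
    have h1 := sum_pauliCoeff_re_sq_le hO (stateBound_opNorm O)
    have h2 := Finset.single_le_sum (f := fun P => (pauliCoeff P O).re ^ 2)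
        (fun P _ => sq_nonneg _) (Finset.mem_univ 0)
    exact abs_le_of_sq_le_sq (h2.trans h1) (opNorm_nonneg O)
  have hsplit : pauliL1 O ≤ |β 0| + ∑ a, ∑ Q with Q a ≠ 0, |β Q| := by
    rw [pauliL1]
    simp only [hnorm]
    rw [← Finset.add_sum_erase _ _ (Finset.mem_univ (0 : PauliString n))]
    gcongr
    simp only [Finset.sum_filter]
    rw [Finset.sum_comm]
    calc _ ≤ ∑ Q ∈ Finset.univ.erase (0 : PauliString n), ∑ a, (if Q a ≠ 0 then |β Q| else 0) := by
          refine Finset.sum_le_sum fun Q hQ => ?_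
          obtain ⟨a, ha⟩ := Function.ne_iff.mp (Finset.ne_of_mem_erase hQ)
          have := Finset.single_le_sum (f := fun a => if Q a ≠ 0 then |β Q| else 0)
            (fun a _ => by split_ifs <;> positivity) (Finset.mem_univ a)
          simpa [show Q a ≠ 0 from ha] using this
      _ ≤ _ := Finset.sum_le_univ_sum_of_nonneg fun Q =>
          Finset.sum_nonneg fun a _ => by split_ifs <;> positivity
  calc pauliL1 O ≤ |β 0| + ∑ a, ∑ Q with Q a ≠ 0, |β Q| := hsplit
    _ ≤ opNorm O + ∑ a, (d * 12 ^ κ) * ((∑ s, |stabPoly (partAt a β) s|) / 6 ^ n) := by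
        gcongr with a; exact hsum a
    _ = opNorm O + (d * 12 ^ κ) * ((∑ a, ∑ s, |stabPoly (partAt a β) s|) / 6 ^ n) := by
        rw [← Finset.mul_sum, Finset.sum_div]
    _ ≤ opNorm O + (d * 12 ^ κ) * (2 * κ ^ 2 * opNorm O) := by
        gcongr
        rw [div_le_iff₀ h6, mul_comm]; exact hinf
    _ = _ := by ring

end IsBoundedDegree

end

section


/-! ### Locally flat distributions -/

open MeasureTheory

variable {n : ℕ}

/-- The expectation value of the Pauli observable `P` in `ρ`. -/
def pauliExp (P : PauliString n) (ρ : Op n) : ℝ := (pauliOp P * ρ).trace.re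

theorem measurable_trace_mul_re (M : Op n) : Measurable fun ρ : Op n => (M * ρ).trace.re := by
  have hentry : ∀ x y, Measurable fun ρ : Op n => ρ x y := fun x y =>
    (measurable_pi_apply (X := fun _ : Fin n → Fin 2 => ℂ) y).comp
      (measurable_pi_apply (X := fun _ : Fin n → Fin 2 => (Fin n → Fin 2) → ℂ) x)
  refine Complex.measurable_re.comp ?_
  simp only [Matrix.trace, Matrix.diag, Matrix.mul_apply]
  exact Finset.measurable_fun_sum _ fun x _ => Finset.measurable_fun_sum _ fun y _ =>
    (hentry y x).const_mul _

theorem measurable_conj (U : Op n) : Measurable fun ρ : Op n => U * ρ * Uᴴ := by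
  have hentry : ∀ x y, Measurable fun ρ : Op n => ρ x y := fun x y =>
    (measurable_pi_apply (X := fun _ : Fin n → Fin 2 => ℂ) y).comp
      (measurable_pi_apply (X := fun _ : Fin n → Fin 2 => (Fin n → Fin 2) → ℂ) x)
  refine measurable_pi_iff.mpr fun x => measurable_pi_iff.mpr fun y => ?_
  simp only [Matrix.mul_apply]
  exact Finset.measurable_fun_sum _ fun z _ =>
    (Finset.measurable_fun_sum _ fun w _ => (hentry w z).const_mul _).mul_const _

theorem measurable_pauliExp (P : PauliString n) : Measurable (pauliExp P) :=
  measurable_trace_mul_re _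

theorem integrable_pauliExp_mul {D : Measure (Op n)} (hD : IsLocallyFlat D)
    (P Q : PauliString n) : Integrable (fun ρ => pauliExp P ρ * pauliExp Q ρ) D := by
  have := hD.prob
  refine Integrable.of_bound
    ((measurable_pauliExp P).mul (measurable_pauliExp Q)).aestronglyMeasurable
    (opNorm (pauliOp P) * opNorm (pauliOp Q)) ?_
  filter_upwards [hD.states] with ρ hρ
  rw [Real.norm_eq_abs, abs_mul]
  exact mul_le_mul (stateBound_opNorm _ _ hρ) (stateBound_opNorm _ _ hρ) (abs_nonneg _)
    (opNorm_nonneg _)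

/-- A one-qubit gate that permutes the Pauli observables up to signs. -/
theorem pauliExp_conj_localGate {U : Matrix (Fin 2) (Fin 2) ℂ} {sgn : Fin 4 → ℝ}
    {perm : Fin 4 → Fin 4} (hU : ∀ c, Uᴴ * pauli c * U = ((sgn c : ℝ) : ℂ) • pauli (perm c))
    (i : Fin n) (P : PauliString n) (c : Fin 4) (ρ : Op n) :
    pauliExp (Function.update P i c) (localGate i U * ρ * (localGate i U)ᴴ) =
      sgn c * pauliExp (Function.update P i (perm c)) ρ := by
  have h : (localGate i U)ᴴ * pauliOp (Function.update P i c) * localGate i U =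
      ((sgn c : ℝ) : ℂ) • pauliOp (Function.update P i (perm c)) := by
    rw [localGate, tensorOp_conjTranspose, pauliOp, pauliOp, tensorOp_mul, tensorOp_mul]
    have := tensorOp_smul (n := n) (Function.update (fun _ => 1) i ((sgn c : ℝ) : ℂ))
      (fun j => pauli (Function.update P i (perm c) j))
    rw [Finset.prod_update_of_mem (Finset.mem_univ i)] at this
    simp only [Finset.prod_const_one, mul_one] at this
    rw [← this]
    congr 1
    funext j
    by_cases hj : j = i
    · subst hj; simp [hU]
    · simp [hj]
  rw [pauliExp, pauliExp, ← Matrix.mul_assoc, Matrix.trace_mul_comm, ← Matrix.mul_assoc,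
    ← Matrix.mul_assoc, h, Matrix.smul_mul, Matrix.trace_smul, smul_eq_mul, Complex.re_ofReal_mul]

/-- The second moments of the Pauli expectation values. -/
def pauliMoment (D : Measure (Op n)) (P Q : PauliString n) : ℝ :=
  ∫ ρ, pauliExp P ρ * pauliExp Q ρ ∂D

theorem pauliMoment_update {D : Measure (Op n)} {U : Matrix (Fin 2) (Fin 2) ℂ} {sgn : Fin 4 → ℝ}
    {perm : Fin 4 → Fin 4} (hU : ∀ c, Uᴴ * pauli c * U = ((sgn c : ℝ) : ℂ) • pauli (perm c))
    {i : Fin n} (hD : IsInvariantUnder D (localGate i U)) (P Q : PauliString n) (a b : Fin 4) :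
    pauliMoment D (Function.update P i a) (Function.update Q i b) =
      sgn a * sgn b *
        pauliMoment D (Function.update P i (perm a)) (Function.update Q i (perm b)) := by
  have hD' : D.map (fun ρ => localGate i U * ρ * (localGate i U)ᴴ) = D := hD
  rw [pauliMoment]
  conv_lhs => rw [← hD']
  have hmeas : Measurable fun ρ : Op n =>
      pauliExp (Function.update P i a) ρ * pauliExp (Function.update Q i b) ρ :=
    (measurable_pauliExp _).mul (measurable_pauliExp _)
  rw [integral_map (measurable_conj _).aemeasurable hmeas.aestronglyMeasurable, pauliMoment,
    ← integral_const_mul]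
  refine integral_congr_ae (Filter.Eventually.of_forall fun ρ => ?_)
  simp only [pauliExp_conj_localGate hU]
  ring

theorem gateS_conj (c : Fin 4) : gateSᴴ * pauli c * gateS =
    (((![1, -1, 1, 1] : Fin 4 → ℝ) c : ℝ) : ℂ) • pauli ((![0, 2, 1, 3] : Fin 4 → Fin 4) c) := by
  ext x y
  fin_cases c <;> fin_cases x <;> fin_cases y <;>
    simp [gateS, pauli, Matrix.mul_apply, Fin.sum_univ_two]

theorem gateH_conj (c : Fin 4) : gateHᴴ * pauli c * gateH =
    (((![1, 1, -1, 1] : Fin 4 → ℝ) c : ℝ) : ℂ) • pauli ((![0, 3, 2, 1] : Fin 4 → Fin 4) c) := by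
  have h2 := ofReal_sqrt_two_mul_self
  have h3 : (((√2 : ℝ) : ℂ))⁻¹ * (((√2 : ℝ) : ℂ))⁻¹ = 1 / 2 := by
    rw [← mul_inv, h2]; norm_num
  rw [gateH, Matrix.conjTranspose_smul, Matrix.smul_mul, Matrix.smul_mul, Matrix.mul_smul,
    smul_smul]
  have h4 : star (((1 / √2 : ℝ) : ℂ)) * ((1 / √2 : ℝ) : ℂ) = 1 / 2 := by
    simp [h3]
  rw [h4]
  ext x y
  fin_cases c <;> fin_cases x <;> fin_cases y <;>
    simp [pauli, Matrix.mul_apply, Fin.sum_univ_two] <;> ring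

/-- Different Pauli observables are uncorrelated. -/
theorem pauliMoment_eq_zero {D : Measure (Op n)} (hD : IsLocallyFlat D) {P Q : PauliString n}
    (hPQ : P ≠ Q) : pauliMoment D P Q = 0 := by
  obtain ⟨i, hi⟩ := Function.ne_iff.mp hPQ
  have hS := pauliMoment_update gateS_conj (hD.invariantS i) P Q
  have hH := pauliMoment_update gateH_conj (hD.invariantH i) P Q
  set J : Fin 4 → Fin 4 → ℝ := fun a b =>
    pauliMoment D (Function.update P i a) (Function.update Q i b) with hJ
  have key : ∀ a b, a ≠ b → J a b = 0 := by
    intro a b hab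
    have s01 : J 0 1 = -J 0 2 := by simpa using hS 0 1
    have s02 : J 0 2 = J 0 1 := by simpa using hS 0 2
    have h03 : J 0 3 = J 0 1 := by simpa using hH 0 3
    have s10 : J 1 0 = -J 2 0 := by simpa using hS 1 0
    have s20 : J 2 0 = J 1 0 := by simpa using hS 2 0
    have h30 : J 3 0 = J 1 0 := by simpa using hH 3 0
    have h12 : J 1 2 = -J 3 2 := by simpa using hH 1 2
    have s32 : J 3 2 = J 3 1 := by simpa using hS 3 2
    have s31 : J 3 1 = -J 3 2 := by simpa using hS 3 1
    have h21 : J 2 1 = -J 2 3 := by simpa using hH 2 1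
    have s23 : J 2 3 = J 1 3 := by simpa using hS 2 3
    have s13 : J 1 3 = -J 2 3 := by simpa using hS 1 3
    fin_cases a <;> fin_cases b <;> first
      | exact absurd rfl hab
      | (dsimp only; simp only [Fin.mk_zero, Fin.mk_one, Fin.reduceFinMk]; linarith)
  have := key (P i) (Q i) hi
  simpa [hJ] using this

theorem pauliMoment_self_update {D : Measure (Op n)} (hD : IsLocallyFlat D) (P : PauliString n)
    (i : Fin n) {a b : Fin 4} (ha : a ≠ 0) (hb : b ≠ 0) :
    pauliMoment D (Function.update P i a) (Function.update P i a) =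
      pauliMoment D (Function.update P i b) (Function.update P i b) := by
  have hS := pauliMoment_update gateS_conj (hD.invariantS i) P P
  have hH := pauliMoment_update gateH_conj (hD.invariantH i) P P
  set J : Fin 4 → ℝ := fun a =>
    pauliMoment D (Function.update P i a) (Function.update P i a) with hJ
  have s : J 1 = J 2 := by simpa using hS 1 1
  have h : J 1 = J 3 := by simpa using hH 1 1
  have key : ∀ a, a ≠ 0 → J a = J 1 := by
    intro a ha
    fin_cases a
    · exact absurd rfl ha
    · rfl
    · exact s.symm
    · exact h.symm
  exact (key a ha).trans (key b hb).symm

theorem pauliMoment_self_eq {D : Measure (Op n)} (hD : IsLocallyFlat D) {P Q : PauliString n}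
    (hPQ : dom P = dom Q) : pauliMoment D P P = pauliMoment D Q Q := by
  have h0 : ∀ i, P i = 0 ↔ Q i = 0 := by
    intro i
    have := Finset.ext_iff.mp hPQ i
    simpa [dom, not_iff_not] using this
  -- the labels are exchanged one qubit at a time
  have key : ∀ T : Finset (Fin n), pauliMoment D P P =
      pauliMoment D (T.piecewise Q P) (T.piecewise Q P) := by
    intro T
    induction T using Finset.induction_on with
    | empty => simp
    | insert i T hi ih =>
      rw [ih, Finset.piecewise_insert]
      by_cases hz : P i = 0
      · have : Function.update (T.piecewise Q P) i (Q i) = T.piecewise Q P := by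
          rw [(h0 i).mp hz]
          refine Function.update_eq_self_iff.mpr ?_
          rw [Finset.piecewise_eq_of_notMem _ _ _ hi, hz]
        rw [this]
      · have h1 := pauliMoment_self_update hD (T.piecewise Q P) i hz (fun h => hz ((h0 i).mpr h))
        rw [← h1]
        have : Function.update (T.piecewise Q P) i (P i) = T.piecewise Q P := by
          refine Function.update_eq_self_iff.mpr ?_
          rw [Finset.piecewise_eq_of_notMem _ _ _ hi]
        rw [this]
  have := key Finset.univ
  simpa using this

/-! ### The purity bound -/

theorem norm_sq_le_of_posSemidef {ρ : Op n} (hρ : ρ.PosSemidef) (x y : Fin n → Fin 2) :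
    ‖ρ x y‖ ^ 2 ≤ (ρ x x).re * (ρ y y).re := by
  have h := (hρ.submatrix ![x, y]).det_nonneg
  rw [Matrix.det_fin_two] at h
  simp only [Matrix.submatrix_apply, Matrix.cons_val_zero, Matrix.cons_val_one] at h
  have hyx : ρ y x = star (ρ x y) := by
    conv_lhs => rw [← hρ.1.eq]
    rfl
  have him : ∀ z, (ρ z z).im = 0 := by
    intro z
    have : star (ρ z z) = ρ z z := by
      conv_rhs => rw [← hρ.1.eq]
      rfl
    exact Complex.conj_eq_iff_im.mp this
  have hre := (Complex.le_def.mp h).1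
  rw [hyx] at hre
  simp only [Complex.sub_re, Complex.mul_re, him, Complex.zero_re] at hre
  rw [← Complex.normSq_eq_norm_sq, Complex.normSq_apply]
  simp at hre
  linarith

theorem diag_re_nonneg {ρ : Op n} (hρ : ρ.PosSemidef) (x : Fin n → Fin 2) : 0 ≤ (ρ x x).re :=
  (Complex.le_def.mp (hρ.diag_nonneg (i := x))).1

theorem sum_dom_subset_pauliOp (A : Finset (Fin n)) (x y z w : Fin n → Fin 2) :
    ∑ P : PauliString n with dom P ⊆ A, pauliOp P x y * pauliOp P z w =
      if y = A.piecewise z x ∧ w = A.piecewise x z then 2 ^ A.card else 0 := by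
  have hset : (Finset.univ.filter fun P : PauliString n => dom P ⊆ A) =
      Fintype.piFinset fun i => if i ∈ A then (Finset.univ : Finset (Fin 4)) else {0} := by
    ext P
    simp only [Finset.mem_filter, Finset.mem_univ, true_and, Fintype.mem_piFinset, dom,
      Finset.subset_iff]
    refine forall_congr' fun i => ?_
    by_cases h : i ∈ A <;> simp [h]
  rw [hset]
  simp only [pauliOp, tensorOp, Matrix.of_apply, ← Finset.prod_mul_distrib]
  rw [← Finset.prod_univ_sum
    (fun i => if i ∈ A then (Finset.univ : Finset (Fin 4)) else {0})
    (fun i a => pauli a (x i) (y i) * pauli a (z i) (w i))]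
  have hfac : ∀ i, ∑ a ∈ (if i ∈ A then (Finset.univ : Finset (Fin 4)) else {0}),
      pauli a (x i) (y i) * pauli a (z i) (w i) =
        if y i = A.piecewise z x i ∧ w i = A.piecewise x z i then (if i ∈ A then 2 else 1)
        else 0 := by
    intro i
    by_cases h : i ∈ A
    · simp only [h, if_true, sum_pauli_mul_pauli, Finset.piecewise_eq_of_mem]
      simp only [and_comm, eq_comm]
    · simp only [h, if_false, Finset.sum_singleton, Finset.piecewise_eq_of_notMem,
        not_false_eq_true]
      simp only [pauli, Matrix.cons_val_zero, Matrix.one_apply]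
      simp only [eq_comm (a := x i), eq_comm (a := z i)]
      by_cases h1 : y i = x i <;> by_cases h2 : w i = z i <;> simp [h1, h2]
  rw [Finset.prod_congr rfl fun i _ => hfac i]
  by_cases h : y = A.piecewise z x ∧ w = A.piecewise x z
  · rw [if_pos h, Finset.prod_congr rfl fun i _ =>
      if_pos ⟨congrFun h.1 i, congrFun h.2 i⟩]
    simp
  · rw [if_neg h]
    have : ∃ i, ¬ (y i = A.piecewise z x i ∧ w i = A.piecewise x z i) := by
      by_contra hcon
      push Not at hcon
      exact h ⟨funext fun i => (hcon i).1, funext fun i => (hcon i).2⟩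
    obtain ⟨i, hi⟩ := this
    exact Finset.prod_eq_zero (Finset.mem_univ i) (if_neg hi)

/-- The sum of the squares of the Pauli expectation values on the qubits in `A` is `2^|A|` times
the purity of a reduced state, hence at most `2^|A|`. -/
theorem sum_dom_subset_pauliExp_sq_le (A : Finset (Fin n)) {ρ : Op n} (hρ : IsState ρ) :
    ∑ P : PauliString n with dom P ⊆ A, pauliExp P ρ ^ 2 ≤ 2 ^ A.card := by
  have hre : ∀ P : PauliString n, ((pauliExp P ρ : ℝ) : ℂ) = (pauliOp P * ρ).trace := by
    intro P
    have := trace_mul_im_eq_zero (pauliOp_isHermitian P) hρ.1.1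
    exact Complex.ext (by simp [pauliExp]) (by simp [this])
  have hexp : ((∑ P : PauliString n with dom P ⊆ A, pauliExp P ρ ^ 2 : ℝ) : ℂ) =
      2 ^ A.card * ∑ x : Fin n → Fin 2, ∑ z : Fin n → Fin 2,
        ρ (A.piecewise z x) x * ρ (A.piecewise x z) z := by
    have h1 : ∀ P : PauliString n, ((pauliExp P ρ : ℝ) : ℂ) ^ 2 =
        ∑ x, ∑ z, ∑ y, ∑ w, (pauliOp P x y * pauliOp P z w) * (ρ y x * ρ w z) := by
      intro P
      rw [hre, pow_two]
      simp only [Matrix.trace, Matrix.diag, Matrix.mul_apply]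
      rw [Finset.sum_mul_sum]
      refine Finset.sum_congr rfl fun x _ => Finset.sum_congr rfl fun z _ => ?_
      rw [Finset.sum_mul_sum]
      exact Finset.sum_congr rfl fun y _ => Finset.sum_congr rfl fun w _ => by ring
    push_cast
    simp_rw [h1]
    rw [Finset.sum_comm, Finset.mul_sum]
    refine Finset.sum_congr rfl fun x _ => ?_
    rw [Finset.sum_comm, Finset.mul_sum]
    refine Finset.sum_congr rfl fun z _ => ?_
    rw [Finset.sum_comm]
    simp_rw [Finset.sum_comm (s := Finset.univ.filter fun P : PauliString n => dom P ⊆ A),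
      ← Finset.sum_mul, sum_dom_subset_pauliOp]
    rw [Finset.sum_eq_single (A.piecewise z x), Finset.sum_eq_single (A.piecewise x z)]
    · simp
    · intro w _ hw; simp [hw]
    · simp
    · intro y _ hy; simp [hy]
    · simp
  set p : (Fin n → Fin 2) → ℝ := fun x => (ρ x x).re with hp
  have hp0 : ∀ x, 0 ≤ p x := diag_re_nonneg hρ.1
  have hp1 : ∑ x, p x = 1 := by
    have := congrArg Complex.re hρ.2
    simpa [Matrix.trace, hp] using this
  have hterm : ∀ x z, ‖ρ (A.piecewise z x) x * ρ (A.piecewise x z) z‖ ≤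
      (p x * p z + p (A.piecewise z x) * p (A.piecewise x z)) / 2 := by
    intro x z
    have h1 := norm_sq_le_of_posSemidef hρ.1 (A.piecewise z x) x
    have h2 := norm_sq_le_of_posSemidef hρ.1 (A.piecewise x z) z
    have a0 := hp0 x
    have b0 := hp0 z
    have c0 := hp0 (A.piecewise z x)
    have d0 := hp0 (A.piecewise x z)
    rw [norm_mul]
    refine abs_le_of_sq_le_sq' ?_ (by positivity) |>.2
    have h3 : (‖ρ (A.piecewise z x) x‖ * ‖ρ (A.piecewise x z) z‖) ^ 2 ≤
        (p (A.piecewise z x) * p x) * (p (A.piecewise x z) * p z) := by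
      rw [mul_pow]
      exact mul_le_mul h1 h2 (sq_nonneg _) (by positivity)
    nlinarith [sq_nonneg (p x * p z - p (A.piecewise z x) * p (A.piecewise x z))]
  have hdouble : ∑ x, ∑ z, p x * p z = 1 := by
    rw [← Finset.sum_mul_sum, hp1, one_mul]
  -- exchanging the coordinates in `A` permutes the pairs `(x, z)`
  have hswap : ∑ x : Fin n → Fin 2, ∑ z : Fin n → Fin 2,
      p (A.piecewise z x) * p (A.piecewise x z) = 1 := by
    rw [← hdouble, ← Fintype.sum_prod_type', ← Fintype.sum_prod_type']
    refine Finset.sum_bij' (fun q _ => (A.piecewise q.2 q.1, A.piecewise q.1 q.2))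
      (fun q _ => (A.piecewise q.2 q.1, A.piecewise q.1 q.2)) (fun _ _ => Finset.mem_univ _)
      (fun _ _ => Finset.mem_univ _) ?_ ?_ (fun _ _ => rfl) <;>
    · rintro ⟨x, z⟩ -
      ext i <;> by_cases h : i ∈ A <;> simp [h]
  have hnorm : ‖∑ x : Fin n → Fin 2, ∑ z : Fin n → Fin 2,
      ρ (A.piecewise z x) x * ρ (A.piecewise x z) z‖ ≤ 1 := by
    calc _ ≤ ∑ x : Fin n → Fin 2, ∑ z : Fin n → Fin 2,
          (p x * p z + p (A.piecewise z x) * p (A.piecewise x z)) / 2 :=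
          (norm_sum_le _ _).trans (Finset.sum_le_sum fun x _ => (norm_sum_le _ _).trans
            (Finset.sum_le_sum fun z _ => hterm x z))
      _ = 1 := by
          simp only [← Finset.sum_div, Finset.sum_add_distrib]
          rw [hdouble, hswap]; norm_num
  have h0 : 0 ≤ ∑ P : PauliString n with dom P ⊆ A, pauliExp P ρ ^ 2 :=
    Finset.sum_nonneg fun _ _ => sq_nonneg _
  calc _ = ‖((∑ P : PauliString n with dom P ⊆ A, pauliExp P ρ ^ 2 : ℝ) : ℂ)‖ := by
        rw [Complex.norm_real, Real.norm_eq_abs, abs_of_nonneg h0]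
    _ ≤ 2 ^ A.card * 1 := by
        rw [hexp, norm_mul, norm_pow, Complex.norm_ofNat]
        gcongr
    _ = _ := mul_one _

/-- The mean square of a Pauli expectation value under a locally flat distribution. -/
theorem pauliMoment_self_le {D : Measure (Op n)} (hD : IsLocallyFlat D) (P : PauliString n) :
    pauliMoment D P P ≤ (2 / 3) ^ weight P := by
  have := hD.prob
  have h1 : ∑ Q : PauliString n with dom Q = dom P, pauliMoment D Q Q =
      3 ^ weight P * pauliMoment D P P := by
    rw [Finset.sum_congr rfl fun Q hQ => pauliMoment_self_eq hD (Finset.mem_filter.mp hQ).2,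
      Finset.sum_const, card_dom_eq, nsmul_eq_mul]
    push_cast; rfl
  have hint : ∀ Q, Integrable (fun ρ => pauliExp Q ρ * pauliExp Q ρ) D := fun Q =>
    integrable_pauliExp_mul hD Q Q
  have h2 : ∑ Q : PauliString n with dom Q = dom P, pauliMoment D Q Q ≤ 2 ^ weight P := by
    simp only [pauliMoment]
    rw [← integral_finsetSum _ fun Q _ => hint Q]
    calc _ ≤ ∫ _ρ, (2 : ℝ) ^ weight P ∂D := by
          refine integral_mono_ae (integrable_finsetSum _ fun Q _ => hint Q)
            (integrable_const _) ?_
          filter_upwards [hD.states] with ρ hρ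
          refine le_trans ?_ (sum_dom_subset_pauliExp_sq_le (dom P) hρ)
          simp only [← pow_two]
          refine Finset.sum_le_sum_of_subset_of_nonneg ?_ fun _ _ _ => sq_nonneg _
          intro Q hQ
          simp only [Finset.mem_filter, Finset.mem_univ, true_and] at hQ ⊢
          exact hQ.le
      _ = _ := by simp
  rw [h1] at h2
  rw [div_pow, le_div_iff₀ (by positivity), mul_comm]
  exact h2

/-- The mean square prediction error in terms of the errors of the Pauli coefficients. -/
theorem integral_sq_sum_pauliExp_le {D : Measure (Op n)} (hD : IsLocallyFlat D)
    (β : PauliString n → ℝ) :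
    Integrable (fun ρ => |∑ P, β P * pauliExp P ρ| ^ 2) D ∧
      ∫ ρ, |∑ P, β P * pauliExp P ρ| ^ 2 ∂D ≤ ∑ P, (2 / 3) ^ weight P * β P ^ 2 := by
  have hint := integrable_pauliExp_mul hD
  have e : (fun ρ => |∑ P, β P * pauliExp P ρ| ^ 2) =
      fun ρ => ∑ P, ∑ Q, β P * β Q * (pauliExp P ρ * pauliExp Q ρ) := by
    funext ρ
    rw [sq_abs, pow_two, Finset.sum_mul_sum]
    exact Finset.sum_congr rfl fun P _ => Finset.sum_congr rfl fun Q _ => by ring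
  have hint2 : ∀ P, Integrable (fun ρ => ∑ Q, β P * β Q * (pauliExp P ρ * pauliExp Q ρ)) D :=
    fun P => integrable_finsetSum _ fun Q _ => (hint P Q).const_mul _
  rw [e]
  refine ⟨integrable_finsetSum _ fun P _ => hint2 P, ?_⟩
  rw [integral_finsetSum _ fun P _ => hint2 P]
  refine Finset.sum_le_sum fun P _ => ?_
  rw [integral_finsetSum _ fun Q _ => (hint P Q).const_mul _]
  simp only [integral_const_mul]
  rw [Finset.sum_eq_single P]
  · have := pauliMoment_self_le hD P
    rw [pauliMoment] at this
    nlinarith [sq_nonneg (β P)]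
  · intro Q _ hQ
    have := pauliMoment_eq_zero hD (Ne.symm hQ)
    rw [pauliMoment] at this
    rw [this, mul_zero]
  · simp

end

section


/-! ### Quantum processes in the Heisenberg picture -/

variable {n : ℕ}

theorem IsCPTP.isState {E : Op n →ₗ[ℂ] Op n} (hE : IsCPTP E) {ρ : Op n} (hρ : IsState ρ) :
    IsState (E ρ) := by
  refine ⟨?_, by rw [hE.tracePreserving, hρ.2]⟩
  have h := hE.completelyPositive 1 (ρ.submatrix Prod.snd Prod.snd) (hρ.1.submatrix _)
  exact h.submatrix fun x => ((0 : Fin 1), x)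

theorem trace_mul_re_nonneg {A B : Op n} (hA : A.PosSemidef) (hB : B.PosSemidef) :
    0 ≤ (A * B).trace.re := by
  obtain ⟨m, v, rfl⟩ := Matrix.posSemidef_iff_eq_sum_vecMulVec.mp hB
  rw [Finset.mul_sum, Matrix.trace_sum, Complex.re_sum]
  refine Finset.sum_nonneg fun i _ => ?_
  rw [Matrix.mul_vecMulVec, Matrix.trace_vecMulVec, dotProduct_comm]
  exact (Complex.le_def.mp (hA.dotProduct_mulVec_nonneg (v i))).1

theorem pauliCoeff_heisenberg (E : Op n →ₗ[ℂ] Op n) (O : Op n) (P : PauliString n) :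
    pauliCoeff P (heisenberg E O) = (O * E (pauliOp P)).trace / 2 ^ n := by
  rw [pauliCoeff, Matrix.trace_mul_comm, trace_heisenberg_mul]

/-- The Pauli coefficients of `E†(O)` as averages over product stabilizer input states. -/
theorem sum_stabChar_mul_trace (E : Op n →ₗ[ℂ] Op n) (O : Op n) (P : PauliString n) :
    ∑ s, ((stabChar P s : ℝ) : ℂ) * (O * E (stabProd s)).trace =
      (((1 / 3) ^ weight P * 6 ^ n : ℝ) : ℂ) * pauliCoeff P (heisenberg E O) := by
  have h := congrArg (fun X => (O * E X).trace) (sum_stabChar_smul_stabProd P)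
  simp only [map_sum, map_smul, Matrix.mul_sum, Matrix.trace_sum, Matrix.mul_smul,
    Matrix.trace_smul, smul_eq_mul] at h
  rw [h, pauliCoeff_heisenberg]
  have h2 : (2 : ℂ) ^ n ≠ 0 := by positivity
  have h6 : (6 : ℂ) ^ n = 3 ^ n * 2 ^ n := by rw [← mul_pow]; norm_num
  push_cast
  rw [h6]
  field_simp

theorem sum_stabChar_mul_trace_re {E : Op n →ₗ[ℂ] Op n} (hE : IsCPTP E) {O : Op n}
    (hO : O.IsHermitian) (P : PauliString n) :
    ((∑ s, stabChar P s * (O * E (stabProd s)).trace.re : ℝ) : ℂ) =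
      (((1 / 3) ^ weight P * 6 ^ n : ℝ) : ℂ) * pauliCoeff P (heisenberg E O) := by
  rw [← sum_stabChar_mul_trace]
  push_cast
  refine Finset.sum_congr rfl fun s _ => ?_
  congr 1
  have := trace_mul_im_eq_zero hO (hE.isState (stabProd_isState s)).1.1
  exact Complex.ext (by simp) (by simp [this])

theorem heisenberg_isHermitian {E : Op n →ₗ[ℂ] Op n} (hE : IsCPTP E) {O : Op n}
    (hO : O.IsHermitian) : (heisenberg E O).IsHermitian := by
  refine isHermitian_of_pauliCoeff_real fun P => ?_
  have h := congrArg Complex.im (sum_stabChar_mul_trace_re hE hO P)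
  rw [Complex.ofReal_im, Complex.im_ofReal_mul] at h
  exact (mul_eq_zero.mp h.symm).resolve_left (by positivity)

theorem stateBound_heisenberg {E : Op n →ₗ[ℂ] Op n} (hE : IsCPTP E) (O : Op n) :
    StateBound (heisenberg E O) (opNorm O) := fun ρ hρ => by
  rw [trace_heisenberg_mul]
  exact stateBound_opNorm O _ (hE.isState hρ)

theorem pauliCoeff_heisenberg_sum {E : Op n →ₗ[ℂ] Op n} (hE : IsCPTP E) (O : Op n)
    (P : PauliString n) : (pauliCoeff P (heisenberg E O)).re =
      ∑ Q, (pauliCoeff Q O).re * (pauliCoeff P (heisenberg E (pauliOp Q))).re := by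
  have h : pauliCoeff P (heisenberg E O) =
      ∑ Q, pauliCoeff Q O * pauliCoeff P (heisenberg E (pauliOp Q)) := by
    simp only [pauliCoeff_heisenberg]
    rw [trace_mul_eq_sum_pauliCoeff, Finset.sum_div]
    exact Finset.sum_congr rfl fun Q _ => by rw [mul_div_assoc]
  rw [h, Complex.re_sum]
  refine Finset.sum_congr rfl fun Q _ => ?_
  rw [pauliCoeff_eq_re (heisenberg_isHermitian hE (pauliOp_isHermitian Q)) P, Complex.re_mul_ofReal,
    Complex.ofReal_re]

/-! ### The statistics of a randomized experiment -/

theorem experimentProb_nonneg {E : Op n →ₗ[ℂ] Op n} (hE : IsCPTP E)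
    (s : (Fin n → Fin 6) × (Fin n → Fin 6)) : 0 ≤ experimentProb E s := by
  have := trace_mul_re_nonneg (stabProd_isState s.2).1 (hE.isState (stabProd_isState s.1)).1
  rw [experimentProb]
  positivity

/-- The single-experiment estimator of the coefficient of `P` in `E†(Q)`. -/
def pauliEstimator (P Q : PauliString n) (s : (Fin n → Fin 6) × (Fin n → Fin 6)) : ℝ :=
  stabChar P s.1 * (3 ^ weight Q * stabChar Q s.2)

theorem sum_experimentProb_mul_pauliEstimator {E : Op n →ₗ[ℂ] Op n} (hE : IsCPTP E)
    (P Q : PauliString n) :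
    ∑ s, experimentProb E s * pauliEstimator P Q s =
      (1 / 3) ^ weight P * (pauliCoeff P (heisenberg E (pauliOp Q))).re := by
  have hin : ∀ X : Op n, ∑ s, stabChar Q s * (stabProd s * X).trace.re =
      (1 / 3) ^ weight Q * 3 ^ n * (pauliOp Q * X).trace.re := by
    intro X
    have h := congrArg (fun Y => (Y * X).trace.re) (sum_stabChar_smul_stabProd Q)
    simp only [Finset.sum_mul, Matrix.trace_sum, Matrix.smul_mul, Matrix.trace_smul,
      smul_eq_mul, Complex.re_sum, Complex.re_ofReal_mul] at h
    exact h
  have hout : ∑ s, stabChar P s * (pauliOp Q * E (stabProd s)).trace.re =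
      (1 / 3) ^ weight P * 6 ^ n * (pauliCoeff P (heisenberg E (pauliOp Q))).re := by
    have h := congrArg Complex.re (sum_stabChar_mul_trace_re hE (pauliOp_isHermitian Q) P)
    rwa [Complex.ofReal_re, Complex.re_ofReal_mul] at h
  rw [Fintype.sum_prod_type]
  have h1 : ∀ s : Fin n → Fin 6,
      ∑ s', experimentProb E (s, s') * pauliEstimator P Q (s, s') =
        (1 / 6) ^ n * (stabChar P s * (pauliOp Q * E (stabProd s)).trace.re) := by
    intro s
    calc _ = (1 / 6) ^ n * (1 / 3) ^ n * stabChar P s * 3 ^ weight Q *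
          ∑ s', stabChar Q s' * (stabProd s' * E (stabProd s)).trace.re := by
          rw [Finset.mul_sum]
          exact Finset.sum_congr rfl fun s' _ => by
            simp only [experimentProb, pauliEstimator]; ring
      _ = _ := by
          rw [hin]
          have e1 : (3 : ℝ) ^ weight Q * (1 / 3) ^ weight Q = 1 := by
            rw [← mul_pow]; norm_num
          have e2 : (1 / 3 : ℝ) ^ n * 3 ^ n = 1 := by rw [← mul_pow]; norm_num
          calc _ = (1 / 6) ^ n * (stabChar P s * (pauliOp Q * E (stabProd s)).trace.re) *
                ((3 : ℝ) ^ weight Q * (1 / 3) ^ weight Q) * ((1 / 3 : ℝ) ^ n * 3 ^ n) := by ring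
            _ = _ := by rw [e1, e2]; ring
  simp_rw [h1]
  rw [← Finset.mul_sum, hout]
  have e : (1 / 6 : ℝ) ^ n * 6 ^ n = 1 := by rw [← mul_pow]; norm_num
  calc _ = (1 / 3) ^ weight P * (pauliCoeff P (heisenberg E (pauliOp Q))).re *
        ((1 / 6 : ℝ) ^ n * 6 ^ n) := by ring
    _ = _ := by rw [e, mul_one]

theorem sum_experimentProb {E : Op n →ₗ[ℂ] Op n} (hE : IsCPTP E) :
    ∑ s, experimentProb E s = 1 := by
  have h := sum_experimentProb_mul_pauliEstimator hE 0 0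
  have h1 : pauliOp (0 : PauliString n) = 1 := by
    rw [← tensorOp_one]; rfl
  have h2 : (2 : ℂ) ^ n ≠ 0 := by positivity
  simp only [pauliEstimator, stabChar_zero, weight_zero, pow_zero, mul_one, one_mul,
    pauliCoeff_heisenberg, h1, hE.tracePreserving] at h
  rw [h, Matrix.trace_one]
  simp

theorem abs_pauliEstimator_le {κ : ℕ} {P Q : PauliString n} (hQ : weight Q ≤ κ)
    (s : (Fin n → Fin 6) × (Fin n → Fin 6)) : |pauliEstimator P Q s| ≤ 3 ^ κ := by
  rw [pauliEstimator, abs_mul, abs_mul, abs_of_pos (by positivity : (0 : ℝ) < 3 ^ weight Q)]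
  have h3 : (3 : ℝ) ^ weight Q ≤ 3 ^ κ := pow_le_pow_right₀ (by norm_num) hQ
  calc |stabChar P s.1| * (3 ^ weight Q * |stabChar Q s.2|) ≤ 1 * (3 ^ κ * 1) := by
        gcongr
        · exact abs_stabChar_le_one _ _
        · exact abs_stabChar_le_one _ _
    _ = _ := by ring

theorem trace_mul_shadow (O : Op n) (s : Fin n → Fin 6) :
    (O * tensorOp fun i => (3 : ℂ) • stabProj (s i) - 1).trace.re =
      ∑ Q, (pauliCoeff Q O).re * (3 ^ weight Q * stabChar Q s) := by
  rw [trace_mul_eq_sum_pauliCoeff, Complex.re_sum]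
  refine Finset.sum_congr rfl fun Q _ => ?_
  have : (pauliOp Q * tensorOp fun i => (3 : ℂ) • stabProj (s i) - 1).trace =
      ((3 ^ weight Q * stabChar Q s : ℝ) : ℂ) := by
    rw [pauliOp, tensorOp_mul, trace_tensorOp]
    simp only [trace_pauli_mul_shadow]
    rw [← Complex.ofReal_prod, Finset.prod_mul_distrib, prod_ite_eq_pow_weight, stabChar]
  rw [this, Complex.re_mul_ofReal]

theorem xHat_eq {N : ℕ} (S : Shadow n N) (P : PauliString n) (O : Op n) :
    xHat S P O = ∑ Q, (pauliCoeff Q O).re * ((1 / N) * ∑ l, pauliEstimator P Q (S l)) := by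
  rw [xHat]
  simp only [trace_pauliOp_mul_stabProd, trace_mul_shadow, Complex.ofReal_re, Finset.mul_sum]
  rw [Finset.sum_comm]
  refine Finset.sum_congr rfl fun Q _ => Finset.sum_congr rfl fun l _ => ?_
  rw [pauliEstimator]; ring

/-! ### Concentration -/

/-- Hoeffding's inequality for independent samples from a finite probability space. -/
theorem sum_prod_ge_le_exp {Ω : Type*} [Fintype Ω] [DecidableEq Ω] {p X : Ω → ℝ} (hp : ∀ s, 0 ≤ p s)
    (hp1 : ∑ s, p s = 1) {b : ℝ} (hb : 0 < b) (hX : ∀ s, |X s| ≤ b) (hX0 : ∑ s, p s * X s = 0)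
    (N : ℕ) (t : ℝ) (ht : 0 ≤ t) :
    (∑ S : Fin N → Ω, if t * N ≤ ∑ l, X (S l) then ∏ l, p (S l) else 0) ≤
      Real.exp (-(N * t ^ 2 / (2 * b ^ 2))) := by
  set r : ℝ := t / b ^ 2 with hr
  have hmgf : ∑ s, p s * Real.exp (r * X s) ≤ Real.exp ((r * b) ^ 2 / 2) := by
    have hchord : ∀ s, Real.exp (r * X s) ≤
        Real.cosh (r * b) + X s / b * Real.sinh (r * b) := by
      intro s
      obtain ⟨h1, h2⟩ := abs_le.mp (hX s)
      have hw1 : 0 ≤ (b + X s) / (2 * b) := div_nonneg (by linarith) (by linarith)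
      have hw2 : 0 ≤ (b - X s) / (2 * b) := div_nonneg (by linarith) (by linarith)
      obtain ⟨-, hcx⟩ := convexOn_exp
      have hc := hcx (Set.mem_univ (r * b)) (Set.mem_univ (-(r * b))) hw1 hw2
        (by field_simp; ring)
      have e : ((b + X s) / (2 * b)) • (r * b) + ((b - X s) / (2 * b)) • (-(r * b)) = r * X s := by
        simp only [smul_eq_mul]; field_simp; ring
      rw [e] at hc
      refine hc.trans (le_of_eq ?_)
      rw [Real.cosh_eq, Real.sinh_eq]
      simp only [smul_eq_mul]; field_simp; ring
    calc ∑ s, p s * Real.exp (r * X s)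
        ≤ ∑ s, p s * (Real.cosh (r * b) + X s / b * Real.sinh (r * b)) :=
          Finset.sum_le_sum fun s _ => mul_le_mul_of_nonneg_left (hchord s) (hp s)
      _ = (∑ s, p s) * Real.cosh (r * b) + (∑ s, p s * X s) * (Real.sinh (r * b) / b) := by
          rw [Finset.sum_mul, Finset.sum_mul, ← Finset.sum_add_distrib]
          exact Finset.sum_congr rfl fun s _ => by ring
      _ = Real.cosh (r * b) := by rw [hp1, hX0]; ring
      _ ≤ _ := Real.cosh_le_exp_half_sq _
  have hr0 : 0 ≤ r := by positivity
  calc _ ≤ ∑ S : Fin N → Ω, Real.exp (-(r * (t * N))) * ∏ l, p (S l) * Real.exp (r * X (S l)) := by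
        refine Finset.sum_le_sum fun S _ => ?_
        have hpp : 0 ≤ ∏ l, p (S l) := Finset.prod_nonneg fun l _ => hp _
        rw [Finset.prod_mul_distrib, ← Real.exp_sum, ← Finset.mul_sum, mul_left_comm, ← Real.exp_add]
        split_ifs with h
        · refine le_mul_of_one_le_right hpp (Real.one_le_exp ?_)
          nlinarith
        · positivity
    _ = Real.exp (-(r * (t * N))) * (∑ s, p s * Real.exp (r * X s)) ^ N := by
        rw [← Finset.mul_sum]
        congr 1
        have := Finset.prod_univ_sum (fun _ : Fin N => (Finset.univ : Finset Ω))
          (fun _ s => p s * Real.exp (r * X s))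
        rw [Fintype.piFinset_univ] at this
        rw [← this]
        simp
    _ ≤ Real.exp (-(r * (t * N))) * Real.exp ((r * b) ^ 2 / 2) ^ N := by
        gcongr
        exact Finset.sum_nonneg fun s _ => mul_nonneg (hp s) (Real.exp_pos _).le
    _ = _ := by
        rw [← Real.exp_nat_mul, ← Real.exp_add]
        congr 1
        rw [hr]; field_simp; ring

theorem shadowProb_mono {N : ℕ} {E : Op n →ₗ[ℂ] Op n} (hE : IsCPTP E) {A B : Set (Shadow n N)}
    (h : A ⊆ B) : shadowProb E A ≤ shadowProb E B := by
  classical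
  refine Finset.sum_le_sum_of_subset_of_nonneg (fun S hS => ?_) fun S _ _ =>
    Finset.prod_nonneg fun l _ => experimentProb_nonneg hE _
  simp only [Finset.mem_filter, Finset.mem_univ, true_and] at hS ⊢
  exact h hS

theorem shadowProb_nonneg {N : ℕ} {E : Op n →ₗ[ℂ] Op n} (hE : IsCPTP E) (A : Set (Shadow n N)) :
    0 ≤ shadowProb E A :=
  Finset.sum_nonneg fun _ _ => Finset.prod_nonneg fun _ _ => experimentProb_nonneg hE _

/-- The data for which all low-weight estimates are `τ`-accurate. -/
def goodShadows (E : Op n →ₗ[ℂ] Op n) (N k κ : ℕ) (τ : ℝ) : Set (Shadow n N) :=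
  {S | ∀ P Q, weight P ≤ k → weight Q ≤ κ →
    |(1 / N) * ∑ l, pauliEstimator P Q (S l) -
      (1 / 3) ^ weight P * (pauliCoeff P (heisenberg E (pauliOp Q))).re| ≤ τ}

theorem le_shadowProb_goodShadows (hn : 1 ≤ n) {N : ℕ} (hN : 1 ≤ N) {E : Op n →ₗ[ℂ] Op n}
    (hE : IsCPTP E) (k κ : ℕ) {τ : ℝ} (hτ : 0 < τ) :
    1 - 882 * (n : ℝ) ^ (k + κ) * Real.exp (-(N * τ ^ 2 / (8 * 9 ^ κ))) ≤
      shadowProb E (goodShadows E N k κ τ) := by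
  classical
  set p := experimentProb E with hp
  have hp0 := experimentProb_nonneg hE
  have hp1 := sum_experimentProb hE
  set μ : PauliString n → PauliString n → ℝ := fun P Q =>
    (1 / 3) ^ weight P * (pauliCoeff P (heisenberg E (pauliOp Q))).re with hμ
  set I : Finset (PauliString n × PauliString n) :=
    (Finset.univ.filter fun P => weight P ≤ k) ×ˢ (Finset.univ.filter fun Q => weight Q ≤ κ) with hI
  have hμb : ∀ P Q, weight Q ≤ κ → |μ P Q| ≤ 3 ^ κ := by
    intro P Q hQ
    rw [hμ]
    dsimp only
    rw [← sum_experimentProb_mul_pauliEstimator hE]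
    calc _ ≤ ∑ s, |experimentProb E s * pauliEstimator P Q s| := Finset.abs_sum_le_sum_abs _ _
      _ ≤ ∑ s, experimentProb E s * 3 ^ κ := by
          refine Finset.sum_le_sum fun s _ => ?_
          rw [abs_mul, abs_of_nonneg (hp0 s)]
          exact mul_le_mul_of_nonneg_left (abs_pauliEstimator_le hQ s) (hp0 s)
      _ = _ := by rw [← Finset.sum_mul, hp1, one_mul]
  have htail : ∀ P Q, weight Q ≤ κ → ∀ sg : ℝ, |sg| = 1 →
      (∑ S : Shadow n N, if τ * N ≤ ∑ l, sg * (pauliEstimator P Q (S l) - μ P Q)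
        then ∏ l, p (S l) else 0) ≤ Real.exp (-(N * τ ^ 2 / (8 * 9 ^ κ))) := by
    intro P Q hQ sg hsg
    have h := sum_prod_ge_le_exp (p := p) (X := fun s => sg * (pauliEstimator P Q s - μ P Q))
      hp0 hp1 (b := 2 * 3 ^ κ) (by positivity) ?_ ?_ N τ hτ.le
    · refine h.trans (le_of_eq ?_)
      have : 2 * ((2 : ℝ) * 3 ^ κ) ^ 2 = 8 * 9 ^ κ := by
        rw [mul_pow, ← pow_mul, mul_comm κ, pow_mul]; norm_num; ring
      rw [this]
    · intro s
      rw [abs_mul, hsg, one_mul]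
      have h1 := abs_sub (pauliEstimator P Q s) (μ P Q)
      have h2 := abs_pauliEstimator_le (P := P) hQ s
      have h3 := hμb P Q hQ
      linarith
    · have h1 := sum_experimentProb_mul_pauliEstimator hE P Q
      calc _ = sg * (∑ s, p s * pauliEstimator P Q s - (∑ s, p s) * μ P Q) := by
            rw [Finset.sum_mul, ← Finset.sum_sub_distrib, Finset.mul_sum]
            exact Finset.sum_congr rfl fun s _ => by ring
        _ = 0 := by rw [hp1, h1]; simp [hμ]
  have htotal : ∑ S : Shadow n N, ∏ l, p (S l) = 1 := by
    have := Finset.prod_univ_sum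
      (fun _ : Fin N => (Finset.univ : Finset ((Fin n → Fin 6) × (Fin n → Fin 6))))
      (fun _ s => p s)
    rw [Fintype.piFinset_univ] at this
    rw [← this, hp1]
    simp
  have hpp : ∀ S : Shadow n N, 0 ≤ ∏ l, p (S l) := fun S => Finset.prod_nonneg fun l _ => hp0 _
  have hcompl : shadowProb E (goodShadows E N k κ τ) =
      1 - ∑ S with S ∉ goodShadows E N k κ τ, ∏ l, p (S l) := by
    rw [← htotal, ← Finset.sum_filter_add_sum_filter_not Finset.univ
      (fun S => S ∈ goodShadows E N k κ τ)]
    simp [shadowProb, hp]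
  set F : PauliString n × PauliString n → ℝ → Shadow n N → ℝ := fun PQ sg S =>
    if τ * N ≤ ∑ l, sg * (pauliEstimator PQ.1 PQ.2 (S l) - μ PQ.1 PQ.2)
    then ∏ l, p (S l) else 0 with hF
  have hF0 : ∀ PQ sg S, 0 ≤ F PQ sg S := fun PQ sg S => by
    rw [hF]; dsimp only
    split_ifs
    · exact hpp S
    · exact le_rfl
  have hone : ∀ S, S ∉ goodShadows E N k κ τ →
      ∏ l, p (S l) ≤ ∑ PQ ∈ I, (F PQ 1 S + F PQ (-1) S) := by
    intro S hgood
    have h : ¬ ∀ P Q, weight P ≤ k → weight Q ≤ κ →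
        |(1 / N) * ∑ l, pauliEstimator P Q (S l) - μ P Q| ≤ τ := hgood
    push Not at h
    obtain ⟨P, Q, hP, hQ, h⟩ := h
    have hmem : (P, Q) ∈ I := by simp [hI, hP, hQ]
    have hNpos : (0 : ℝ) < N := by exact_mod_cast hN
    have e : ∑ l, (pauliEstimator P Q (S l) - μ P Q) =
        N * ((1 / N) * ∑ l, pauliEstimator P Q (S l) - μ P Q) := by
      rw [Finset.sum_sub_distrib, Finset.sum_const, Finset.card_univ, Fintype.card_fin,
        nsmul_eq_mul]
      field_simp
    have hsingle : F (P, Q) 1 S + F (P, Q) (-1) S ≤ ∑ PQ ∈ I, (F PQ 1 S + F PQ (-1) S) :=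
      Finset.single_le_sum (f := fun PQ => F PQ 1 S + F PQ (-1) S)
        (fun PQ _ => add_nonneg (hF0 _ _ _) (hF0 _ _ _)) hmem
    refine le_trans ?_ hsingle
    rcases lt_abs.mp h with h | h
    · have hle : τ * N ≤ ∑ l, 1 * (pauliEstimator P Q (S l) - μ P Q) := by
        rw [← Finset.mul_sum, e]
        nlinarith
      have : F (P, Q) 1 S = ∏ l, p (S l) := if_pos hle
      rw [this]
      linarith [hF0 (P, Q) (-1) S]
    · have hle : τ * N ≤ ∑ l, -1 * (pauliEstimator P Q (S l) - μ P Q) := by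
        rw [← Finset.mul_sum, e]
        nlinarith
      have : F (P, Q) (-1) S = ∏ l, p (S l) := if_pos hle
      rw [this]
      linarith [hF0 (P, Q) 1 S]
  have hbad : ∑ S with S ∉ goodShadows E N k κ τ, ∏ l, p (S l) ≤
      ∑ PQ ∈ I, (∑ S, F PQ 1 S + ∑ S, F PQ (-1) S) := by
    calc _ ≤ ∑ S with S ∉ goodShadows E N k κ τ, ∑ PQ ∈ I, (F PQ 1 S + F PQ (-1) S) :=
          Finset.sum_le_sum fun S hS => hone S (Finset.mem_filter.mp hS).2
      _ ≤ ∑ S, ∑ PQ ∈ I, (F PQ 1 S + F PQ (-1) S) :=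
          Finset.sum_le_univ_sum_of_nonneg fun S =>
            Finset.sum_nonneg fun PQ _ => add_nonneg (hF0 _ _ _) (hF0 _ _ _)
      _ = _ := by
          rw [Finset.sum_comm]
          exact Finset.sum_congr rfl fun PQ _ => Finset.sum_add_distrib
  rw [hcompl]
  have hcard : (I.card : ℝ) ≤ 441 * (n : ℝ) ^ (k + κ) := by
    rw [hI, Finset.card_product]
    push_cast
    calc _ ≤ (21 * (n : ℝ) ^ k) * (21 * (n : ℝ) ^ κ) :=
          mul_le_mul (card_weight_le hn k) (card_weight_le hn κ) (by positivity) (by positivity)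
      _ = _ := by rw [pow_add]; ring
  have hfinal : ∑ S with S ∉ goodShadows E N k κ τ, ∏ l, p (S l) ≤
      882 * (n : ℝ) ^ (k + κ) * Real.exp (-(N * τ ^ 2 / (8 * 9 ^ κ))) := by
    set e := Real.exp (-(N * τ ^ 2 / (8 * 9 ^ κ))) with he
    refine hbad.trans ?_
    calc _ ≤ ∑ PQ ∈ I, (e + e) := by
          refine Finset.sum_le_sum fun PQ hPQ => ?_
          have hQ : weight PQ.2 ≤ κ := by simp [hI] at hPQ; exact hPQ.2
          exact add_le_add (htail _ _ hQ 1 (by simp)) (htail _ _ hQ (-1) (by simp))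
      _ = I.card * (2 * e) := by
          rw [Finset.sum_const, nsmul_eq_mul]; ring
      _ ≤ (441 * (n : ℝ) ^ (k + κ)) * (2 * e) := by
          gcongr
      _ = _ := by ring
  linarith

/-- Accuracy of the estimates for an arbitrary observable of bounded degree, by linearity. -/
theorem abs_xHat_sub_le {N k κ d : ℕ} {τ : ℝ} {E : Op n →ₗ[ℂ] Op n} (hE : IsCPTP E)
    {S : Shadow n N} (hS : S ∈ goodShadows E N k κ τ) {O : Op n} (hO : IsBoundedDegree κ d O)
    {P : PauliString n} (hP : weight P ≤ k) :
    |xHat S P O - (1 / 3) ^ weight P * (pauliCoeff P (heisenberg E O)).re| ≤ pauliL1 O * τ := by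
  rw [xHat_eq, pauliCoeff_heisenberg_sum hE, Finset.mul_sum, ← Finset.sum_sub_distrib, pauliL1,
    Finset.sum_mul]
  refine (Finset.abs_sum_le_sum_abs _ _).trans (Finset.sum_le_sum fun Q _ => ?_)
  by_cases hQ : pauliCoeff Q O = 0
  · simp [hQ]
  · have h1 := hS P Q hP (hO.weight_le hQ)
    calc _ = |(pauliCoeff Q O).re| * |(1 / N) * ∑ l, pauliEstimator P Q (S l) -
          (1 / 3) ^ weight P * (pauliCoeff P (heisenberg E (pauliOp Q))).re| := by
          rw [← abs_mul]; congr 1; ring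
      _ ≤ _ := mul_le_mul (Complex.abs_re_le_norm _) h1 (abs_nonneg _) (norm_nonneg _)

end

section


/-! ### Accuracy of the learned function -/

variable {n : ℕ}

/-- The filter makes the error of an estimated coefficient at most the coefficient itself, and at
most the filter threshold. -/
theorem sq_alphaHat_sub_le {N k : ℕ} {τ η α : ℝ} (hτ : 0 < τ) (hτk : 2 * τ < (1 / 3) ^ k)
    {S : Shadow n N} {O : Op n} (hη : pauliL1 O = η) {P : PauliString n} (hP : weight P ≤ k)
    (hx : |xHat S P O - (1 / 3) ^ weight P * α| ≤ η * τ) :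
    (alphaHat S τ P O - α) ^ 2 ≤ min (α ^ 2) (9 * 3 ^ k * η ^ 2 * τ) := by
  set p : ℝ := (1 / 3) ^ weight P with hp
  set x := xHat S P O with hxd
  have hp0 : 0 < p := by positivity
  have hη0 : 0 ≤ η := by
    rw [← hη]; exact Finset.sum_nonneg fun _ _ => norm_nonneg _
  have hpk : (1 / 3 : ℝ) ^ k ≤ p := pow_le_pow_of_le_one (by norm_num) (by norm_num) hP
  have hτp : 2 * τ < p := hτk.trans_le hpk
  have hinv : 1 / p ≤ 3 ^ k := by
    rw [hp, one_div, one_div, inv_pow, inv_inv]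
    exact pow_le_pow_right₀ (by norm_num) hP
  set st := √τ with hst
  set sp := √p with hsp
  have hst0 : 0 < st := Real.sqrt_pos.mpr hτ
  have hsp0 : 0 < sp := Real.sqrt_pos.mpr hp0
  have hst2 : st * st = τ := Real.mul_self_sqrt hτ.le
  have hsp2 : sp * sp = p := Real.mul_self_sqrt hp0.le
  have hlt : st ≤ sp := Real.sqrt_le_sqrt (by linarith)
  have hητ : η * τ ≤ η * st * sp := by
    rw [← hst2, ← mul_assoc]
    exact mul_le_mul_of_nonneg_left hlt (by positivity)
  rw [alphaHat, hη]
  split_ifs with h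
  · have hx2 : 2 * η * st * sp < |x| := (lt_div_iff₀ hsp0).mp h.2
    have hdiff : x / p - α = (x - p * α) / p := by field_simp
    rw [hdiff, div_pow]
    refine le_min ?_ ?_
    · rw [div_le_iff₀ (by positivity), ← mul_pow, mul_comm α]
      refine sq_le_sq.mpr ?_
      have := abs_sub_abs_le_abs_sub x (x - p * α)
      rw [sub_sub_cancel] at this
      linarith
    · rw [div_le_iff₀ (by positivity)]
      have h1 : (x - p * α) ^ 2 ≤ (η * τ) ^ 2 := by
        rw [← sq_abs]; exact pow_le_pow_left₀ (abs_nonneg _) hx 2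
      have h2 : 1 ≤ 3 ^ k * p := by
        rwa [div_le_iff₀ hp0] at hinv
      calc (x - p * α) ^ 2 ≤ (η ^ 2 * τ) * τ := by linarith
        _ ≤ (η ^ 2 * τ) * p := by gcongr; linarith
        _ ≤ (η ^ 2 * τ) * p * (3 ^ k * p) := le_mul_of_one_le_right (by positivity) h2
        _ ≤ 9 * ((η ^ 2 * τ) * p * (3 ^ k * p)) := by
            have : 0 ≤ (η ^ 2 * τ) * p * (3 ^ k * p) := by positivity
            linarith
        _ = _ := by ring
  · rw [zero_sub, neg_sq]
    refine le_min le_rfl ?_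
    rw [not_and] at h
    have hx2 : |x| ≤ 2 * η * st * sp := by
      have := h hτp
      rwa [not_lt, div_le_iff₀ hsp0] at this
    have h1 : |p * α| ≤ 3 * η * st * sp := by
      have := abs_sub_abs_le_abs_sub (p * α) x
      rw [abs_sub_comm] at this
      linarith
    have h2 : (p * α) ^ 2 ≤ (3 * η * st * sp) ^ 2 := by
      rw [← sq_abs]; exact pow_le_pow_left₀ (abs_nonneg _) h1 2
    have h3 : (3 * η * st * sp) ^ 2 = 9 * η ^ 2 * τ * p := by
      rw [← hst2, ← hsp2]; ring
    rw [h3] at h2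
    have h4 : α ^ 2 ≤ 9 * η ^ 2 * τ * (1 / p) := by
      have : p * (p * α ^ 2) ≤ p * (9 * η ^ 2 * τ) := by linarith
      have := le_of_mul_le_mul_left this hp0
      rw [mul_one_div, le_div_iff₀ hp0]; linarith
    calc α ^ 2 ≤ 9 * η ^ 2 * τ * (1 / p) := h4
      _ ≤ 9 * η ^ 2 * τ * 3 ^ k := by gcongr
      _ = _ := by ring

theorem learned_sub_eq {N : ℕ} (S : Shadow n N) (k : ℕ) (τ : ℝ) {E : Op n →ₗ[ℂ] Op n}
    (hE : IsCPTP E) {O : Op n} (hO : O.IsHermitian) (ρ : Op n) :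
    learned S k τ ρ O - (O * E ρ).trace.re =
      ∑ P, ((if weight P ≤ k then alphaHat S τ P O else 0) -
        (pauliCoeff P (heisenberg E O)).re) * pauliExp P ρ := by
  simp only [sub_mul, Finset.sum_sub_distrib]
  congr 1
  · rw [learned, Finset.sum_filter]
    exact Finset.sum_congr rfl fun P _ => by split_ifs <;> simp [pauliExp]
  · rw [← trace_heisenberg_mul, trace_mul_eq_sum_pauliCoeff, Complex.re_sum]
    refine Finset.sum_congr rfl fun P _ => ?_
    rw [pauliCoeff_eq_re (heisenberg_isHermitian hE hO) P, Complex.re_ofReal_mul,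
      Complex.ofReal_re, pauliExp]

theorem lowDegree_isHermitian {M : Op n} (hM : M.IsHermitian) (k : ℕ) :
    (lowDegree k M).IsHermitian := by
  refine isHermitian_of_pauliCoeff_real fun P => ?_
  rw [pauliCoeff_lowDegree]
  split_ifs
  · rw [pauliCoeff_eq_re hM, Complex.ofReal_im]
  · rfl

theorem sq_le_rpow_mul_sq {U V r a : ℝ} (hU : 0 < U) (hV : 0 ≤ V) (hr0 : 0 ≤ r) (hr2 : r ≤ 2)
    (haU : a ≤ U ^ 2) (haV : a ≤ V ^ 2) : a ≤ (V / U) ^ r * U ^ 2 := by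
  have hU2 : 0 < U ^ 2 := by positivity
  rcases le_total V U with h | h
  · have h1 : (V / U) ^ 2 ≤ (V / U) ^ r := by
      rcases hV.eq_or_lt with h0 | h0
      · rw [← h0, zero_div]
        simpa using Real.rpow_nonneg le_rfl r
      · rw [← Real.rpow_natCast]
        exact Real.rpow_le_rpow_of_exponent_ge (by positivity) ((div_le_one hU).mpr h)
          (by exact_mod_cast hr2)
    calc a ≤ (V / U) ^ 2 * U ^ 2 := by rw [← mul_pow, div_mul_cancel₀ _ hU.ne']; exact haV
      _ ≤ _ := by gcongr
  · have h1 : 1 ≤ (V / U) ^ r := Real.one_le_rpow ((one_le_div hU).mpr h) hr0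
    nlinarith

theorem rpow_div_mul_sq {U V : ℝ} (hU : 0 < U) (hV : 0 < V) (k : ℕ) :
    (V / U) ^ (2 * k / (k + 1) : ℝ) * U ^ 2 = (U ^ 2 / V ^ 2) ^ (1 / (k + 1) : ℝ) * V ^ 2 := by
  have hx : 0 < V / U := by positivity
  have e2 : (2 * k / (k + 1) : ℝ) = 2 - 2 * (1 / (k + 1)) := by field_simp; ring
  have e3 : U ^ 2 / V ^ 2 = (V / U) ^ (-2 : ℝ) := by
    rw [Real.rpow_neg hx.le, Real.rpow_two, div_pow, inv_div]
  rw [e3, ← Real.rpow_mul hx.le, e2, Real.rpow_sub hx, Real.rpow_two, neg_mul,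
    Real.rpow_neg hx.le]
  have : (V / U) ^ (2 * (1 / (k + 1)) : ℝ) ≠ 0 := (Real.rpow_pos_of_pos hx _).ne'
  generalize (V / U) ^ (2 * (1 / (k + 1)) : ℝ) = z at *
  field_simp

theorem pauliCoeff_lowDegree_re (M : Op n) (k : ℕ) (P : PauliString n) :
    (pauliCoeff P (lowDegree k M)).re = if weight P ≤ k then (pauliCoeff P M).re else 0 := by
  rw [pauliCoeff_lowDegree]
  split_ifs <;> rfl

theorem sum_pauliCoeff_re_sq_le_lowDegree {M : Op n} (hM : M.IsHermitian) (k : ℕ) :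
    ∑ P with weight P ≤ k, (pauliCoeff P M).re ^ 2 ≤ opNorm (lowDegree k M) ^ 2 := by
  have h1 := sum_pauliCoeff_re_sq_le (lowDegree_isHermitian hM k) (stateBound_opNorm _)
  simp only [pauliCoeff_lowDegree_re] at h1
  rw [Finset.sum_filter]
  refine le_trans (le_of_eq ?_) h1
  exact Finset.sum_congr rfl fun P _ => by split_ifs <;> simp

/-- The Bohnenblust–Hille bound for the low-degree part, rescaled by the norm `U` of the
observable. -/
theorem sum_min_sq_le_lowDegree {M : Op n} (hM : M.IsHermitian) {k K : ℕ} (hk : 1 ≤ k)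
    (hKk : K ≤ k) {U g q : ℝ} (hU : 0 < U) (hg : 0 ≤ g) (hq : 0 ≤ q) (hqg : q ≤ g * U ^ 2)
    (hV : 0 < opNorm (lowDegree k M)) :
    ∑ P with weight P ≤ K, min ((pauliCoeff P M).re ^ 2) q ≤
      88 * 27 ^ K * k ^ 4 * g ^ (1 / (k + 1) : ℝ) *
        ((opNorm (lowDegree k M) / U) ^ (2 * k / (k + 1) : ℝ) * U ^ 2) := by
  have h1 := sum_min_sq_le_rpow (lowDegree_isHermitian hM k) hV (stateBound_opNorm _) hk hKk
    (fun P hP => by rw [pauliCoeff_lowDegree_re, if_neg (by omega)]) hq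
  have h2 : ∑ P with weight P ≤ K, min ((pauliCoeff P (lowDegree k M)).re ^ 2) q =
      ∑ P with weight P ≤ K, min ((pauliCoeff P M).re ^ 2) q := by
    refine Finset.sum_congr rfl fun P hP => ?_
    rw [pauliCoeff_lowDegree_re, if_pos ((Finset.mem_filter.mp hP).2.trans hKk)]
  rw [h2] at h1
  refine h1.trans ?_
  generalize opNorm (lowDegree k M) = V at *
  have h3 : (q / V ^ 2) ^ (1 / (k + 1) : ℝ) ≤
      g ^ (1 / (k + 1) : ℝ) * (U ^ 2 / V ^ 2) ^ (1 / (k + 1) : ℝ) := by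
    rw [← Real.mul_rpow hg (by positivity), ← mul_div_assoc]
    exact Real.rpow_le_rpow (by positivity) (div_le_div_of_nonneg_right hqg (by positivity))
      (by positivity)
  have h4 := mul_le_mul_of_nonneg_left h3 (by positivity : (0 : ℝ) ≤ 88 * 27 ^ K * k ^ 4 * V ^ 2)
  rw [rpow_div_mul_sq hU hV]
  calc _ = _ := by ring
    _ ≤ _ := h4
    _ = _ := by ring

/-- The levels above `K` of the low-degree part, damped by local flatness. -/
theorem sum_mid_le {α : PauliString n → ℝ} {k K : ℕ} {q a B : ℝ} (hq : 0 ≤ q) (ha : 0 ≤ a)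
    (hB : ∑ P with weight P ≤ k, α P ^ 2 ≤ B) (hK : K = k ∨ (2 / 3) ^ (K + 1) ≤ a) :
    ∑ P with weight P ≤ k ∧ ¬ weight P ≤ K, (2 / 3) ^ weight P * min (α P ^ 2) q ≤ a * B := by
  have hB0 : 0 ≤ B := (Finset.sum_nonneg fun P _ => sq_nonneg _).trans hB
  rcases hK with hK | hK
  · refine le_trans (le_of_eq ?_) (mul_nonneg ha hB0)
    refine Finset.sum_eq_zero fun P hP => ?_
    have := (Finset.mem_filter.mp hP).2
    omega
  · calc _ ≤ ∑ P with weight P ≤ k ∧ ¬ weight P ≤ K, a * α P ^ 2 := by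
          refine Finset.sum_le_sum fun P hP => ?_
          have hP := (Finset.mem_filter.mp hP).2
          refine mul_le_mul ?_ (min_le_left _ _) (le_min (sq_nonneg _) hq) ha
          exact (pow_le_pow_of_le_one (by norm_num) (by norm_num) (by omega)).trans hK
      _ ≤ ∑ P with weight P ≤ k, a * α P ^ 2 :=
          Finset.sum_le_sum_of_subset_of_nonneg
            (fun P hP => by simp only [Finset.mem_filter] at hP ⊢; exact ⟨hP.1, hP.2.1⟩)
            fun P _ _ => mul_nonneg ha (sq_nonneg _)
      _ ≤ _ := by rw [← Finset.mul_sum]; exact mul_le_mul_of_nonneg_left hB ha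

theorem sum_weighted_min_le_add (α : PauliString n → ℝ) (k K : ℕ) {q : ℝ} (hq : 0 ≤ q) :
    ∑ P with weight P ≤ k, (2 / 3) ^ weight P * min (α P ^ 2) q ≤
      ∑ P with weight P ≤ K, min (α P ^ 2) q +
      ∑ P with weight P ≤ k ∧ ¬ weight P ≤ K, (2 / 3) ^ weight P * min (α P ^ 2) q := by
  rw [← Finset.sum_filter_add_sum_filter_not _ (fun P => weight P ≤ K), Finset.filter_filter,
    Finset.filter_filter]
  refine add_le_add ?_ le_rfl
  calc _ ≤ ∑ P with weight P ≤ k ∧ weight P ≤ K, min (α P ^ 2) q :=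
        Finset.sum_le_sum fun P _ => mul_le_of_le_one_left (le_min (sq_nonneg _) hq)
          (pow_le_one₀ (by norm_num) (by norm_num))
    _ ≤ _ := Finset.sum_le_sum_of_subset_of_nonneg
        (fun P hP => by simp only [Finset.mem_filter] at hP ⊢; exact ⟨hP.1, hP.2.2⟩)
        fun P _ _ => le_min (sq_nonneg _) hq

/-- The error of the levels up to `k`, under either of two conditions on the filter level
`q = g U²`. In the first one, the levels up to `K` are controlled by the filter and the
Bohnenblust–Hille inequality, the levels from `K` to `k` by local flatness; in the second one
the filter level is so small that even the sum of the errors of all coefficients is negligible. -/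
theorem sum_weighted_min_le {M : Op n} (hM : M.IsHermitian) {k : ℕ} (hk : 1 ≤ k) (hn : 1 ≤ n)
    {U g q ε ε' : ℝ} (hU : 0 < U) (hε : 0 < ε) (hε' : 0 < ε') (hg : 0 ≤ g) (hq : 0 ≤ q)
    (hqg : q ≤ g * U ^ 2) (hMU : ∑ P, (pauliCoeff P M).re ^ 2 ≤ U ^ 2)
    (h : (∃ K ≤ k, 88 * 27 ^ K * k ^ 4 * g ^ (1 / (k + 1) : ℝ) ≤ ε' / 2 ∧
        (K = k ∨ (2 / 3) ^ (K + 1) ≤ ε' / 2)) ∨ 21 * (n : ℝ) ^ k * g ≤ ε / 3) :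
    ∑ P with weight P ≤ k, (2 / 3) ^ weight P * min ((pauliCoeff P M).re ^ 2) q ≤
      ε / 3 * U ^ 2 +
        ε' * ((opNorm (lowDegree k M) / U) ^ (2 * k / (k + 1) : ℝ) * U ^ 2) := by
  have hsumV := sum_pauliCoeff_re_sq_le_lowDegree hM k
  have hlow := fun K (hKk : K ≤ k) => sum_min_sq_le_lowDegree hM hk hKk hU hg hq hqg
  have hV0 : 0 ≤ opNorm (lowDegree k M) := opNorm_nonneg _
  generalize opNorm (lowDegree k M) = V at *
  have hr2 : (2 * k / (k + 1) : ℝ) ≤ 2 := by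
    rw [div_le_iff₀ (by positivity)]; linarith
  have hr0 : (0 : ℝ) ≤ 2 * k / (k + 1) := by positivity
  have hS2 : ∑ P with weight P ≤ k, (pauliCoeff P M).re ^ 2 ≤
      (V / U) ^ (2 * k / (k + 1) : ℝ) * U ^ 2 :=
    sq_le_rpow_mul_sq hU hV0 hr0 hr2
      ((Finset.sum_le_univ_sum_of_nonneg fun P => sq_nonneg _).trans hMU) hsumV
  have hR0 : 0 ≤ (V / U) ^ (2 * k / (k + 1) : ℝ) * U ^ 2 := by positivity
  generalize (V / U) ^ (2 * k / (k + 1) : ℝ) * U ^ 2 = B at *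
  have hU2 : 0 ≤ ε / 3 * U ^ 2 := by positivity
  rcases h with ⟨K, hKk, hK1, hK2⟩ | h
  · rcases hV0.eq_or_lt with hV00 | hVpos
    · have h0 : ∀ P, weight P ≤ k → (pauliCoeff P M).re = 0 := by
        intro P hP
        rw [← hV00] at hsumV
        have hP' : P ∈ Finset.univ.filter fun P : PauliString n => weight P ≤ k := by simp [hP]
        have h2 := Finset.single_le_sum (f := fun P => (pauliCoeff P M).re ^ 2)
          (fun P _ => sq_nonneg _) hP'
        exact pow_eq_zero_iff (two_ne_zero) |>.mp (le_antisymm (by linarith) (sq_nonneg _))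
      have : ∑ P with weight P ≤ k, (2 / 3) ^ weight P * min ((pauliCoeff P M).re ^ 2) q = 0 := by
        refine Finset.sum_eq_zero fun P hP => ?_
        rw [h0 P (Finset.mem_filter.mp hP).2]
        simp [min_eq_left hq]
      rw [this]
      exact add_nonneg hU2 (mul_nonneg hε'.le hR0)
    · have h1 := sum_weighted_min_le_add (fun P => (pauliCoeff P M).re) k K hq
      have h2 := sum_mid_le hq (half_pos hε').le hS2 hK2
      have h3 := (hlow K hKk hVpos).trans (mul_le_mul_of_nonneg_right hK1 hR0)
      linarith
  · have h1 : ∑ P with weight P ≤ k, (2 / 3) ^ weight P * min ((pauliCoeff P M).re ^ 2) q ≤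
        ε / 3 * U ^ 2 := by
      calc _ ≤ ∑ P : PauliString n with weight P ≤ k, q := Finset.sum_le_sum fun P _ =>
            (mul_le_of_le_one_left (le_min (sq_nonneg _) hq)
              (pow_le_one₀ (by norm_num) (by norm_num))).trans (min_le_right _ _)
        _ = (Finset.univ.filter fun P : PauliString n => weight P ≤ k).card * q := by
            rw [Finset.sum_const, nsmul_eq_mul]
        _ ≤ (21 * (n : ℝ) ^ k) * (g * U ^ 2) :=
            mul_le_mul (card_weight_le hn k) hqg hq (by positivity)
        _ = 21 * (n : ℝ) ^ k * g * U ^ 2 := by ring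
        _ ≤ _ := mul_le_mul_of_nonneg_right h (sq_nonneg _)
    have := mul_nonneg hε'.le hR0
    linarith

/-- The prediction error for given data: the levels above `k` contribute at most `2ε/3`, by local
flatness, the other ones are bounded in `sum_weighted_min_le`. -/
theorem integral_sq_learned_sub_le {N k κ d : ℕ} {τ c ε ε' : ℝ} (hk : 1 ≤ k) (hn : 1 ≤ n)
    (hε' : 0 < ε') (hτ : 0 < τ)
    (hτk : 2 * τ < (1 / 3) ^ k) (hεk : (2 / 3) ^ k ≤ ε) {E : Op n →ₗ[ℂ] Op n} (hE : IsCPTP E)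
    {S : Shadow n N} (hS : S ∈ goodShadows E N k κ τ) {O : Op n} (hO : IsBoundedDegree κ d O)
    (hc : pauliL1 O ≤ c * opNorm O) {D : MeasureTheory.Measure (Op n)} (hD : IsLocallyFlat D)
    (h : (∃ K ≤ k, 88 * 27 ^ K * k ^ 4 * (9 * 3 ^ k * c ^ 2 * τ) ^ (1 / (k + 1) : ℝ) ≤ ε' / 2 ∧
        (K = k ∨ (2 / 3) ^ (K + 1) ≤ ε' / 2)) ∨
      21 * (n : ℝ) ^ k * (9 * 3 ^ k * c ^ 2 * τ) ≤ ε / 3) :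
    MeasureTheory.Integrable (fun ρ => |learned S k τ ρ O - (O * E ρ).trace.re| ^ 2) D ∧
      ∫ ρ, |learned S k τ ρ O - (O * E ρ).trace.re| ^ 2 ∂D ≤
        (ε + ε' * (opNorm (lowDegree k (heisenberg E O)) / opNorm O) ^ (2 * k / (k + 1) : ℝ)) *
          opNorm O ^ 2 := by
  have hOH := hO.isHermitian
  have hM := heisenberg_isHermitian hE hOH
  set M := heisenberg E O with hMd
  set U := opNorm O with hU
  set α : PauliString n → ℝ := fun P => (pauliCoeff P M).re with hα
  set η := pauliL1 O with hη
  have hη0 : 0 ≤ η := Finset.sum_nonneg fun _ _ => norm_nonneg _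
  have hU0 : 0 ≤ U := opNorm_nonneg _
  have hε : 0 < ε := lt_of_lt_of_le (by positivity) hεk
  simp only [learned_sub_eq S k τ hE hOH]
  obtain ⟨hint, hle⟩ := integral_sq_sum_pauliExp_le hD
    (fun P => (if weight P ≤ k then alphaHat S τ P O else 0) - α P)
  refine ⟨hint, hle.trans ?_⟩
  have hsumU : ∑ P, α P ^ 2 ≤ U ^ 2 := sum_pauliCoeff_re_sq_le hM (stateBound_heisenberg hE O)
  set q := 9 * 3 ^ k * η ^ 2 * τ with hq
  have hq0 : 0 ≤ q := by positivity
  have herr : ∀ P, weight P ≤ k → (alphaHat S τ P O - α P) ^ 2 ≤ min (α P ^ 2) q := fun P hP =>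
    sq_alphaHat_sub_le hτ hτk rfl hP (abs_xHat_sub_le hE hS hO hP)
  have hsplit : ∑ P, (2 / 3) ^ weight P *
      ((if weight P ≤ k then alphaHat S τ P O else 0) - α P) ^ 2 ≤
      ∑ P with weight P ≤ k, (2 / 3) ^ weight P * min (α P ^ 2) q + 2 / 3 * ε * U ^ 2 := by
    rw [← Finset.sum_filter_add_sum_filter_not Finset.univ (fun P => weight P ≤ k)]
    refine add_le_add (Finset.sum_le_sum fun P hP => ?_) ?_
    · have hP := (Finset.mem_filter.mp hP).2
      rw [if_pos hP]
      exact mul_le_mul_of_nonneg_left (herr P hP) (by positivity)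
    · calc _ ≤ ∑ P with ¬ weight P ≤ k, 2 / 3 * ε * α P ^ 2 := by
            refine Finset.sum_le_sum fun P hP => ?_
            have hP := (Finset.mem_filter.mp hP).2
            rw [if_neg hP, zero_sub, neg_sq]
            refine mul_le_mul_of_nonneg_right ?_ (sq_nonneg _)
            calc (2 / 3 : ℝ) ^ weight P ≤ (2 / 3) ^ (k + 1) :=
                  pow_le_pow_of_le_one (by norm_num) (by norm_num) (by omega)
              _ = 2 / 3 * (2 / 3) ^ k := by ring
              _ ≤ _ := by gcongr
        _ ≤ ∑ P, 2 / 3 * ε * α P ^ 2 :=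
            Finset.sum_le_univ_sum_of_nonneg fun P => by positivity
        _ ≤ _ := by rw [← Finset.mul_sum]; gcongr
  refine hsplit.trans ?_
  rcases hU0.eq_or_lt with hU00 | hUpos
  · -- for `O = 0` all terms vanish
    have : ∀ P, α P = 0 := by
      intro P
      rw [← hU00] at hsumU
      have h2 := Finset.single_le_sum (f := fun P => α P ^ 2)
        (fun P _ => sq_nonneg _) (Finset.mem_univ P)
      exact pow_eq_zero_iff (two_ne_zero) |>.mp (le_antisymm (by linarith) (sq_nonneg _))
    simp [this, ← hU00, min_eq_left hq0]
  have hηU : η ^ 2 ≤ c ^ 2 * U ^ 2 := by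
    rw [← mul_pow]; exact pow_le_pow_left₀ hη0 hc 2
  have hqU : q ≤ 9 * 3 ^ k * c ^ 2 * τ * U ^ 2 := by
    calc q ≤ 9 * 3 ^ k * (c ^ 2 * U ^ 2) * τ := by rw [hq]; gcongr
      _ = _ := by ring
  have hmain := sum_weighted_min_le hM hk hn hUpos hε hε'
    (by positivity : 0 ≤ 9 * 3 ^ k * c ^ 2 * τ) hq0 hqU hsumU h
  calc _ ≤ _ := add_le_add hmain le_rfl
    _ = _ := by ring

end

section


/-! ### Choice of the parameters -/

theorem one_le_degree {ε : ℝ} (hε : 0 < ε) (hε1 : ε < 1) : 1 ≤ degree ε := by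
  have h : 0 < Real.logb 1.5 (1 / ε) :=
    Real.logb_pos (by norm_num) ((one_lt_div hε).mpr hε1)
  exact Nat.one_le_ceil_iff.mpr h

theorem two_thirds_pow_degree_le {ε : ℝ} (hε : 0 < ε) : (2 / 3) ^ degree ε ≤ ε := by
  have h1 : Real.logb 1.5 (1 / ε) ≤ degree ε := Nat.le_ceil _
  have h2 : 1 / ε ≤ 1.5 ^ (degree ε : ℝ) :=
    (Real.logb_le_iff_le_rpow (by norm_num) (by positivity)).mp h1
  rw [Real.rpow_natCast] at h2
  have h3 : (2 / 3 : ℝ) ^ degree ε = 1 / 1.5 ^ degree ε := by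
    rw [← one_div_pow]; norm_num
  rw [h3]
  exact (one_div_le hε (by positivity)).mp h2

theorem one_le_lg (x : ℝ) : 1 ≤ lg x := le_max_left _ _

theorem logb_le_lg (x : ℝ) : Real.logb 2 x ≤ lg x := le_max_right _ _

theorem degree_le {ε : ℝ} (hε : 0 < ε) (hε1 : ε < 1) : (degree ε : ℝ) + 1 ≤ 4 * lg (1 / ε) := by
  have h0 : 0 < Real.log (1 / ε) := Real.log_pos ((one_lt_div hε).mpr hε1)
  have h1 : (degree ε : ℝ) < Real.logb 1.5 (1 / ε) + 1 :=
    Nat.ceil_lt_add_one (Real.logb_nonneg (by norm_num) ((one_le_div hε).mpr hε1.le))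
  have h2 : Real.logb 1.5 (1 / ε) ≤ 2 * Real.logb 2 (1 / ε) := by
    have h3 : Real.log 2 ≤ 2 * Real.log 1.5 := by
      rw [← Nat.cast_ofNat (n := 2), ← Real.log_pow]
      exact Real.log_le_log (by norm_num) (by norm_num)
    have h4 : 0 < Real.log 1.5 := Real.log_pos (by norm_num)
    have h5 : 0 < Real.log 2 := Real.log_pos (by norm_num)
    rw [Real.logb, Real.logb, ← mul_div_assoc, div_le_div_iff₀ h4 h5]
    nlinarith
  have h6 := logb_le_lg (1 / ε)
  have h7 := one_le_lg (1 / ε)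
  linarith

/-- The quantity `y = min (k / min ε' 1) n` in the filter parameter. -/
def filterScale (n k : ℕ) (ε' : ℝ) : ℝ := min (k / min ε' 1) n

/-- The filter parameter `τ = (b y)^{-10 (k + 1)}`. -/
def filterParam (b n k : ℕ) (ε' : ℝ) : ℝ := 1 / (b * filterScale n k ε') ^ (10 * (k + 1))

/-- The base of the filter parameter. -/
def filterBase (κ d : ℕ) : ℕ := 567 * (1 + d * 12 ^ κ * (2 * κ ^ 2)) ^ 2

theorem filterBase_ge (κ d : ℕ) : 567 ≤ filterBase κ d := by
  unfold filterBase
  have : 0 < (1 + d * 12 ^ κ * (2 * κ ^ 2)) ^ 2 := by positivity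
  omega

theorem one_le_filterScale {n k : ℕ} {ε' : ℝ} (hn : 1 ≤ n) (hk : 1 ≤ k) (hε' : 0 < ε') :
    1 ≤ filterScale n k ε' := by
  refine le_min ?_ (by exact_mod_cast hn)
  have h0 : 0 < min ε' 1 := lt_min hε' one_pos
  rw [le_div_iff₀ h0, one_mul]
  exact (min_le_right _ _).trans (by exact_mod_cast hk)

theorem filterParam_pos {b n k : ℕ} {ε' : ℝ} (hb : 1 ≤ b) (hn : 1 ≤ n) (hk : 1 ≤ k)
    (hε' : 0 < ε') : 0 < filterParam b n k ε' := by
  have := one_le_filterScale hn hk hε'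
  have hb : (0 : ℝ) < b := by exact_mod_cast hb
  unfold filterParam
  positivity

theorem two_mul_filterParam_lt {b n k : ℕ} {ε' : ℝ} (hb : 567 ≤ b) (hn : 1 ≤ n) (hk : 1 ≤ k)
    (hε' : 0 < ε') : 2 * filterParam b n k ε' < (1 / 3) ^ k := by
  have hy := one_le_filterScale hn hk hε'
  have hb : (567 : ℝ) ≤ b := by exact_mod_cast hb
  have h1 : (567 : ℝ) ≤ b * filterScale n k ε' := by nlinarith
  have h2 : (567 : ℝ) ^ (k + 1) ≤ (b * filterScale n k ε') ^ (10 * (k + 1)) :=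
    (pow_le_pow_right₀ (by norm_num) (by omega)).trans (pow_le_pow_left₀ (by norm_num) h1 _)
  have h3 : (2 : ℝ) * 3 ^ k < 567 ^ (k + 1) := by
    have : (3 : ℝ) ^ k ≤ 567 ^ k := pow_le_pow_left₀ (by norm_num) (by norm_num) _
    have h4 : (0 : ℝ) < 567 ^ k := by positivity
    rw [pow_succ]; linarith
  rw [filterParam, mul_one_div, one_div_pow, div_lt_div_iff₀ (by positivity) (by positivity)]
  linarith

theorem filterParam_small {κ d n k : ℕ} {ε ε' c : ℝ} (hn : 1 ≤ n)
    (hc : c = (1 + d * 12 ^ κ * (2 * κ ^ 2) : ℕ)) (hεk : (2 / 3) ^ k ≤ ε)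
    (hy : filterScale n k ε' = n) :
    21 * (n : ℝ) ^ k * (9 * 3 ^ k * c ^ 2 * filterParam (filterBase κ d) n k ε') ≤ ε / 3 := by
  have hc1 : 1 ≤ c := by rw [hc]; exact_mod_cast Nat.le_add_right 1 _
  have hn : (1 : ℝ) ≤ n := by exact_mod_cast hn
  have hb : ((filterBase κ d : ℕ) : ℝ) = 567 * c ^ 2 := by rw [filterBase, hc]; push_cast; ring
  rw [filterParam, hy, hb, mul_one_div, mul_div_assoc', div_le_iff₀ (by positivity)]
  have hB : (567 * c ^ 2 * n) ^ (k + 1) ≤ (567 * c ^ 2 * (n : ℝ)) ^ (10 * (k + 1)) := by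
    refine pow_le_pow_right₀ ?_ (by omega)
    have : 1 ≤ c ^ 2 := one_le_pow₀ hc1
    nlinarith
  have h1 : 21 * (n : ℝ) ^ k * (9 * 3 ^ k * c ^ 2) ≤
      (2 / 3) ^ k / 3 * (567 * c ^ 2 * (n : ℝ)) ^ (k + 1) := by
    have h2 : (2 / 3 : ℝ) ^ k / 3 * (567 * c ^ 2 * (n : ℝ)) ^ (k + 1) =
        189 * c ^ 2 * n * n ^ k * ((2 / 3) ^ k * (567 * c ^ 2) ^ k) := by
      rw [mul_pow, pow_succ, pow_succ]; ring
    have h3 : (3 : ℝ) ^ k ≤ (2 / 3) ^ k * (567 * c ^ 2) ^ k := by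
      rw [← mul_pow]
      refine pow_le_pow_left₀ (by norm_num) ?_ _
      have : 1 ≤ c ^ 2 := one_le_pow₀ hc1
      nlinarith
    rw [h2]
    calc 21 * (n : ℝ) ^ k * (9 * 3 ^ k * c ^ 2) = 189 * c ^ 2 * 1 * n ^ k * 3 ^ k := by ring
      _ ≤ _ := by gcongr
  have hε : 0 ≤ ε := le_trans (by positivity) hεk
  calc _ ≤ _ := h1
    _ ≤ _ := by gcongr

/-- With `y = k / min ε' 1`, the level `K` at which one switches from the Bohnenblust–Hille
inequality to local flatness is `log_{1.5} (2 / ε')`, so that `27 ^ K` is a power of `1 / ε'`. -/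
theorem filterParam_moderate {κ d n k : ℕ} {ε' c : ℝ} (hk : 1 ≤ k) (hε' : 0 < ε')
    (hc : c = (1 + d * 12 ^ κ * (2 * κ ^ 2) : ℕ))
    (hy : filterScale n k ε' = k / min ε' 1) :
    ∃ K ≤ k, 88 * 27 ^ K * k ^ 4 *
        (9 * 3 ^ k * c ^ 2 * filterParam (filterBase κ d) n k ε') ^ (1 / (k + 1) : ℝ) ≤ ε' / 2 ∧
      (K = k ∨ (2 / 3) ^ (K + 1) ≤ ε' / 2) := by
  have hc1 : 1 ≤ c := by rw [hc]; exact_mod_cast Nat.le_add_right 1 _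
  have hk1 : (1 : ℝ) ≤ k := by exact_mod_cast hk
  have hb : ((filterBase κ d : ℕ) : ℝ) = 567 * c ^ 2 := by rw [filterBase, hc]; push_cast; ring
  set e := min ε' 1 with he
  have he0 : 0 < e := lt_min hε' one_pos
  have he1 : e ≤ 1 := min_le_right _ _
  have heε : e ≤ ε' := min_le_left _ _
  obtain ⟨m, hm1, hm2⟩ := exists_nat_pow_near (x := 2 / e) (y := 3 / 2)
    (by rw [le_div_iff₀ he0]; linarith) (by norm_num)
  have hmK : (2 / 3 : ℝ) ^ (m + 1) ≤ e / 2 := by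
    have h1 : (2 / 3 : ℝ) ^ (m + 1) = 1 / (3 / 2) ^ (m + 1) := by rw [← one_div_pow]; norm_num
    rw [h1, div_le_div_iff₀ (by positivity) (by norm_num)]
    rw [div_lt_iff₀ he0] at hm2
    linarith
  have h27 : (27 : ℝ) ^ m ≤ (2 / e) ^ 9 := by
    calc (27 : ℝ) ^ m ≤ ((3 / 2) ^ 9) ^ m := pow_le_pow_left₀ (by norm_num) (by norm_num) _
      _ = ((3 / 2) ^ m) ^ 9 := by rw [← pow_mul, ← pow_mul, mul_comm]
      _ ≤ _ := pow_le_pow_left₀ (by positivity) hm1 _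
  have hroot : (9 * 3 ^ k * c ^ 2 * filterParam (filterBase κ d) n k ε') ^ (1 / (k + 1) : ℝ) ≤
      27 * c ^ 2 / (567 * c ^ 2 * (k / e)) ^ 10 := by
    have hz : 9 * 3 ^ k * c ^ 2 * filterParam (filterBase κ d) n k ε' ≤
        (27 * c ^ 2 / (567 * c ^ 2 * (k / e)) ^ 10) ^ (k + 1) := by
      rw [filterParam, hy, hb, div_pow, ← pow_mul, mul_one_div]
      have h1 : 9 * 3 ^ k * c ^ 2 ≤ (27 * c ^ 2) ^ (k + 1) := by
        have h2 : (3 : ℝ) ^ k ≤ (27 * c ^ 2) ^ k := by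
          refine pow_le_pow_left₀ (by norm_num) ?_ _
          have : 1 ≤ c ^ 2 := one_le_pow₀ hc1
          nlinarith
        calc 9 * 3 ^ k * c ^ 2 ≤ 27 * (27 * c ^ 2) ^ k * c ^ 2 := by gcongr; norm_num
          _ = _ := by ring
      gcongr
    have h0 : 0 ≤ 9 * 3 ^ k * c ^ 2 * filterParam (filterBase κ d) n k ε' := by
      rw [filterParam, hy, hb]; positivity
    calc _ ≤ ((27 * c ^ 2 / (567 * c ^ 2 * (k / e)) ^ 10) ^ (k + 1)) ^ (1 / (k + 1) : ℝ) :=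
          Real.rpow_le_rpow h0 hz (by positivity)
      _ = _ := by
          have h3 : (1 / (k + 1) : ℝ) = ((k + 1 : ℕ) : ℝ)⁻¹ := by push_cast; rw [one_div]
          rw [h3, Real.pow_rpow_inv_natCast (by positivity) (by omega)]
  have hfin : 88 * (2 / e) ^ 9 * k ^ 4 * (27 * c ^ 2 / (567 * c ^ 2 * (k / e)) ^ 10) ≤ e / 2 := by
    have hc2 : 1 ≤ c ^ 2 := one_le_pow₀ hc1
    have h1 : 88 * (2 / e) ^ 9 * k ^ 4 * (27 * c ^ 2 / (567 * c ^ 2 * (k / e)) ^ 10) =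
        e / 2 * (88 * 2 ^ 10 * 27 / (567 ^ 10 * ((c ^ 2) ^ 9 * k ^ 6))) := by
      field_simp
    rw [h1]
    refine mul_le_of_le_one_right (by positivity) ?_
    rw [div_le_one (by positivity)]
    have h2 : (1 : ℝ) ≤ (c ^ 2) ^ 9 * (k : ℝ) ^ 6 :=
      one_le_mul_of_one_le_of_one_le (one_le_pow₀ hc2) (one_le_pow₀ hk1)
    nlinarith
  refine ⟨min k m, min_le_left _ _, ?_, ?_⟩
  · have h1 : (27 : ℝ) ^ min k m ≤ (2 / e) ^ 9 :=
      (pow_le_pow_right₀ (by norm_num) (min_le_right _ _)).trans h27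
    have h0 : 0 ≤ 27 * c ^ 2 / (567 * c ^ 2 * (k / e)) ^ 10 := by positivity
    calc _ ≤ 88 * 27 ^ min k m * k ^ 4 * (27 * c ^ 2 / (567 * c ^ 2 * (k / e)) ^ 10) := by
          gcongr
      _ ≤ 88 * (2 / e) ^ 9 * k ^ 4 * (27 * c ^ 2 / (567 * c ^ 2 * (k / e)) ^ 10) := by gcongr
      _ ≤ e / 2 := hfin
      _ ≤ _ := by linarith
  · rcases le_total k m with h | h
    · exact Or.inl (min_eq_left h)
    · right
      rw [min_eq_right h]
      linarith

theorem rpow_two_logb {x : ℝ} (hx : 0 < x) : (2 : ℝ) ^ Real.logb 2 x = x :=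
  Real.rpow_logb (by norm_num) (by norm_num) hx

/-- The constant in the number of experiments. -/
def sampleBase (κ d : ℕ) : ℕ := 16 * 9 ^ κ * (κ + 9) * filterBase κ d ^ 20

theorem pow_le_two_rpow {a z : ℝ} (k : ℕ) {l : ℝ} (ha : 0 < a) (hk : (k : ℝ) + 1 ≤ 4 * l)
    (hz0 : 0 ≤ z) (hz : Real.logb 2 a ≤ z) {C : ℝ} {w : ℝ} (hw : 4 * z ≤ C * w) (hl : 0 ≤ l) :
    a ^ (k + 1) ≤ (2 : ℝ) ^ (C * (l * w)) := by
  calc a ^ (k + 1) = (2 : ℝ) ^ (Real.logb 2 a * ((k + 1 : ℕ) : ℝ)) := by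
        rw [Real.rpow_mul (by norm_num), rpow_two_logb ha, Real.rpow_natCast]
    _ ≤ _ := by
        refine Real.rpow_le_rpow_of_exponent_le (by norm_num) ?_
        push_cast
        calc Real.logb 2 a * ((k : ℝ) + 1) ≤ z * (4 * l) := by gcongr
          _ = l * (4 * z) := by ring
          _ ≤ l * (C * w) := by gcongr
          _ = _ := by ring

theorem logb_natCast_le (m : ℕ) : Real.logb 2 m ≤ m := by
  rcases Nat.eq_zero_or_pos m with rfl | hm
  · simp
  · rw [Real.logb_le_iff_le_rpow (by norm_num) (by exact_mod_cast hm), Real.rpow_natCast]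
    exact_mod_cast Nat.lt_two_pow_self.le

theorem sampleSize_ge {κ d n : ℕ} {ε ε' δ C : ℝ} (hn : 1 ≤ n) (hε : 0 < ε) (hε1 : ε < 1)
    (hε' : 0 < ε') (hC : 4 * ((sampleBase κ d : ℝ) + 60) ≤ C) :
    lg (n / δ) * (8 * 9 ^ κ * (degree ε + κ + 8) /
      filterParam (filterBase κ d) n (degree ε) ε' ^ 2) ≤ sampleSize C n ε ε' δ := by
  have hk := one_le_degree hε hε1
  have hk1 : (1 : ℝ) ≤ degree ε := by exact_mod_cast hk
  have hkl := degree_le hε hε1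
  have hl := one_le_lg (1 / ε)
  have hy := one_le_filterScale hn hk hε'
  have hb : (567 : ℝ) ≤ filterBase κ d := by exact_mod_cast filterBase_ge κ d
  have hn1 : (1 : ℝ) ≤ n := by exact_mod_cast hn
  have he0 : 0 < min ε' 1 := lt_min hε' one_pos
  refine mul_le_mul_of_nonneg_left ?_ (by linarith [one_le_lg (n / δ)])
  set k := degree ε with hkd
  set y := filterScale n k ε' with hyd
  set b := filterBase κ d with hbd
  have hS0 : (0 : ℝ) < sampleBase κ d := by
    unfold sampleBase
    have : 0 < filterBase κ d := by have := filterBase_ge κ d; omega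
    positivity
  have hmain : 8 * 9 ^ κ * (k + κ + 8) / filterParam b n k ε' ^ 2 ≤
      ((sampleBase κ d : ℝ) * y ^ 20) ^ (k + 1) := by
    have h1 : (8 * 9 ^ κ * (k + κ + 8) : ℝ) ≤ (16 * 9 ^ κ * (κ + 9)) ^ (k + 1) := by
      have h2 : ((k : ℝ) + 1) ≤ 2 ^ k := by
        exact_mod_cast Nat.lt_two_pow_self (n := k)
      have h3 : (1 : ℝ) ≤ 9 ^ κ := one_le_pow₀ (by norm_num)
      have h4 : (2 : ℝ) ^ k ≤ (16 * 9 ^ κ * (κ + 9)) ^ k := by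
        refine pow_le_pow_left₀ (by norm_num) ?_ _
        have : (0 : ℝ) ≤ κ := by positivity
        nlinarith
      calc (8 * 9 ^ κ * (k + κ + 8) : ℝ) ≤ 8 * 9 ^ κ * ((κ + 9) * (k + 1)) := by
            gcongr
            have : (0 : ℝ) ≤ κ := by positivity
            nlinarith
        _ ≤ 16 * 9 ^ κ * ((κ + 9) * (k + 1)) := by gcongr; norm_num
        _ ≤ 16 * 9 ^ κ * ((κ + 9) * (16 * 9 ^ κ * (κ + 9)) ^ k) := by
            gcongr; exact h2.trans h4
        _ = _ := by ring
    have h5 : filterParam b n k ε' ^ 2 = 1 / ((b ^ 20 * y ^ 20) ^ (k + 1)) := by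
      rw [filterParam, one_div_pow, ← hyd, ← mul_pow, ← pow_mul, ← pow_mul]
      congr 2; ring
    rw [h5, div_div_eq_mul_div, div_one]
    calc _ ≤ (16 * 9 ^ κ * (κ + 9)) ^ (k + 1) * ((b : ℝ) ^ 20 * y ^ 20) ^ (k + 1) := by gcongr
      _ = _ := by rw [← mul_pow, sampleBase]; push_cast; ring
  refine hmain.trans (le_min ?_ ?_)
  · have hyle : y ≤ k / min ε' 1 := min_le_left _ _
    have hlg := one_le_lg (lg (1 / ε))
    have hlg' := one_le_lg (1 / ε')
    refine le_trans (pow_le_pow_left₀ (by positivity)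
      (by gcongr : (sampleBase κ d : ℝ) * y ^ 20 ≤ sampleBase κ d * (k / min ε' 1) ^ 20) _) ?_
    refine pow_le_two_rpow k (z := (sampleBase κ d + 60) * (lg (lg (1 / ε)) + lg (1 / ε')))
      (by positivity) hkl (by positivity) ?_ ?_ (by linarith)
    · have hlk : Real.logb 2 k ≤ 2 + lg (lg (1 / ε)) := by
        calc Real.logb 2 k ≤ Real.logb 2 (4 * lg (1 / ε)) :=
              Real.logb_le_logb_of_le (by norm_num) (by positivity) (by linarith)
          _ = 2 + Real.logb 2 (lg (1 / ε)) := by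
              rw [Real.logb_mul (by norm_num) (by positivity)]
              congr 1
              rw [Real.logb_eq_iff_rpow_eq (by norm_num) (by norm_num) (by norm_num)]
              norm_num
          _ ≤ _ := by gcongr; exact logb_le_lg _
      have hle : -Real.logb 2 (min ε' 1) ≤ lg (1 / ε') := by
        rcases le_total ε' 1 with h | h
        · rw [min_eq_left h, ← Real.logb_inv, ← one_div]; exact logb_le_lg _
        · rw [min_eq_right h, Real.logb_one, neg_zero]; linarith
      rw [Real.logb_mul (by positivity) (by positivity), Real.logb_pow,
        Real.logb_div (by positivity) (by positivity)]
      have := logb_natCast_le (sampleBase κ d)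
      push_cast
      nlinarith
    · calc _ = 4 * (sampleBase κ d + 60 : ℝ) * (lg (lg (1 / ε)) + lg (1 / ε')) := by ring
        _ ≤ _ := by gcongr
  · have hyle : y ≤ n := min_le_right _ _
    have hlg := one_le_lg n
    refine le_trans (pow_le_pow_left₀ (by positivity)
      (by gcongr : (sampleBase κ d : ℝ) * y ^ 20 ≤ sampleBase κ d * (n : ℝ) ^ 20) _) ?_
    refine pow_le_two_rpow k (z := (sampleBase κ d + 60) * lg n)
      (by positivity) hkl (by positivity) ?_ ?_ (by linarith)
    · rw [Real.logb_mul (by positivity) (by positivity), Real.logb_pow]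
      have := logb_natCast_le (sampleBase κ d)
      have := logb_le_lg n
      push_cast
      nlinarith
    · calc _ = 4 * (sampleBase κ d + 60 : ℝ) * lg n := by ring
        _ ≤ _ := by gcongr

/-- The failure probability of the estimates is at most `δ` if the number of experiments is
`8 · 9^κ (k + κ + 8) τ⁻² lg (n / δ)`. -/
theorem failure_le {n N k κ : ℕ} {τ δ : ℝ} (hn : 1 ≤ n) (hδ : 0 < δ) (hδ1 : δ < 1) (hτ : 0 < τ)
    (hN : lg (n / δ) * (8 * 9 ^ κ * (k + κ + 8) / τ ^ 2) ≤ N) :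
    882 * (n : ℝ) ^ (k + κ) * Real.exp (-(N * τ ^ 2 / (8 * 9 ^ κ))) ≤ δ := by
  have hn1 : (1 : ℝ) ≤ n := by exact_mod_cast hn
  have hx : (k + κ + 8) * lg (n / δ) ≤ N * τ ^ 2 / (8 * 9 ^ κ) := by
    rw [le_div_iff₀ (by positivity)]
    rw [mul_div_assoc', div_le_iff₀ (by positivity)] at hN
    linarith
  set z := Real.log (n / δ) with hz
  have hnδ : 1 ≤ n / δ := by rw [le_div_iff₀ hδ]; linarith
  have hz0 : 0 ≤ z := Real.log_nonneg hnδ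
  have hzl : z ≤ lg (n / δ) := by
    refine le_trans ?_ (logb_le_lg _)
    rw [Real.logb, le_div_iff₀ (Real.log_pos (by norm_num))]
    have : Real.log 2 ≤ 1 := by linarith [Real.log_le_sub_one_of_pos (show (0:ℝ) < 2 by norm_num)]
    nlinarith
  have hlg := one_le_lg (n / δ)
  have hexp : (k + κ) * z + z + 7 ≤ N * τ ^ 2 / (8 * 9 ^ κ) := by
    refine le_trans ?_ hx
    have : ((k : ℝ) + κ) * z ≤ (k + κ) * lg (n / δ) := by gcongr
    linarith
  have he7 : (882 : ℝ) ≤ Real.exp 7 := by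
    have h1 : (2.7 : ℝ) ^ 7 ≤ Real.exp 1 ^ 7 :=
      pow_le_pow_left₀ (by norm_num) (by linarith [Real.exp_one_gt_d9]) _
    rw [← Real.exp_nat_mul] at h1
    norm_num at h1 ⊢
    linarith
  have hez : Real.exp z = n / δ := Real.exp_log (by positivity)
  have hez2 : Real.exp ((k + κ) * z) = (n / δ) ^ (k + κ) := by
    rw [← hez, ← Real.exp_nat_mul]; push_cast; rfl
  have h1 : 882 * (n : ℝ) ^ (k + κ) ≤ δ * Real.exp (N * τ ^ 2 / (8 * 9 ^ κ)) := by
    calc 882 * (n : ℝ) ^ (k + κ) ≤ Real.exp 7 * (n / δ) ^ (k + κ) * n := by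
          have : (n : ℝ) ≤ n / δ := by rw [le_div_iff₀ hδ]; nlinarith
          calc _ ≤ Real.exp 7 * (n / δ) ^ (k + κ) := by gcongr
            _ ≤ _ := le_mul_of_one_le_right (by positivity) hn1
      _ = δ * (Real.exp ((k + κ) * z) * Real.exp z * Real.exp 7) := by
          rw [hez, hez2]; field_simp
      _ = δ * Real.exp ((k + κ) * z + z + 7) := by rw [Real.exp_add, Real.exp_add]
      _ ≤ _ := by gcongr
  rw [Real.exp_neg, ← div_eq_mul_inv, div_le_iff₀ (Real.exp_pos _)]
  exact h1

/-- The accuracy of the learned function. -/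
theorem accuracy {κ d n : ℕ} {ε ε' C : ℝ} (hn : 1 ≤ n) (hε : 0 < ε) (hε1 : ε < 1)
    (hε' : 0 < ε') (hC : 4 * ((sampleBase κ d : ℝ) + 60) ≤ C) {δ : ℝ} {N : ℕ} (hδ : 0 < δ)
    (hN : sampleSize C n ε ε' δ ≤ N) {E : Op n →ₗ[ℂ] Op n} (hE : IsCPTP E) :
    1 - δ ≤ shadowProb E {S : Shadow n N |
      ∀ (D : MeasureTheory.Measure (Op n)) (O : Op n),
        IsLocallyFlat D → IsBoundedDegree κ d O →
          MeasureTheory.Integrable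
            (fun ρ => |learned S (degree ε) (filterParam (filterBase κ d) n (degree ε) ε') ρ O -
              (O * E ρ).trace.re| ^ 2) D ∧
          ∫ ρ, |learned S (degree ε) (filterParam (filterBase κ d) n (degree ε) ε') ρ O -
              (O * E ρ).trace.re| ^ 2 ∂D ≤
            (ε + ε' * (opNorm (lowDegree (degree ε) (heisenberg E O)) / opNorm O) ^
              exponent ε) * opNorm O ^ 2} := by
  rcases le_or_gt 1 δ with hδ1 | hδ1
  · exact (by linarith : 1 - δ ≤ 0).trans (shadowProb_nonneg hE _)
  have hk := one_le_degree hε hε1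
  have hb := filterBase_ge κ d
  have hτ := filterParam_pos (b := filterBase κ d) (by omega) hn hk hε'
  have hN' := (sampleSize_ge (δ := δ) hn hε hε1 hε' hC).trans hN
  have hN1 : 1 ≤ N := by
    have : (0 : ℝ) < N := lt_of_lt_of_le (by have := one_le_lg (n / δ); positivity) hN'
    exact_mod_cast this
  have hfail := failure_le hn hδ hδ1 hτ hN'
  refine le_trans ?_ (shadowProb_mono hE (A := goodShadows E N (degree ε) κ
    (filterParam (filterBase κ d) n (degree ε) ε')) ?_)
  · exact le_trans (by linarith) (le_shadowProb_goodShadows hn hN1 hE (degree ε) κ hτ)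
  · intro S hS D O hD hO
    have hc := hO.pauliL1_le
    refine integral_sq_learned_sub_le (c := (1 + d * 12 ^ κ * (2 * κ ^ 2) : ℕ)) hk hn hε' hτ
      (two_mul_filterParam_lt hb hn hk hε') (two_thirds_pow_degree_le hε) hE hS hO
      (by push_cast; exact hc) hD ?_
    rcases min_choice ((degree ε : ℝ) / min ε' 1) n with h | h
    · exact Or.inl (filterParam_moderate hk hε' rfl h)
    · exact Or.inr (filterParam_small hn rfl (two_thirds_pow_degree_le hε) h)

end

section


/-! ### Reasoning about programs -/

namespace RAM

/-- Started in `σ`, the program `p` halts after at most `T` steps in a memory that satisfies `Q`. -/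
def Runs (Ω : Oracle) (p : Cmd) (σ : Store) (T : ℕ) (Q : Store → Prop) : Prop :=
  ∃ t σ', Exec Ω p σ t σ' ∧ t ≤ T ∧ Q σ'

/-- The integer arrays that a program writes to. -/
def Cmd.natWrites : Cmd → List ℕ
  | setNat a _ _ _ => [a]
  | setReal _ _ _ _ => []
  | query _ _ _ _ _ _ => []
  | seq p q => p.natWrites ++ q.natWrites
  | ite _ p q => p.natWrites ++ q.natWrites
  | loop _ p => p.natWrites

/-- The real arrays that a program writes to. -/
def Cmd.realWrites : Cmd → List ℕ
  | setNat _ _ _ _ => []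
  | setReal a _ _ _ => [a]
  | query _ _ _ c _ _ => [c]
  | seq p q => p.realWrites ++ q.realWrites
  | ite _ p q => p.realWrites ++ q.realWrites
  | loop _ p => p.realWrites

/-- The memories `σ` and `σ'` agree on all arrays that `p` does not write to. -/
structure Frame (p : Cmd) (σ σ' : Store) : Prop where
  nat : ∀ a, a ∉ p.natWrites → σ'.nat a = σ.nat a
  real : ∀ a, a ∉ p.realWrites → σ'.real a = σ.real a

theorem Frame.refl (p : Cmd) (σ : Store) : Frame p σ σ := ⟨fun _ _ => rfl, fun _ _ => rfl⟩

theorem Frame.trans {p : Cmd} {σ σ₁ σ₂ : Store} (h : Frame p σ σ₁) (h' : Frame p σ₁ σ₂) :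
    Frame p σ σ₂ :=
  ⟨fun a ha => (h'.nat a ha).trans (h.nat a ha), fun a ha => (h'.real a ha).trans (h.real a ha)⟩

theorem Frame.mono {p q : Cmd} {σ σ' : Store} (h : Frame p σ σ')
    (hn : p.natWrites ⊆ q.natWrites) (hr : p.realWrites ⊆ q.realWrites) : Frame q σ σ' :=
  ⟨fun a ha => h.nat a fun h' => ha (hn h'), fun a ha => h.real a fun h' => ha (hr h')⟩

theorem Store.nat_setNat (σ : Store) (a i j v a' i' j' : ℕ) :
    (σ.setNat a i j v).nat a' i' j' = if a' = a ∧ i' = i ∧ j' = j then v else σ.nat a' i' j' := rfl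

theorem Store.real_setNat (σ : Store) (a i j v : ℕ) : (σ.setNat a i j v).real = σ.real := rfl

theorem Store.nat_setReal (σ : Store) (a i j : ℕ) (v : ℝ) :
    (σ.setReal a i j v).nat = σ.nat := rfl

theorem Store.real_setReal (σ : Store) (a i j : ℕ) (v : ℝ) (a' i' j' : ℕ) :
    (σ.setReal a i j v).real a' i' j' =
      if a' = a ∧ i' = i ∧ j' = j then v else σ.real a' i' j' := rfl

theorem Exec.frame {Ω : Oracle} {p : Cmd} {σ σ' : Store} {t : ℕ} (h : Exec Ω p σ t σ') :
    Frame p σ σ' := by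
  induction h with
  | setNat a i j e σ =>
    refine ⟨fun b hb => ?_, fun _ _ => rfl⟩
    have : b ≠ a := by simpa [Cmd.natWrites] using hb
    funext i' j'
    simp [Store.nat_setNat, this]
  | setReal a i j e σ =>
    refine ⟨fun _ _ => rfl, fun b hb => ?_⟩
    have : b ≠ a := by simpa [Cmd.realWrites] using hb
    funext i' j'
    simp [Store.real_setReal, this]
  | query a b w c i j σ =>
    refine ⟨fun _ _ => rfl, fun b hb => ?_⟩
    have : b ≠ c := by simpa [Cmd.realWrites] using hb
    funext i' j'
    simp [Store.real_setReal, this]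
  | seq _ _ h₁ h₂ =>
    exact (h₁.mono (by simp [Cmd.natWrites]) (by simp [Cmd.realWrites])).trans
      (h₂.mono (by simp [Cmd.natWrites]) (by simp [Cmd.realWrites]))
  | iteTrue _ _ h => exact h.mono (by simp [Cmd.natWrites]) (by simp [Cmd.realWrites])
  | iteFalse _ _ h => exact h.mono (by simp [Cmd.natWrites]) (by simp [Cmd.realWrites])
  | loopTrue _ _ _ h₁ h₂ =>
    exact (h₁.mono (by simp [Cmd.natWrites]) (by simp [Cmd.realWrites])).trans h₂
  | loopFalse _ => exact Frame.refl _ _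

variable {Ω : Oracle} {p q : Cmd} {σ : Store} {T T₁ T₂ : ℕ} {Q R : Store → Prop}

theorem Runs.frame (h : Runs Ω p σ T Q) : Runs Ω p σ T fun σ' => Q σ' ∧ Frame p σ σ' := by
  obtain ⟨t, σ', he, ht, hQ⟩ := h
  exact ⟨t, σ', he, ht, hQ, he.frame⟩

theorem Runs.mono (h : Runs Ω p σ T₁ R) (hT : T₁ ≤ T) (hQ : ∀ σ', R σ' → Q σ') :
    Runs Ω p σ T Q := by
  obtain ⟨t, σ', he, ht, hR⟩ := h
  exact ⟨t, σ', he, ht.trans hT, hQ _ hR⟩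

theorem Runs.seq (h₁ : Runs Ω p σ T₁ R) (h₂ : ∀ σ₁, R σ₁ → Frame p σ σ₁ → Runs Ω q σ₁ T₂ Q)
    (hT : T₁ + T₂ ≤ T) : Runs Ω (.seq p q) σ T Q := by
  obtain ⟨t₁, σ₁, he₁, ht₁, hR⟩ := h₁
  obtain ⟨t₂, σ₂, he₂, ht₂, hQ⟩ := h₂ σ₁ hR he₁.frame
  exact ⟨_, σ₂, he₁.seq he₂, by omega, hQ⟩

theorem Runs.ite {b : Test} (h₁ : b.Holds σ → Runs Ω p σ T₁ Q) (h₂ : ¬ b.Holds σ → Runs Ω q σ T₁ Q)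
    (hT : b.cost + T₁ ≤ T) : Runs Ω (.ite b p q) σ T Q := by
  by_cases hb : b.Holds σ
  · obtain ⟨t, σ', he, ht, hQ⟩ := h₁ hb
    exact ⟨_, σ', .iteTrue hb he, by omega, hQ⟩
  · obtain ⟨t, σ', he, ht, hQ⟩ := h₂ hb
    exact ⟨_, σ', .iteFalse hb he, by omega, hQ⟩

/-- A loop with `m` passes through its body, where the first `i` passes take at most `B i`
steps. -/
theorem Runs.loop {b : Test} (m : ℕ) (B : ℕ → ℕ) (I : ℕ → Store → Prop) (h0 : I 0 σ)
    (hstep : ∀ i < m, ∀ σ', Frame p σ σ' → I i σ' →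
      b.Holds σ' ∧ ∃ T', b.cost + T' + B i ≤ B (i + 1) ∧ Runs Ω p σ' T' (I (i + 1)))
    (hend : ∀ σ', Frame p σ σ' → I m σ' → ¬ b.Holds σ')
    (hT : B m + b.cost ≤ T) : Runs Ω (.loop b p) σ T (I m) := by
  have key : ∀ j, ∀ i, i + j = m → ∀ σ', Frame p σ σ' → I i σ' →
      ∃ t σ'', Exec Ω (.loop b p) σ' t σ'' ∧ t + B i ≤ B m + b.cost ∧ I m σ'' := by
    intro j
    induction j with
    | zero =>
      intro i hi σ' hF hI
      obtain rfl : i = m := by omega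
      exact ⟨_, σ', .loopFalse (hend σ' hF hI), by omega, hI⟩
    | succ j ih =>
      intro i hi σ' hF hI
      obtain ⟨hb, T', hT', t₁, σ₁, he₁, ht₁, hI₁⟩ := hstep i (by omega) σ' hF hI
      obtain ⟨t₂, σ₂, he₂, ht₂, hI₂⟩ := ih (i + 1) (by omega) σ₁ (hF.trans he₁.frame) hI₁
      exact ⟨_, σ₂, .loopTrue hb he₁ he₂, by omega, hI₂⟩
  obtain ⟨t, σ', he, ht, hI⟩ := key m 0 (by omega) σ (Frame.refl _ _) h0
  exact ⟨t, σ', he, by omega, hI⟩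

/-- A loop with `m` passes through its body, of at most `B` steps each. -/
theorem Runs.loop_const {b : Test} (m B : ℕ) (I : ℕ → Store → Prop) (h0 : I 0 σ)
    (hstep : ∀ i < m, ∀ σ', Frame p σ σ' → I i σ' → b.Holds σ' ∧ Runs Ω p σ' B (I (i + 1)))
    (hend : ∀ σ', Frame p σ σ' → I m σ' → ¬ b.Holds σ')
    (hT : m * (b.cost + B) + b.cost ≤ T) : Runs Ω (.loop b p) σ T (I m) :=
  Runs.loop m (fun i => i * (b.cost + B)) I h0
    (fun i hi σ' hF hI => ⟨(hstep i hi σ' hF hI).1, B, by rw [add_mul]; omega,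
      (hstep i hi σ' hF hI).2⟩) hend hT

/-- Programs that consist of assignments and case distinctions only. -/
def Cmd.Straight : Cmd → Prop
  | setNat _ _ _ _ => True
  | setReal _ _ _ _ => True
  | query _ _ _ _ _ _ => False
  | seq p q => p.Straight ∧ q.Straight
  | ite _ p q => p.Straight ∧ q.Straight
  | loop _ _ => False

open Classical in
/-- The effect of a program without loops and queries. -/
def Cmd.effect : Cmd → Store → Store
  | setNat a i j e, σ => σ.setNat a (i.eval σ) (j.eval σ) (e.eval σ)
  | setReal a i j e, σ => σ.setReal a (i.eval σ) (j.eval σ) (e.eval σ)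
  | query _ _ _ _ _ _, σ => σ
  | seq p q, σ => q.effect (p.effect σ)
  | ite b p q, σ => if b.Holds σ then p.effect σ else q.effect σ
  | loop _ _, σ => σ

/-- A bound on the number of steps of a program without loops and queries. -/
def Cmd.steps : Cmd → ℕ
  | setNat _ i j e => i.cost + j.cost + e.cost + 1
  | setReal _ i j e => i.cost + j.cost + e.cost + 1
  | query _ _ _ _ _ _ => 0
  | seq p q => p.steps + q.steps
  | ite b p q => b.cost + max p.steps q.steps
  | loop _ _ => 0

theorem Runs.straight (hp : p.Straight) (hT : p.steps ≤ T) (hQ : Q (p.effect σ)) :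
    Runs Ω p σ T Q := by
  have key : ∀ p : Cmd, p.Straight → ∀ σ, ∃ t, Exec Ω p σ t (p.effect σ) ∧ t ≤ p.steps := by
    intro p
    induction p with
    | setNat a i j e => exact fun _ σ => ⟨_, .setNat a i j e σ, le_rfl⟩
    | setReal a i j e => exact fun _ σ => ⟨_, .setReal a i j e σ, le_rfl⟩
    | query => exact fun h => h.elim
    | seq p q hp hq =>
      intro h σ
      obtain ⟨t₁, h₁, ht₁⟩ := hp h.1 σ
      obtain ⟨t₂, h₂, ht₂⟩ := hq h.2 (p.effect σ)
      exact ⟨_, h₁.seq h₂, by simp only [Cmd.steps]; omega⟩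
    | ite b p q hp hq =>
      intro h σ
      by_cases hb : b.Holds σ
      · obtain ⟨t, h, ht⟩ := hp h.1 σ
        refine ⟨b.cost + t, ?_, by simp only [Cmd.steps]; omega⟩
        rw [Cmd.effect, if_pos hb]
        exact .iteTrue hb h
      · obtain ⟨t, h, ht⟩ := hq h.2 σ
        refine ⟨b.cost + t, ?_, by simp only [Cmd.steps]; omega⟩
        rw [Cmd.effect, if_neg hb]
        exact .iteFalse hb h
    | loop => exact fun h => h.elim
  obtain ⟨t, h, ht⟩ := key p hp σ
  exact ⟨t, _, h, ht.trans hT, hQ⟩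

/-- The scalar variable `a` is the cell `(0, 0)` of the integer array `a`. -/
abbrev nv (a : ℕ) : NExp := .get a (.lit 0) (.lit 0)

/-- The scalar variable `a` is the cell `(0, 0)` of the real array `a`. -/
abbrev rv (a : ℕ) : RExp := .get a (.lit 0) (.lit 0)

/-- A natural number as a real constant. -/
abbrev rlit (c : ℕ) : RExp := .cast (.lit c)

/-- Assignment to a scalar integer variable. -/
abbrev Cmd.letNat (a : ℕ) (e : NExp) : Cmd := .setNat a (.lit 0) (.lit 0) e

/-- Assignment to a scalar real variable. -/
abbrev Cmd.letReal (a : ℕ) (e : RExp) : Cmd := .setReal a (.lit 0) (.lit 0) e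

/-- The loop `for a < e` with the counter `a`; the body ends with the increment of the counter. -/
abbrev Cmd.forLt (a : ℕ) (e : NExp) (p : Cmd) : Cmd :=
  .loop (.natLe (.add (nv a) (.lit 1)) e) (.seq p (.letNat a (.add (nv a) (.lit 1))))

infixr:60 " ;; " => Cmd.seq

theorem Runs.forLt_sum {a : ℕ} {e : NExp} (s m : ℕ) (B : ℕ → ℕ) (I : ℕ → Store → Prop)
    (hs : σ.nat a 0 0 = s) (ha : a ∉ p.natWrites)
    (he : ∀ σ', Frame (.forLt a e p) σ σ' → e.eval σ' = s + m) (h0 : I 0 σ)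
    (hstep : ∀ i < m, ∀ σ', Frame (.forLt a e p) σ σ' → σ'.nat a 0 0 = s + i → I i σ' →
      ∃ T', e.cost + 14 + T' + B i ≤ B (i + 1) ∧
        Runs Ω p σ' T' fun σ'' => I (i + 1) (σ''.setNat a 0 0 (s + i + 1)))
    (hT : B m + e.cost + 6 ≤ T) :
    Runs Ω (.forLt a e p) σ T fun σ' => I m σ' ∧ σ'.nat a 0 0 = s + m := by
  have hF : ∀ σ', Frame (p ;; .letNat a (.add (nv a) (.lit 1))) σ σ' → Frame (.forLt a e p) σ σ' :=
    fun σ' h => ⟨h.nat, h.real⟩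
  refine Runs.loop m B (fun i σ' => I i σ' ∧ σ'.nat a 0 0 = s + i) ⟨h0, hs⟩ ?_ ?_ ?_
  · rintro i hi σ' hσ' ⟨hI, hc⟩
    obtain ⟨T', hT', hr⟩ := hstep i hi σ' (hF _ hσ') hc hI
    refine ⟨?_, T' + 8, ?_, ?_⟩
    · simp only [Test.Holds, he σ' (hF _ hσ'), NExp.eval, hc]; omega
    · simp only [Test.cost, NExp.cost]; omega
    · refine Runs.seq hr (T₂ := 8) (fun σ₁ h₁ hF₁ => ?_) le_rfl
      refine Runs.straight trivial (by simp [Cmd.steps, NExp.cost]) ?_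
      have h2 : σ₁.nat a 0 0 = s + i := by rw [hF₁.nat a ha, hc]
      simp only [Cmd.effect, NExp.eval, h2]
      exact ⟨h₁, by simp [Store.nat_setNat, add_assoc]⟩
  · rintro σ' hσ' ⟨-, hc⟩
    simp only [Test.Holds, he σ' (hF _ hσ'), NExp.eval, hc]; omega
  · simp only [Test.cost, NExp.cost]; omega

theorem Runs.forLt {a : ℕ} {e : NExp} (s m B : ℕ) (I : ℕ → Store → Prop)
    (hs : σ.nat a 0 0 = s) (ha : a ∉ p.natWrites)
    (he : ∀ σ', Frame (.forLt a e p) σ σ' → e.eval σ' = s + m) (h0 : I 0 σ)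
    (hstep : ∀ i < m, ∀ σ', Frame (.forLt a e p) σ σ' → σ'.nat a 0 0 = s + i → I i σ' →
      Runs Ω p σ' B fun σ'' => I (i + 1) (σ''.setNat a 0 0 (s + i + 1)))
    (hT : m * (e.cost + 14 + B) + e.cost + 6 ≤ T) :
    Runs Ω (.forLt a e p) σ T fun σ' => I m σ' ∧ σ'.nat a 0 0 = s + m :=
  Runs.forLt_sum s m (fun i => i * (e.cost + 14 + B)) I hs ha he h0
    (fun i hi σ' hF hc hI => ⟨B, by rw [add_mul]; omega, hstep i hi σ' hF hc hI⟩) hT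

end RAM

end

section


/-! ### The parameters and the table of Pauli expectations in memory -/

open RAM

/-- Computes `k = degree ε` into the integer variable `11`: the least `k` with
`(3/2)^k ε ≥ 1`. -/
def degreeCode : Cmd :=
  .letReal 5 (rv 0) ;; .letNat 11 (.lit 0) ;; .letNat 17 (.lit 1) ;;
  .loop (.natLe (.lit 1) (nv 17))
    (.ite (.realLe (rlit 1) (rv 5)) (.letNat 17 (.lit 0))
      (.letReal 5 (.mul (rv 5) (.div (rlit 3) (rlit 2))) ;; .letNat 11 (.add (nv 11) (.lit 1))))

/-- Computes the filter parameter into the real variable `4`. -/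
def filterCode (b : ℕ) : Cmd :=
  .ite (.realLe (.get 0 (.lit 0) (.lit 1)) (rlit 1)) (.letReal 5 (.get 0 (.lit 0) (.lit 1)))
    (.letReal 5 (rlit 1)) ;;
  .letReal 5 (.div (.cast (nv 11)) (rv 5)) ;;
  .ite (.realLe (rv 5) (.cast (nv 0))) (.letReal 7 (.mul (rlit b) (rv 5)))
    (.letReal 7 (.mul (rlit b) (.cast (nv 0)))) ;;
  .letReal 5 (.mul (rv 7) (rv 7)) ;;
  .letReal 7 (.mul (rv 5) (.mul (.mul (rv 5) (rv 5)) (.mul (rv 5) (rv 5)))) ;;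
  .letReal 4 (rlit 1) ;; .letNat 15 (.lit 0) ;;
  .forLt 15 (.add (nv 11) (.lit 1)) (.letReal 4 (.div (rv 4) (rv 7)))

/-- Fills the real array `6` with the expectation values of `X, Y, Z` in the six stabilizer
states. -/
def tableCode : Cmd :=
  .setReal 6 (.lit 1) (.lit 2) (rlit 1) ;; .setReal 6 (.lit 1) (.lit 3) (.sub (rlit 0) (rlit 1)) ;;
  .setReal 6 (.lit 2) (.lit 4) (rlit 1) ;; .setReal 6 (.lit 2) (.lit 5) (.sub (rlit 0) (rlit 1)) ;;
  .setReal 6 (.lit 3) (.lit 0) (rlit 1) ;; .setReal 6 (.lit 3) (.lit 1) (.sub (rlit 0) (rlit 1))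

theorem degree_le_iff {ε : ℝ} (hε : 0 < ε) (i : ℕ) : degree ε ≤ i ↔ 1 ≤ (3 / 2) ^ i * ε := by
  rw [degree, Nat.ceil_le, Real.logb_le_iff_le_rpow (by norm_num) (by positivity),
    Real.rpow_natCast, div_le_iff₀ hε]
  norm_num

variable {Ω : Oracle}

theorem runs_degreeCode {σ : Store} {ε : ℝ} (hσ : σ.real 0 0 0 = ε) (hε : 0 < ε) :
    Runs Ω degreeCode σ (100 * (degree ε + 1)) fun σ' => σ'.nat 11 0 0 = degree ε := by
  set k := degree ε with hk
  refine Runs.seq (Runs.straight (T := 6) trivial (by decide)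
    (Q := fun σ' => σ'.real 5 0 0 = ε) ?_) (fun σ₁ h₁ _ => ?_) (T₂ := 90 + 60 * k) (by omega)
  · simpa [Cmd.effect, RExp.eval, NExp.eval, Store.real_setReal] using hσ
  refine Runs.seq (Runs.straight (T := 6) trivial (by decide)
    (Q := fun σ' => σ'.real 5 0 0 = ε ∧ σ'.nat 11 0 0 = 0) ?_) (fun σ₂ h₂ _ => ?_) (T₂ := 80 + 60 * k) (by omega)
  · simpa [Cmd.effect, RExp.eval, NExp.eval, Store.real_setNat, Store.nat_setNat] using h₁
  refine Runs.seq (Runs.straight (T := 6) trivial (by decide)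
    (Q := fun σ' => σ'.real 5 0 0 = ε ∧ σ'.nat 11 0 0 = 0 ∧ σ'.nat 17 0 0 = 1) ?_)
    (fun σ₃ h₃ _ => ?_) (T₂ := 70 + 60 * k) (by omega)
  · simpa [Cmd.effect, RExp.eval, NExp.eval, Store.real_setNat, Store.nat_setNat] using h₂
  refine Runs.mono (Runs.loop_const (k + 1) 40 (fun i σ' => σ'.nat 11 0 0 = min i k ∧
    σ'.real 5 0 0 = (3 / 2) ^ min i k * ε ∧ σ'.nat 17 0 0 = if i ≤ k then 1 else 0)
    ?_ ?_ ?_ le_rfl) ?_ ?_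
  · simp [h₃.1, h₃.2.1, h₃.2.2]
  · rintro i hi σ' - ⟨hk', hx, hf⟩
    have hik : i ≤ k := by omega
    rw [if_pos hik] at hf
    rw [min_eq_left hik] at hk' hx
    refine ⟨by simp [Test.Holds, NExp.eval, hf], ?_⟩
    refine Runs.ite (T₁ := 30) (fun hb => ?_) (fun hb => ?_) (by decide)
    · simp only [Test.Holds, RExp.eval, NExp.eval, hx, Nat.cast_one, ← degree_le_iff hε] at hb
      obtain rfl : i = k := le_antisymm hik hb
      refine Runs.straight trivial (by decide) ?_
      simp [Cmd.effect, NExp.eval, Store.nat_setNat, Store.real_setNat, hk', hx]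
    · simp only [Test.Holds, RExp.eval, NExp.eval, hx, Nat.cast_one, ← degree_le_iff hε] at hb
      have : i + 1 ≤ k := by omega
      refine Runs.straight ⟨trivial, trivial⟩ (by decide) ?_
      simp [Cmd.effect, NExp.eval, RExp.eval, Store.nat_setNat, Store.real_setNat,
        Store.nat_setReal, Store.real_setReal, hk', hx, hf, this, pow_succ]
      ring
  · rintro σ' - ⟨-, -, hf⟩
    simp [Test.Holds, NExp.eval, hf]
  · simp only [Test.cost, NExp.cost]; omega
  · rintro σ' ⟨h, -⟩
    simpa using h

theorem runs_filterCode {σ : Store} {b n k : ℕ} {ε' : ℝ} (hn : σ.nat 0 0 0 = n)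
    (hk : σ.nat 11 0 0 = k) (hε' : σ.real 0 0 1 = ε') :
    Runs Ω (filterCode b) σ (200 + 40 * k) fun σ' => σ'.real 4 0 0 = filterParam b n k ε' := by
  refine Runs.seq (Runs.straight (T := 20) ⟨trivial, trivial⟩ (by decide)
    (Q := fun σ' => σ'.real 5 0 0 = min ε' 1 ∧ σ'.nat = σ.nat) ?_)
    (fun σ₁ h₁ _ => ?_) (T₂ := 180 + 40 * k) (by omega)
  · simp only [Cmd.effect, Test.Holds, RExp.eval, NExp.eval, hε', Nat.cast_one]
    rw [min_def]
    split_ifs <;> simp [Store.real_setReal, Store.nat_setReal]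
  refine Runs.seq (Runs.straight (T := 20) trivial (by decide)
    (Q := fun σ' => σ'.real 5 0 0 = k / min ε' 1 ∧ σ'.nat = σ.nat) ?_)
    (fun σ₂ h₂ _ => ?_) (T₂ := 160 + 40 * k) (by omega)
  · simp [Cmd.effect, RExp.eval, NExp.eval, Store.real_setReal, Store.nat_setReal, h₁.1, h₁.2, hk]
  refine Runs.seq (Runs.straight (T := 30) ⟨trivial, trivial⟩
    (by simp [Cmd.steps, Test.cost, NExp.cost, RExp.cost])
    (Q := fun σ' => σ'.real 7 0 0 = b * filterScale n k ε' ∧ σ'.nat = σ.nat) ?_)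
    (fun σ₃ h₃ _ => ?_) (T₂ := 130 + 40 * k) (by omega)
  · simp only [Cmd.effect, Test.Holds, RExp.eval, NExp.eval, h₂.1, h₂.2, hn]
    rw [filterScale]
    split_ifs with h
    · simp [Store.real_setReal, Store.nat_setReal, h₂, min_eq_left h]
    · simp [Store.real_setReal, Store.nat_setReal, h₂, min_eq_right (not_le.mp h).le]
  refine Runs.seq (Runs.straight (T := 10) trivial (by decide)
    (Q := fun σ' => σ'.real 5 0 0 = (b * filterScale n k ε') ^ 2 ∧ σ'.nat = σ.nat) ?_)
    (fun σ₄ h₄ _ => ?_) (T₂ := 120 + 40 * k) (by omega)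
  · simp [Cmd.effect, RExp.eval, NExp.eval, Store.real_setReal, Store.nat_setReal, h₃, sq]
  refine Runs.seq (Runs.straight (T := 30) trivial (by decide)
    (Q := fun σ' => σ'.real 7 0 0 = (b * filterScale n k ε') ^ 10 ∧ σ'.nat = σ.nat) ?_)
    (fun σ₅ h₅ _ => ?_) (T₂ := 90 + 40 * k) (by omega)
  · simp [Cmd.effect, RExp.eval, NExp.eval, Store.real_setReal, Store.nat_setReal, h₄]
    ring
  refine Runs.seq (Runs.straight (T := 10) trivial (by decide)
    (Q := fun σ' => σ'.real 4 0 0 = 1 ∧ σ'.real 7 0 0 = (b * filterScale n k ε') ^ 10 ∧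
      σ'.nat = σ.nat) ?_) (fun σ₆ h₆ _ => ?_) (T₂ := 80 + 40 * k) (by omega)
  · simp [Cmd.effect, RExp.eval, NExp.eval, Store.real_setReal, Store.nat_setReal, h₅]
  refine Runs.seq (Runs.straight (T := 10) trivial (by decide)
    (Q := fun σ' => σ'.real 4 0 0 = 1 ∧ σ'.real 7 0 0 = (b * filterScale n k ε') ^ 10 ∧
      σ'.nat 11 = σ.nat 11 ∧ σ'.nat 15 0 0 = 0) ?_) (fun σ₇ h₇ _ => ?_) (T₂ := 70 + 40 * k) (by omega)
  · simpa [Cmd.effect, RExp.eval, NExp.eval, Store.real_setNat, Store.nat_setNat, h₆] using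
      funext fun i => funext fun j => by simp [Store.nat_setNat, h₆]
  refine Runs.mono (Runs.forLt 0 (k + 1) 10
    (fun i σ' => σ'.real 4 0 0 = 1 / ((b * filterScale n k ε') ^ 10) ^ i) h₇.2.2.2 (by decide) ?_ ?_
    ?_ le_rfl) ?_ ?_
  · intro σ' hF
    simp [NExp.eval, hF.nat 11 (by decide), h₇.2.2.1, hk]
  · simp [h₇.1]
  · intro i hi σ' hF hc hI
    refine Runs.straight trivial (by decide) ?_
    simp only [Cmd.effect, RExp.eval, NExp.eval, Store.real_setNat, Store.real_setReal, hI,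
      hF.real 7 (by decide), h₇.2.1, and_self, if_true]
    rw [div_div, ← pow_succ]
  · simp only [NExp.cost]; omega
  · rintro σ' ⟨h, -⟩
    rw [h, filterParam, ← pow_mul]

theorem runs_tableCode {σ : Store} (hσ : ∀ i j, σ.real 6 i j = 0) :
    Runs Ω tableCode σ 100 fun σ' =>
      ∀ (a : Fin 4) (s : Fin 6), a ≠ 0 → σ'.real 6 a s = stabExp a s := by
  refine Runs.straight (by simp [tableCode, Cmd.Straight]) (by decide) ?_
  intro a s ha
  simp only [tableCode, Cmd.effect, RExp.eval, NExp.eval, Store.real_setReal]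
  fin_cases a <;> fin_cases s <;> simp_all [stabExp]

end

section


/-! ### Enumeration of the Pauli observables of low weight -/

variable {n : ℕ}

/-- One plus the last qubit on which a Pauli observable acts; `0` for the identity. -/
def top (P : PauliString n) : ℕ := (dom P).sup fun i => (i : ℕ) + 1

/-- The Pauli observable `P`, changed to the label `l` on qubit `q`. -/
def upd (P : PauliString n) (q : ℕ) (l : Fin 4) : PauliString n :=
  fun i => if (i : ℕ) = q then l else P i

/-- The Pauli observable without its last factor. -/
def parent (P : PauliString n) : PauliString n := fun i => if (i : ℕ) + 1 = top P then 0 else P i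

theorem lt_top {P : PauliString n} {i : Fin n} (h : P i ≠ 0) : (i : ℕ) < top P :=
  Nat.lt_of_succ_le (Finset.le_sup (f := fun i : Fin n => (i : ℕ) + 1) (by simpa [dom] using h))

theorem apply_eq_zero_of_top_le {P : PauliString n} {i : Fin n} (h : top P ≤ i) : P i = 0 := by
  by_contra h'
  exact absurd (lt_top h') (by omega)

theorem top_le_iff {P : PauliString n} {m : ℕ} : top P ≤ m ↔ ∀ i, P i ≠ 0 → (i : ℕ) < m := by
  simp only [top, Finset.sup_le_iff, dom, Finset.mem_filter, Finset.mem_univ, true_and]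
  exact Iff.rfl

theorem top_le (P : PauliString n) : top P ≤ n := top_le_iff.mpr fun i _ => i.isLt

theorem top_zero : top (0 : PauliString n) = 0 :=
  Nat.le_zero.mp (top_le_iff.mpr fun _ h => absurd rfl h)

theorem exists_top_eq {P : PauliString n} (hP : P ≠ 0) :
    ∃ i : Fin n, P i ≠ 0 ∧ (i : ℕ) + 1 = top P := by
  obtain ⟨j, hj⟩ := Function.ne_iff.mp hP
  obtain ⟨i, hi, h⟩ := Finset.exists_mem_eq_sup (dom P) ⟨j, by simpa [dom] using hj⟩
    fun i => (i : ℕ) + 1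
  exact ⟨i, by simpa [dom] using hi, h.symm⟩

theorem top_upd {P : PauliString n} {q : ℕ} {l : Fin 4} (hq : q < n) (hP : top P ≤ q)
    (hl : l ≠ 0) : top (upd P q l) = q + 1 := by
  refine le_antisymm (top_le_iff.mpr fun i hi => ?_) ?_
  · unfold upd at hi
    split_ifs at hi with h
    · omega
    · have := lt_top hi; omega
  · exact lt_top (P := upd P q l) (i := ⟨q, hq⟩) (by simpa [upd] using hl)

theorem parent_upd {P : PauliString n} {q : ℕ} {l : Fin 4} (hq : q < n) (hP : top P ≤ q)
    (hl : l ≠ 0) : parent (upd P q l) = P := by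
  funext i
  simp only [parent, top_upd hq hP hl, upd, Nat.add_right_cancel_iff]
  split_ifs with h
  · exact (apply_eq_zero_of_top_le (by omega)).symm
  · rfl

theorem weight_upd {P : PauliString n} {q : ℕ} {l : Fin 4} (hq : q < n) (hP : top P ≤ q)
    (hl : l ≠ 0) : weight (upd P q l) = weight P + 1 := by
  have h : dom (upd P q l) = insert ⟨q, hq⟩ (dom P) := by
    ext i
    simp only [dom, Finset.mem_filter, Finset.mem_univ, true_and, Finset.mem_insert, Fin.ext_iff]
    by_cases h : (i : ℕ) = q <;> simp [upd, h, hl]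
  rw [weight, h, Finset.card_insert_of_notMem, weight]
  simp only [dom, Finset.mem_filter, Finset.mem_univ, true_and, not_not]
  exact apply_eq_zero_of_top_le hP

theorem upd_ne_zero (P : PauliString n) {q : ℕ} {l : Fin 4} (hq : q < n) (hl : l ≠ 0) :
    upd P q l ≠ 0 := by
  intro h
  have := congrFun h ⟨q, hq⟩
  simp only [upd, if_true, Pi.zero_apply] at this
  exact hl this

theorem exists_eq_upd {P : PauliString n} (hP : P ≠ 0) :
    ∃ q < n, ∃ l : Fin 4, l ≠ 0 ∧ top (parent P) ≤ q ∧ P = upd (parent P) q l := by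
  obtain ⟨i, hi, ht⟩ := exists_top_eq hP
  refine ⟨i, i.2, P i, hi, top_le_iff.mpr fun j hj => ?_, ?_⟩
  · unfold parent at hj
    split_ifs at hj with h
    · exact absurd rfl hj
    · have := lt_top hj; omega
  · funext j
    simp only [upd, parent, ← ht, Nat.add_right_cancel_iff]
    split_ifs with h
    · rw [Fin.ext h]
    · rfl

/-- The Pauli observables that extend `P` by one factor on one of the `j` qubits after the last
qubit on which `P` acts. -/
def extensions (P : PauliString n) (j : ℕ) : List (PauliString n) :=
  (List.range j).flatMap fun i => [upd P (top P + i) 1, upd P (top P + i) 2, upd P (top P + i) 3]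

theorem extensions_succ (P : PauliString n) (j : ℕ) :
    extensions P (j + 1) = extensions P j ++
      [upd P (top P + j) 1, upd P (top P + j) 2, upd P (top P + j) 3] := by
  simp [extensions, List.range_succ]

theorem length_extensions (P : PauliString n) (j : ℕ) : (extensions P j).length = 3 * j := by
  induction j with
  | zero => rfl
  | succ j ih => rw [extensions_succ, List.length_append, ih]; rfl

theorem mem_extensions {P X : PauliString n} :
    X ∈ extensions P (n - top P) ↔ X ≠ 0 ∧ parent X = P := by
  have hl : ∀ l : Fin 4, l ≠ 0 ↔ l = 1 ∨ l = 2 ∨ l = 3 := by decide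
  constructor
  · intro h
    obtain ⟨i, hi, hX⟩ := List.mem_flatMap.mp h
    have hi := List.mem_range.mp hi
    have : ∃ l : Fin 4, l ≠ 0 ∧ X = upd P (top P + i) l := by
      simp only [List.mem_cons, List.not_mem_nil, or_false] at hX
      rcases hX with h | h | h
      exacts [⟨1, by decide, h⟩, ⟨2, by decide, h⟩, ⟨3, by decide, h⟩]
    obtain ⟨l, hl, rfl⟩ := this
    exact ⟨upd_ne_zero P (by omega) hl, parent_upd (by omega) (by omega) hl⟩
  · rintro ⟨hX, rfl⟩
    obtain ⟨q, hq, l, hl', ht, hX⟩ := exists_eq_upd hX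
    refine List.mem_flatMap.mpr ⟨q - top (parent X), List.mem_range.mpr (by omega), ?_⟩
    rw [Nat.add_sub_cancel' ht]
    suffices h : upd (parent X) q l ∈
        [upd (parent X) q 1, upd (parent X) q 2, upd (parent X) q 3] by rwa [← hX] at h
    clear hX
    rcases (hl l).mp hl' with rfl | rfl | rfl <;> simp

theorem upd_injective {P : PauliString n} {q q' : ℕ} {l l' : Fin 4} (hq : q < n) (hq' : q' < n)
    (hP : top P ≤ q) (hP' : top P ≤ q') (hl : l ≠ 0) (hl' : l' ≠ 0)
    (h : upd P q l = upd P q' l') : q = q' ∧ l = l' := by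
  have h1 : q = q' := by
    have := congrArg top h
    rw [top_upd hq hP hl, top_upd hq' hP' hl'] at this
    omega
  subst h1
  refine ⟨rfl, ?_⟩
  have := congrFun h ⟨q, hq⟩
  simpa [upd] using this

theorem nodup_extensions (P : PauliString n) : (extensions P (n - top P)).Nodup := by
  refine List.nodup_flatMap.mpr ⟨fun i hi => ?_, ?_⟩
  · have hi := List.mem_range.mp hi
    have h := fun {l l' : Fin 4} (hl : l ≠ 0) (hl' : l' ≠ 0)
        (e : upd P (top P + i) l = upd P (top P + i) l') =>
      (upd_injective (by omega) (by omega) (by omega) (by omega) hl hl' e).2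
    have h12 : upd P (top P + i) 1 ≠ upd P (top P + i) 2 :=
      fun e => absurd (h (by decide) (by decide) e) (by decide)
    have h13 : upd P (top P + i) 1 ≠ upd P (top P + i) 3 :=
      fun e => absurd (h (by decide) (by decide) e) (by decide)
    have h23 : upd P (top P + i) 2 ≠ upd P (top P + i) 3 :=
      fun e => absurd (h (by decide) (by decide) e) (by decide)
    simp [h12, h13, h23]
  · refine List.Pairwise.imp_of_mem (R := fun a b => a ≠ b) ?_ List.nodup_range
    intro i j hi hj hij X hX hX'
    have hi := List.mem_range.mp hi
    have hj := List.mem_range.mp hj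
    have key : ∀ i, X ∈ [upd P (top P + i) 1, upd P (top P + i) 2, upd P (top P + i) 3] →
        ∃ l : Fin 4, l ≠ 0 ∧ X = upd P (top P + i) l := by
      intro i hX
      simp only [List.mem_cons, List.not_mem_nil, or_false] at hX
      rcases hX with h | h | h
      exacts [⟨1, by decide, h⟩, ⟨2, by decide, h⟩, ⟨3, by decide, h⟩]
    obtain ⟨l, hl, h1⟩ := key i hX
    obtain ⟨l', hl', h2⟩ := key j hX'
    have := (upd_injective (by omega) (by omega) (by omega) (by omega) hl hl'
      (h1.symm.trans h2)).1
    omega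

/-- The Pauli observables of weight at most `k` that extend `P` by one factor. -/
def children (k : ℕ) (P : PauliString n) : List (PauliString n) :=
  if weight P < k then extensions P (n - top P) else []

theorem mem_children {k : ℕ} {P X : PauliString n} :
    X ∈ children k P ↔ X ≠ 0 ∧ weight X ≤ k ∧ parent X = P := by
  have hw : X ≠ 0 → weight X = weight (parent X) + 1 := by
    intro h
    obtain ⟨q, hq, l, hl, ht, hX⟩ := exists_eq_upd h
    conv_lhs => rw [hX]
    exact weight_upd hq ht hl
  unfold children
  split_ifs with h
  · rw [mem_extensions]
    refine ⟨fun ⟨h1, h2⟩ => ⟨h1, ?_, h2⟩, fun ⟨h1, _, h2⟩ => ⟨h1, h2⟩⟩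
    rw [hw h1, h2]; omega
  · simp only [List.not_mem_nil, false_iff, not_and]
    rintro h1 h2 rfl
    have := hw h1
    omega

/-- The queue of a breadth-first search, after `h` entries have been processed. -/
def queue (n k : ℕ) : ℕ → List (PauliString n)
  | 0 => [0]
  | h + 1 => queue n k h ++ (((queue n k h)[h]?).map (children k)).getD []

theorem queue_spec (n k h : ℕ) : (queue n k h).Nodup ∧ 0 ∈ queue n k h ∧
    (∀ P, P ≠ 0 → (P ∈ queue n k h ↔ weight P ≤ k ∧ parent P ∈ (queue n k h).take h)) := by
  induction h with
  | zero => simp [queue]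
  | succ h ih =>
    obtain ⟨h1, h2, h3⟩ := ih
    rw [queue]
    rcases lt_or_ge h (queue n k h).length with hlt | hge
    · rw [List.getElem?_eq_getElem hlt]
      set L := queue n k h with hL
      set X := L[h] with hX
      simp only [Option.map_some, Option.getD_some]
      have htake : (L ++ children k X).take (h + 1) = L.take h ++ [X] := by
        rw [List.take_append_of_le_length (by omega), List.take_concat_get' L h hlt]
      have hXn : X ∉ L.take h := by
        intro hm
        have h4 : (L.take (h + 1)).Nodup := h1.sublist (List.take_sublist _ _)
        rw [← List.take_concat_get' L h hlt] at h4
        exact (List.nodup_append.mp h4).2.2 X hm X (by simp [hX]) rfl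
      refine ⟨List.nodup_append.mpr ⟨h1, ?_, ?_⟩, List.mem_append_left _ h2, ?_⟩
      · unfold children
        split_ifs
        · exact nodup_extensions X
        · exact List.nodup_nil
      · rintro P hP Q hQ rfl
        obtain ⟨hP0, -, hpar⟩ := mem_children.mp hQ
        exact hXn (hpar ▸ ((h3 P hP0).mp hP).2)
      · intro P hP0
        rw [htake, List.mem_append, List.mem_append, mem_children, h3 P hP0, List.mem_singleton]
        tauto
    · rw [List.getElem?_eq_none hge]
      refine ⟨by simpa using h1, by simpa using h2, ?_⟩
      intro P hP0
      simp only [Option.map_none, Option.getD_none, List.append_nil]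
      rw [h3 P hP0, List.take_of_length_le hge, List.take_of_length_le (by omega)]

/-- The search ends when all `m` Pauli observables of weight at most `k` have been found and
processed. -/
theorem exists_queue_complete (n k : ℕ) : ∃ m, (queue n k m).length = m ∧
    (∀ h < m, h < (queue n k h).length) ∧ (∀ P, P ∈ queue n k m ↔ weight P ≤ k) := by
  classical
  have hex : ∃ h, (queue n k h).length ≤ h := by
    refine ⟨Fintype.card (PauliString n), ?_⟩
    exact (queue_spec n k _).1.length_le_card
  refine ⟨Nat.find hex, ?_⟩
  have hlt : ∀ h < Nat.find hex, h < (queue n k h).length := fun h hh =>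
    not_le.mp (Nat.find_min hex hh)
  have hle := Nat.find_spec hex
  have hlen : (queue n k (Nat.find hex)).length = Nat.find hex := by
    refine le_antisymm hle ?_
    rcases Nat.eq_zero_or_pos (Nat.find hex) with h0 | hpos
    · omega
    · obtain ⟨m, hm⟩ : ∃ m, Nat.find hex = m + 1 := ⟨Nat.find hex - 1, by omega⟩
      have := hlt m (by omega)
      rw [hm, queue, List.length_append]
      omega
  refine ⟨hlen, hlt, ?_⟩
  obtain ⟨-, h0, h3⟩ := queue_spec n k (Nat.find hex)
  rw [List.take_of_length_le hle] at h3
  have key : ∀ w, ∀ P : PauliString n, weight P = w →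
      (P ∈ queue n k (Nat.find hex) ↔ weight P ≤ k) := by
    intro w
    induction w with
    | zero =>
      intro P hP
      have : P = 0 := by
        by_contra hP0
        obtain ⟨q, hq, l, hl, ht, hX⟩ := exists_eq_upd hP0
        rw [hX, weight_upd hq ht hl] at hP
        omega
      simp [this, h0, weight_zero]
    | succ w ih =>
      intro P hP
      have hP0 : P ≠ 0 := by
        rintro rfl
        rw [weight_zero] at hP; omega
      obtain ⟨q, hq, l, hl, ht, hX⟩ := exists_eq_upd hP0
      have hw : weight P = weight (parent P) + 1 := by
        conv_lhs => rw [hX]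
        exact weight_upd hq ht hl
      rw [h3 P hP0, ih (parent P) (by omega)]
      omega
  exact fun P => key _ P rfl

end

section


/-! ### The training program -/

open RAM

variable {n N : ℕ}

/-- The data that stay fixed after the initialization: `n`, `N`, the outcomes of the experiments,
`k` in the integer variable `11`, `τ` in the real variable `4`, and the expectation values of
`X, Y, Z` in the real array `6`. -/
structure Constants (S : Shadow n N) (k : ℕ) (τ : ℝ) (σ : Store) : Prop where
  qubits : σ.nat 0 0 0 = n
  experiments : σ.nat 0 0 1 = N
  input : ∀ (l : Fin N) (j : Fin n), σ.nat 1 l j = (S l).1 j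
  output : ∀ (l : Fin N) (j : Fin n), σ.nat 2 l j = (S l).2 j
  degree : σ.nat 11 0 0 = k
  filter : σ.real 4 0 0 = τ
  table : ∀ (a : Fin 4) (s : Fin 6), a ≠ 0 → σ.real 6 a s = stabExp a s

theorem Constants.frame {S : Shadow n N} {k : ℕ} {τ : ℝ} {p : Cmd} {σ σ' : Store}
    (h : Constants S k τ σ) (hF : Frame p σ σ')
    (hn : 0 ∉ p.natWrites ∧ 1 ∉ p.natWrites ∧ 2 ∉ p.natWrites ∧ 11 ∉ p.natWrites)
    (hr : 4 ∉ p.realWrites ∧ 6 ∉ p.realWrites) : Constants S k τ σ' where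
  qubits := by rw [hF.nat _ hn.1, h.qubits]
  experiments := by rw [hF.nat _ hn.1, h.experiments]
  input l j := by rw [hF.nat _ hn.2.1, h.input]
  output l j := by rw [hF.nat _ hn.2.2.1, h.output]
  degree := by rw [hF.nat _ hn.2.2.2, h.degree]
  filter := by rw [hF.real _ hr.1, h.filter]
  table a s ha := by rw [hF.real _ hr.2, h.table a s ha]

/-- Row `p` of the table describes the Pauli observable `P`: its weight in the integer array `7`,
its last qubit in `8`, its nontrivial factors in `9` and `10`, and its expectation values in the
input states in the real array `3`. -/
structure IsRow (S : Shadow n N) (σ : Store) (p : ℕ) (P : PauliString n) : Prop where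
  weight : σ.nat 7 p 0 = weight P
  top : σ.nat 8 p 0 = top P
  factors : decode n (fun s : Fin (QEvo.weight P) => (σ.nat 9 p s, σ.nat 10 p s)) = P
  values : ∀ l : Fin N, σ.real 3 p l = stabChar P (S l).1

/-- The table describes the Pauli observables in the list `L`, with the length of `L` in the integer
variable `12`. -/
structure IsTable (S : Shadow n N) (σ : Store) (L : List (PauliString n)) : Prop where
  length : σ.nat 12 0 0 = L.length
  row : ∀ (p : ℕ) (hp : p < L.length), IsRow S σ p L[p]

theorem IsRow.congr {S : Shadow n N} {σ σ' : Store} {p : ℕ} {P : PauliString n}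
    (h : IsRow S σ p P) (h7 : σ'.nat 7 p = σ.nat 7 p) (h8 : σ'.nat 8 p = σ.nat 8 p)
    (h9 : σ'.nat 9 p = σ.nat 9 p) (h10 : σ'.nat 10 p = σ.nat 10 p)
    (h3 : σ'.real 3 p = σ.real 3 p) : IsRow S σ' p P where
  weight := by rw [h7, h.weight]
  top := by rw [h8, h.top]
  factors := by rw [h9, h10, h.factors]
  values l := by rw [h3, h.values]

theorem IsTable.frame {S : Shadow n N} {p : Cmd} {σ σ' : Store} {L : List (PauliString n)}
    (h : IsTable S σ L) (hF : Frame p σ σ')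
    (hn : 7 ∉ p.natWrites ∧ 8 ∉ p.natWrites ∧ 9 ∉ p.natWrites ∧ 10 ∉ p.natWrites ∧
      12 ∉ p.natWrites) (hr : 3 ∉ p.realWrites) : IsTable S σ' L where
  length := by rw [hF.nat _ hn.2.2.2.2, h.length]
  row p hp := (h.row p hp).congr (by rw [hF.nat _ hn.1]) (by rw [hF.nat _ hn.2.1])
    (by rw [hF.nat _ hn.2.2.1]) (by rw [hF.nat _ hn.2.2.2.1]) (by rw [hF.real _ hr])

theorem decode_snoc {P : PauliString n} {w q : ℕ} {l : Fin 4} {a b a' b' : ℕ → ℕ}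
    (hP : decode n (fun s : Fin w => (a s, b s)) = P) (hq : top P ≤ q)
    (ha : ∀ s < w, a' s = a s) (hb : ∀ s < w, b' s = b s) (haw : a' w = q) (hbw : b' w = l) :
    decode n (fun s : Fin (w + 1) => (a' s, b' s)) = upd P q l := by
  funext i
  have h1 := congrFun hP i
  unfold decode at h1 ⊢
  rw [Finset.sum_filter] at h1 ⊢
  rw [Fin.sum_univ_castSucc]
  simp only [Fin.val_castSucc, Fin.val_last, haw, hbw]
  have h2 : (∑ s : Fin w, if a' s = (i : ℕ) then b' s else 0) =
      ∑ s : Fin w, if a s = (i : ℕ) then b s else 0 :=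
    Finset.sum_congr rfl fun s _ => by rw [ha s s.2, hb s s.2]
  rw [h2]
  unfold upd
  by_cases h : (i : ℕ) = q
  · rw [apply_eq_zero_of_top_le (P := P) (i := i) (by omega)] at h1
    have h3 := congrArg Fin.val h1
    simp only [Fin.ofNat, Fin.val_zero] at h3
    rw [if_pos h.symm, if_pos h]
    refine Fin.ext ?_
    simp only [Fin.ofNat]
    have := l.2
    omega
  · rw [if_neg (Ne.symm h), if_neg h, add_zero, h1]

theorem stabChar_upd {P : PauliString n} {q : ℕ} (hq : q < n) (hP : top P ≤ q) (l : Fin 4)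
    (s : Fin n → Fin 6) : stabChar (upd P q l) s = stabChar P s * stabExp l (s ⟨q, hq⟩) := by
  rw [stabChar, stabChar, ← Finset.mul_prod_erase Finset.univ _ (Finset.mem_univ ⟨q, hq⟩),
    ← Finset.mul_prod_erase Finset.univ (fun i => stabExp (P i) (s i))
      (Finset.mem_univ ⟨q, hq⟩), apply_eq_zero_of_top_le (P := P) (i := ⟨q, hq⟩) hP, stabExp_zero,
    one_mul, mul_comm]
  congr 1
  · refine Finset.prod_congr rfl fun i hi => ?_
    have : (i : ℕ) ≠ q := fun h => (Finset.mem_erase.mp hi).1 (Fin.ext h)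
    simp [upd, this]
  · simp [upd]

/-- Writes the description of a new row `12`: row `13`, extended by the factor `lab` on qubit
`14`. -/
def descriptionCode (lab : ℕ) : Cmd :=
  .setNat 7 (nv 12) (.lit 0) (.add (.get 7 (nv 13) (.lit 0)) (.lit 1)) ;;
  .setNat 8 (nv 12) (.lit 0) (.add (nv 14) (.lit 1)) ;;
  .letNat 15 (.lit 0) ;;
  .forLt 15 (.get 7 (nv 13) (.lit 0))
    (.setNat 9 (nv 12) (nv 15) (.get 9 (nv 13) (nv 15)) ;;
      .setNat 10 (nv 12) (nv 15) (.get 10 (nv 13) (nv 15))) ;;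
  .setNat 9 (nv 12) (nv 15) (nv 14) ;; .setNat 10 (nv 12) (nv 15) (.lit lab)

/-- Writes the expectation values for the new row `12` in the input states. -/
def valuesCode (lab : ℕ) : Cmd :=
  .letNat 16 (.lit 0) ;;
  .forLt 16 (.get 0 (.lit 0) (.lit 1))
    (.setReal 3 (nv 12) (nv 16)
      (.mul (.get 3 (nv 13) (nv 16)) (.get 6 (.lit lab) (.get 1 (nv 16) (nv 14)))))

/-- Appends a row to the table. -/
def appendCode (lab : ℕ) : Cmd :=
  descriptionCode lab ;; valuesCode lab ;; .letNat 12 (.add (nv 12) (.lit 1))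

variable {Ω : Oracle}

theorem runs_descriptionCode {σ : Store} {c h q w lab : ℕ} (hc : σ.nat 12 0 0 = c)
    (hh : σ.nat 13 0 0 = h) (hq : σ.nat 14 0 0 = q) (hw : σ.nat 7 h 0 = w) (hhc : h ≠ c) :
    Runs Ω (descriptionCode lab) σ (100 + 60 * w) fun σ' =>
      (σ'.nat 7 c 0 = w + 1 ∧ ∀ p, p ≠ c → σ'.nat 7 p = σ.nat 7 p) ∧
      (σ'.nat 8 c 0 = q + 1 ∧ ∀ p, p ≠ c → σ'.nat 8 p = σ.nat 8 p) ∧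
      ((∀ s < w, σ'.nat 9 c s = σ.nat 9 h s) ∧ σ'.nat 9 c w = q ∧
        ∀ p, p ≠ c → σ'.nat 9 p = σ.nat 9 p) ∧
      ((∀ s < w, σ'.nat 10 c s = σ.nat 10 h s) ∧ σ'.nat 10 c w = lab ∧
        ∀ p, p ≠ c → σ'.nat 10 p = σ.nat 10 p) := by
  refine Runs.seq (Runs.straight (T := 20) trivial (by decide)
    (Q := fun σ' => σ'.nat 7 c 0 = w + 1 ∧ ∀ p, p ≠ c → σ'.nat 7 p = σ.nat 7 p) ?_)
    (fun σ₁ h₁ hF₁ => ?_) (T₂ := 80 + 60 * w) (by omega)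
  · simp only [Cmd.effect, NExp.eval, hc, hh, hw]
    exact ⟨by simp [Store.nat_setNat], fun p hp => by funext j; simp [Store.nat_setNat, hp]⟩
  replace hc : σ₁.nat 12 0 0 = c := by rw [hF₁.nat _ (by decide), hc]
  replace hh : σ₁.nat 13 0 0 = h := by rw [hF₁.nat _ (by decide), hh]
  replace hq : σ₁.nat 14 0 0 = q := by rw [hF₁.nat _ (by decide), hq]
  replace hw : σ₁.nat 7 h 0 = w := by rw [h₁.2 h hhc, hw]
  rw [← hF₁.nat 8 (by decide), ← hF₁.nat 9 (by decide), ← hF₁.nat 10 (by decide)]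
  clear hF₁
  refine Runs.seq (Runs.straight (T := 20) trivial (by decide)
    (Q := fun σ' => σ'.nat 8 c 0 = q + 1 ∧ ∀ p, p ≠ c → σ'.nat 8 p = σ₁.nat 8 p) ?_)
    (fun σ₂ h₂ hF₂ => ?_) (T₂ := 60 + 60 * w) (by omega)
  · simp only [Cmd.effect, NExp.eval, hc, hq]
    exact ⟨by simp [Store.nat_setNat], fun p hp => by funext j; simp [Store.nat_setNat, hp]⟩
  rw [← hF₂.nat 7 (by decide)] at h₁ hw
  rw [← hF₂.nat 9 (by decide), ← hF₂.nat 10 (by decide)]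
  replace hc : σ₂.nat 12 0 0 = c := by rw [hF₂.nat _ (by decide), hc]
  replace hh : σ₂.nat 13 0 0 = h := by rw [hF₂.nat _ (by decide), hh]
  replace hq : σ₂.nat 14 0 0 = q := by rw [hF₂.nat _ (by decide), hq]
  clear hF₂
  refine Runs.seq (Runs.straight (T := 4) trivial (by decide)
    (Q := fun σ' => σ'.nat 15 0 0 = 0) ?_) (fun σ₃ h₃ hF₃ => ?_) (T₂ := 50 + 60 * w) (by omega)
  · simp [Cmd.effect, NExp.eval, Store.nat_setNat]
  rw [← hF₃.nat 7 (by decide)] at h₁ hw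
  rw [← hF₃.nat 8 (by decide)] at h₂
  rw [← hF₃.nat 9 (by decide), ← hF₃.nat 10 (by decide)]
  replace hc : σ₃.nat 12 0 0 = c := by rw [hF₃.nat _ (by decide), hc]
  replace hh : σ₃.nat 13 0 0 = h := by rw [hF₃.nat _ (by decide), hh]
  replace hq : σ₃.nat 14 0 0 = q := by rw [hF₃.nat _ (by decide), hq]
  clear hF₃
  refine Runs.seq (Runs.forLt 0 w 34 (fun i σ' =>
    ((∀ s < i, σ'.nat 9 c s = σ₃.nat 9 h s) ∧ ∀ p, p ≠ c → σ'.nat 9 p = σ₃.nat 9 p) ∧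
    ((∀ s < i, σ'.nat 10 c s = σ₃.nat 10 h s) ∧ ∀ p, p ≠ c → σ'.nat 10 p = σ₃.nat 10 p))
    h₃ (by decide) ?_ ?_ ?_ (T := 15 + 60 * w) ?_) (fun σ₄ h₄ hF₄ => ?_) (T₂ := 30) (by omega)
  · intro σ' hF
    simp [NExp.eval, hF.nat 13 (by decide), hF.nat 7 (by decide), hh, hw]
  · exact ⟨⟨fun s hs => absurd hs (by omega), fun _ _ => rfl⟩,
      ⟨fun s hs => absurd hs (by omega), fun _ _ => rfl⟩⟩
  · rintro i hi σ' hF hci ⟨⟨h9, h9'⟩, ⟨h10, h10'⟩⟩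
    refine Runs.straight ⟨trivial, trivial⟩ (by decide) ?_
    have e12 : σ'.nat 12 0 0 = c := by rw [hF.nat 12 (by decide), hc]
    have e13 : σ'.nat 13 0 0 = h := by rw [hF.nat 13 (by decide), hh]
    simp only [Cmd.effect, NExp.eval, Store.nat_setNat, e12, e13, hci, zero_add]
    refine ⟨⟨fun s hs => ?_, fun p hp => ?_⟩, ⟨fun s hs => ?_, fun p hp => ?_⟩⟩
    · rcases Nat.lt_succ_iff_lt_or_eq.mp hs with h' | rfl
      · have : s ≠ i := by omega
        simp [this, h9 s h']
      · simp [h9' h hhc]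
    · funext j; simp [Store.nat_setNat, hp, h9' p hp]
    · rcases Nat.lt_succ_iff_lt_or_eq.mp hs with h' | rfl
      · have : s ≠ i := by omega
        simp [this, h10 s h']
      · simp [h10' h hhc]
    · funext j; simp [Store.nat_setNat, hp, h10' p hp]
  · simp only [NExp.cost]; omega
  obtain ⟨⟨⟨h9, h9'⟩, ⟨h10, h10'⟩⟩, h15⟩ := h₄
  rw [zero_add] at h15
  refine Runs.straight ⟨trivial, trivial⟩ (by simp [Cmd.steps, NExp.cost]) ?_
  have e12 : σ₄.nat 12 0 0 = c := by rw [hF₄.nat 12 (by decide), hc]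
  have e14 : σ₄.nat 14 0 0 = q := by rw [hF₄.nat 14 (by decide), hq]
  rw [← hF₄.nat 7 (by decide)] at h₁
  rw [← hF₄.nat 8 (by decide)] at h₂
  simp only [Cmd.effect, NExp.eval, Store.nat_setNat, e12, e14, h15]
  refine ⟨⟨by simp [h₁.1], fun p hp => ?_⟩, ⟨by simp [h₂.1], fun p hp => ?_⟩,
    ⟨fun s hs => ?_, by simp, fun p hp => ?_⟩, ⟨fun s hs => ?_, by simp, fun p hp => ?_⟩⟩
  · funext j; simp [Store.nat_setNat, h₁.2 p hp]
  · funext j; simp [Store.nat_setNat, h₂.2 p hp]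
  · simp [h9 s hs, hs.ne]
  · funext j; simp [Store.nat_setNat, hp, h9' p hp]
  · simp [h10 s hs, hs.ne]
  · funext j; simp [Store.nat_setNat, hp, h10' p hp]

theorem runs_valuesCode {σ : Store} {c h q lab : ℕ} (hc : σ.nat 12 0 0 = c)
    (hh : σ.nat 13 0 0 = h) (hq : σ.nat 14 0 0 = q) (hN : σ.nat 0 0 1 = N) (hhc : h ≠ c) :
    Runs Ω (valuesCode lab) σ (20 + 60 * N) fun σ' =>
      (∀ l < N, σ'.real 3 c l = σ.real 3 h l * σ.real 6 lab (σ.nat 1 l q)) ∧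
        ∀ p, p ≠ c → σ'.real 3 p = σ.real 3 p := by
  refine Runs.seq (Runs.straight (T := 4) trivial (by decide)
    (Q := fun σ' => σ'.nat 16 0 0 = 0) ?_) (fun σ₁ h₁ hF₁ => ?_) (T₂ := 15 + 60 * N) (by omega)
  · simp [Cmd.effect, NExp.eval, Store.nat_setNat]
  replace hc : σ₁.nat 12 0 0 = c := by rw [hF₁.nat _ (by decide), hc]
  replace hh : σ₁.nat 13 0 0 = h := by rw [hF₁.nat _ (by decide), hh]
  replace hq : σ₁.nat 14 0 0 = q := by rw [hF₁.nat _ (by decide), hq]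
  replace hN : σ₁.nat 0 0 1 = N := by rw [hF₁.nat _ (by decide), hN]
  rw [← hF₁.nat 1 (by decide), ← hF₁.real 3 (by decide), ← hF₁.real 6 (by decide)]
  refine Runs.mono (Runs.forLt 0 N 30 (fun i σ' =>
    (∀ l < i, σ'.real 3 c l = σ₁.real 3 h l * σ₁.real 6 lab (σ₁.nat 1 l q)) ∧
      ∀ p, p ≠ c → σ'.real 3 p = σ₁.real 3 p) h₁ (by simp [Cmd.natWrites]) ?_ ?_ ?_ le_rfl) ?_
      fun σ' h => h.1
  · intro σ' hF
    simp [NExp.eval, hF.nat 0 (by simp [Cmd.natWrites]), hN]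
  · exact ⟨fun s hs => absurd hs (by omega), fun _ _ => rfl⟩
  · rintro i hi σ' hF hci ⟨h3, h3'⟩
    refine Runs.straight trivial (by simp [Cmd.steps, NExp.cost, RExp.cost]) ?_
    have e12 : σ'.nat 12 0 0 = c := by rw [hF.nat 12 (by simp [Cmd.natWrites]), hc]
    have e13 : σ'.nat 13 0 0 = h := by rw [hF.nat 13 (by simp [Cmd.natWrites]), hh]
    have e14 : σ'.nat 14 0 0 = q := by rw [hF.nat 14 (by simp [Cmd.natWrites]), hq]
    simp only [Cmd.effect, NExp.eval, RExp.eval, Store.real_setNat, Store.real_setReal, e12, e13,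
      e14, hci, zero_add, hF.nat 1 (by simp [Cmd.natWrites]),
      hF.real 6 (by simp [Cmd.realWrites])]
    refine ⟨fun s hs => ?_, fun p hp => ?_⟩
    · rcases Nat.lt_succ_iff_lt_or_eq.mp hs with h' | rfl
      · have : s ≠ i := by omega
        simp [this, h3 s h']
      · simp [h3' h hhc]
    · funext j; simp [Store.real_setReal, hp, h3' p hp]
  · simp only [NExp.cost]; omega

theorem runs_appendCode {S : Shadow n N} {k : ℕ} {τ : ℝ} {σ : Store} {L : List (PauliString n)}
    {h q : ℕ} {l : Fin 4} (hC : Constants S k τ σ) (hT : IsTable S σ L) (hh : σ.nat 13 0 0 = h)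
    (hhL : h < L.length) (hq : σ.nat 14 0 0 = q) (hqn : q < n) (hPq : top L[h] ≤ q) (hl : l ≠ 0)
    (hwk : weight L[h] ≤ k) :
    Runs Ω (appendCode l) σ (130 + 60 * k + 60 * N) fun σ' => IsTable S σ' (L ++ [upd L[h] q l]) := by
  set P := L[h] with hP
  have hrow := hT.row h hhL
  refine Runs.seq (runs_descriptionCode hT.length hh hq hrow.weight hhL.ne)
    (fun σ₁ h₁ hF₁ => ?_) (T₂ := 30 + 60 * N) (by rw [← hP]; omega)
  rw [← hP] at hrow h₁
  obtain ⟨⟨h7, h7'⟩, ⟨h8, h8'⟩, ⟨h9, h9q, h9'⟩, ⟨h10, h10q, h10'⟩⟩ := h₁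
  have hw : ∀ a, a ∉ [7, 8, 15, 9, 10] → σ₁.nat a = σ.nat a := fun a ha =>
    hF₁.nat a fun h' => ha (by
      simp only [descriptionCode, Cmd.natWrites, List.mem_append, List.mem_cons] at h' ⊢; tauto)
  have hr : σ₁.real = σ.real := funext fun a =>
    hF₁.real a (by simp [descriptionCode, Cmd.realWrites])
  have e12 : σ₁.nat 12 0 0 = L.length := by rw [hw 12 (by decide), hT.length]
  refine Runs.seq (runs_valuesCode (N := N) e12 (by rw [hw 13 (by decide), hh])
    (by rw [hw 14 (by decide), hq]) (by rw [hw 0 (by decide), hC.experiments]) hhL.ne)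
    (fun σ₂ h₂ hF₂ => ?_) (T₂ := 10) (by omega)
  obtain ⟨h3, h3'⟩ := h₂
  have hn : ∀ a, a ≠ 16 → σ₂.nat a = σ₁.nat a := fun a ha =>
    hF₂.nat a (by simp [valuesCode, Cmd.natWrites, ha])
  rw [hr] at h3'
  refine Runs.straight trivial (by decide) ?_
  simp only [Cmd.effect, NExp.eval, hn 12 (by decide), e12]
  have hrow' : IsRow S (σ₂.setNat 12 0 0 (L.length + 1)) L.length (upd P q l) := by
    refine ⟨?_, ?_, ?_, fun j => ?_⟩
    · rw [weight_upd hqn hPq hl]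
      simp [Store.nat_setNat, hn 7 (by decide), h7]
    · rw [top_upd hqn hPq hl]
      simp [Store.nat_setNat, hn 8 (by decide), h8]
    · rw [weight_upd hqn hPq hl]
      refine decode_snoc (a' := (σ₂.setNat 12 0 0 (L.length + 1)).nat 9 L.length)
        (b' := (σ₂.setNat 12 0 0 (L.length + 1)).nat 10 L.length) hrow.factors hPq ?_ ?_ ?_ ?_
      · intro s hs; simp [Store.nat_setNat, hn 9 (by decide), h9 s hs]
      · intro s hs; simp [Store.nat_setNat, hn 10 (by decide), h10 s hs]
      · simp [Store.nat_setNat, hn 9 (by decide), h9q]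
      · simp [Store.nat_setNat, hn 10 (by decide), h10q]
    · rw [stabChar_upd hqn hPq, Store.real_setNat, h3 j j.2, hr, hrow.values,
        hw 1 (by decide), hC.input j ⟨q, hqn⟩, hC.table _ _ hl]
  refine ⟨by simp [Store.nat_setNat], fun p hp => ?_⟩
  rw [List.length_append, List.length_singleton] at hp
  rcases Nat.lt_succ_iff_lt_or_eq.mp hp with hp | rfl
  · rw [List.getElem_append_left hp]
    refine (hT.row p hp).congr ?_ ?_ ?_ ?_ ?_
    · funext j; simp [Store.nat_setNat, hn 7 (by decide), h7' p hp.ne]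
    · funext j; simp [Store.nat_setNat, hn 8 (by decide), h8' p hp.ne]
    · funext j; simp [Store.nat_setNat, hn 9 (by decide), h9' p hp.ne]
    · funext j; simp [Store.nat_setNat, hn 10 (by decide), h10' p hp.ne]
    · rw [Store.real_setNat, h3' p hp.ne]
  · simpa using hrow'

end

section


/-! ### The breadth-first search -/

open RAM

variable {n N : ℕ} {Ω : Oracle}

/-- Appends the children of row `13`. -/
def expandCode : Cmd :=
  .ite (.natLe (.add (.get 7 (nv 13) (.lit 0)) (.lit 1)) (nv 11))
    (.letNat 14 (.get 8 (nv 13) (.lit 0)) ;;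
      .forLt 14 (nv 0) (appendCode 1 ;; appendCode 2 ;; appendCode 3))
    (.letNat 15 (.lit 0))

/-- The search, started with the identity in row `0`. -/
def searchCode : Cmd :=
  .letNat 12 (.lit 1) ;; .letNat 16 (.lit 0) ;;
  .forLt 16 (.get 0 (.lit 0) (.lit 1)) (.setReal 3 (.lit 0) (nv 16) (rlit 1)) ;;
  .letNat 13 (.lit 0) ;; .forLt 13 (nv 12) expandCode

/-- The training program. -/
def trainCode (b : ℕ) : Cmd := degreeCode ;; filterCode b ;; tableCode ;; searchCode

theorem IsTable.setNat {S : Shadow n N} {σ : Store} {L : List (PauliString n)}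
    (h : IsTable S σ L) {a : ℕ} (ha : a = 13 ∨ a = 14) (i j v : ℕ) :
    IsTable S (σ.setNat a i j v) L := by
  refine h.frame (p := .letNat a (.lit 0)) ⟨fun b hb => ?_, fun _ _ => rfl⟩ ?_ (by
    simp [Cmd.realWrites])
  · have : b ≠ a := by simpa [Cmd.natWrites] using hb
    funext i' j'
    simp [Store.nat_setNat, this]
  · rcases ha with rfl | rfl <;> decide

theorem runs_expandCode {S : Shadow n N} {k : ℕ} {τ : ℝ} {σ : Store} {L : List (PauliString n)}
    {h : ℕ} (hC : Constants S k τ σ) (hT : IsTable S σ L) (hh : σ.nat 13 0 0 = h)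
    (hhL : h < L.length) :
    Runs Ω expandCode σ (50 + (children k L[h]).length * (150 + 60 * k + 60 * N)) fun σ' =>
      IsTable S σ' (L ++ children k L[h]) := by
  set P := L[h] with hP
  have hrow : IsRow S σ h P := hT.row h hhL
  have hiff : (Test.natLe (.add (.get 7 (nv 13) (.lit 0)) (.lit 1)) (nv 11)).Holds σ ↔
      weight P < k := by
    simp only [Test.Holds, NExp.eval, hh, hrow.weight, hC.degree]; omega
  refine Runs.ite (T₁ := 30 + (children k P).length * (150 + 60 * k + 60 * N)) (fun hb => ?_)
    (fun hb => ?_) (by simp only [Test.cost, NExp.cost]; omega)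
  · have hlt := hiff.mp hb
    have hch : children k P = extensions P (n - top P) := if_pos hlt
    rw [hch, length_extensions]
    refine Runs.seq (Runs.straight (T := 10) trivial (by decide)
      (Q := fun σ' => σ'.nat 14 0 0 = top P) ?_) (fun σ₁ h₁ hF₁ => ?_)
      (T₂ := (n - top P) * (17 + 3 * (130 + 60 * k + 60 * N)) + 9) ?_
    · simp [Cmd.effect, NExp.eval, Store.nat_setNat, hh, hrow.top]
    · replace hC := hC.frame hF₁ (by decide) (by decide)
      replace hT := hT.frame hF₁ (by decide) (by decide)
      replace hh : σ₁.nat 13 0 0 = h := by rw [hF₁.nat _ (by decide), hh]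
      refine Runs.mono (Runs.forLt (top P) (n - top P) (3 * (130 + 60 * k + 60 * N))
        (fun i σ' => IsTable S σ' (L ++ extensions P i)) h₁ (by decide) ?_ ?_ ?_ le_rfl) ?_
        fun σ' h => h.1
      · intro σ' hF
        have := top_le P
        simp only [NExp.eval]
        rw [(hC.frame hF (by decide) (by decide)).qubits]
        omega
      · simpa [extensions] using hT
      · intro i hi σ' hF hc hI
        have hC' := hC.frame hF (by decide) (by decide)
        have e13 : σ'.nat 13 0 0 = h := by rw [hF.nat _ (by decide), hh]
        have get : ∀ L' : List (PauliString n), ∃ hL : h < (L ++ L').length, (L ++ L')[h] = P :=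
          fun L' => ⟨by rw [List.length_append]; omega, List.getElem_append_left hhL⟩
        have step : ∀ (l : Fin 4) (L' : List (PauliString n)) (σ'' : Store), l ≠ 0 →
            Constants S k τ σ'' → IsTable S σ'' (L ++ L') → σ''.nat 13 0 0 = h →
            σ''.nat 14 0 0 = top P + i →
            Runs Ω (appendCode l) σ'' (130 + 60 * k + 60 * N) fun σ' =>
              IsTable S σ' (L ++ (L' ++ [upd P (top P + i) l])) := by
          intro l L' σ'' hl hC hT h13 h14
          obtain ⟨hL, hLP⟩ := get L'
          have := runs_appendCode (Ω := Ω) hC hT h13 hL h14 (by omega) (by rw [hLP]; omega) hl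
            (by rw [hLP]; exact hlt.le)
          rw [hLP, List.append_assoc] at this
          exact this
        refine Runs.seq (step 1 _ σ' (by decide) hC' hI e13 hc) (fun σ₂ h₂ hF₂ => ?_)
          (T₂ := 2 * (130 + 60 * k + 60 * N)) (by omega)
        refine Runs.seq (step 2 _ σ₂ (by decide) (hC'.frame hF₂ (by decide) (by decide)) h₂
          (by rw [hF₂.nat _ (by decide), e13]) (by rw [hF₂.nat _ (by decide), hc]))
          (fun σ₃ h₃ hF₃ => ?_) (T₂ := 130 + 60 * k + 60 * N) (by omega)
        refine Runs.mono (step 3 _ σ₃ (by decide) ((hC'.frame hF₂ (by decide) (by decide)).frame hF₃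
          (by decide) (by decide)) h₃ (by rw [hF₃.nat _ (by decide), hF₂.nat _ (by decide), e13])
          (by rw [hF₃.nat _ (by decide), hF₂.nat _ (by decide), hc])) le_rfl fun σ₄ h₄ => ?_
        rw [extensions_succ]
        simp only [List.append_assoc, List.cons_append, List.nil_append] at h₄
        exact h₄.setNat (Or.inr rfl) _ _ _
      · simp only [NExp.cost, Nat.reduceAdd]; omega
    · have : (n - top P) * (17 + 3 * (130 + 60 * k + 60 * N)) ≤
          3 * (n - top P) * (150 + 60 * k + 60 * N) := by
        rw [mul_comm 3 (n - top P), mul_assoc]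
        exact Nat.mul_le_mul_left _ (by omega)
      omega
  · have hch : children k P = [] := if_neg fun h => hb (hiff.mpr h)
    rw [hch, List.append_nil]
    refine Runs.mono (T₁ := 4) (Runs.frame (Q := fun _ => True)
      (Runs.straight trivial (by decide) trivial)) ?_
      fun σ' h => hT.frame h.2 (by decide) (by decide)
    omega

theorem runs_searchCode {S : Shadow n N} {k : ℕ} {τ : ℝ} {σ : Store} (hC : Constants S k τ σ)
    (h7 : σ.nat 7 0 0 = 0) (h8 : σ.nat 8 0 0 = 0) {m : ℕ} (hlen : (queue n k m).length = m)
    (hlt : ∀ h < m, h < (queue n k h).length) :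
    Runs Ω searchCode σ (m * (250 + 60 * k + 60 * N) + 60 + 60 * N) fun σ' =>
      IsTable S σ' (queue n k m) := by
  refine Runs.seq (Runs.straight (T := 4) trivial (by decide)
    (Q := fun σ' => σ'.nat 12 0 0 = 1) ?_) (fun σ₁ h₁ hF₁ => ?_)
    (T₂ := m * (250 + 60 * k + 60 * N) + 50 + 60 * N) (by omega)
  · simp [Cmd.effect, NExp.eval, Store.nat_setNat]
  replace hC := hC.frame hF₁ (by decide) (by decide)
  rw [← hF₁.nat 7 (by decide)] at h7
  rw [← hF₁.nat 8 (by decide)] at h8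
  refine Runs.seq (Runs.straight (T := 4) trivial (by decide)
    (Q := fun σ' => σ'.nat 16 0 0 = 0) ?_) (fun σ₂ h₂ hF₂ => ?_)
    (T₂ := m * (250 + 60 * k + 60 * N) + 40 + 60 * N) (by omega)
  · simp [Cmd.effect, NExp.eval, Store.nat_setNat]
  replace hC := hC.frame hF₂ (by decide) (by decide)
  rw [← hF₂.nat 7 (by decide)] at h7
  rw [← hF₂.nat 8 (by decide)] at h8
  rw [← hF₂.nat 12 (by decide)] at h₁
  refine Runs.seq (Runs.forLt 0 N 10 (fun i σ' => ∀ l < i, σ'.real 3 0 l = 1) h₂ (by decide) ?_ ?_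
    ?_ (T := 60 * N + 12) ?_) (fun σ₃ h₃ hF₃ => ?_) (T₂ := m * (250 + 60 * k + 60 * N) + 20)
    (by omega)
  · intro σ' hF
    simp [NExp.eval, (hC.frame hF (by decide) (by decide)).experiments]
  · exact fun l hl => absurd hl (by omega)
  · intro i hi σ' hF hc hI
    refine Runs.straight trivial (by decide) ?_
    simp only [Cmd.effect, NExp.eval, RExp.eval, Store.real_setNat, Store.real_setReal, hc]
    intro l hl
    rcases Nat.lt_succ_iff_lt_or_eq.mp hl with h' | rfl
    · have : l ≠ i := by omega
      simp [this, hI l h']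
    · simp
  · simp only [NExp.cost]; omega
  replace hC := hC.frame hF₃ (by decide) (by decide)
  rw [← hF₃.nat 7 (by decide)] at h7
  rw [← hF₃.nat 8 (by decide)] at h8
  rw [← hF₃.nat 12 (by decide)] at h₁
  have hT : IsTable S σ₃ (queue n k 0) := by
    refine ⟨by rw [h₁]; rfl, fun p hp => ?_⟩
    have hp0 : p = 0 := by simpa [queue] using hp
    subst hp0
    simp only [queue, List.getElem_cons_zero]
    refine ⟨by rw [h7, weight_zero], by rw [h8, top_zero], ?_,
      fun l => by rw [h₃.1 l l.2, stabChar_zero]⟩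
    funext i
    have : ∀ f : Fin (weight (0 : PauliString n)) → ℕ, ∑ s, f s = 0 := by
      rw [weight_zero]; exact fun f => rfl
    simp only [decode, Finset.sum_filter, this]
    rfl
  refine Runs.seq (Runs.straight (T := 4) trivial (by decide)
    (Q := fun σ' => σ'.nat 13 0 0 = 0) ?_) (fun σ₄ h₄ hF₄ => ?_)
    (T₂ := m * (250 + 60 * k + 60 * N) + 10) (by omega)
  · simp [Cmd.effect, NExp.eval, Store.nat_setNat]
  replace hC := hC.frame hF₄ (by decide) (by decide)
  replace hT := hT.frame hF₄ (by decide) (by decide)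
  -- an iteration takes constant time, and time `150 + 60 k + 60 N` for each new row
  refine Runs.mono (Runs.loop m
    (fun h => h * 100 + (queue n k h).length * (150 + 60 * k + 60 * N))
    (fun h σ' => IsTable S σ' (queue n k h) ∧ σ'.nat 13 0 0 = h) ⟨hT, h₄⟩ ?_ ?_ le_rfl) ?_
    fun σ' h => h.1
  · rintro h hh σ' hF ⟨hT, hc⟩
    have hhL := hlt h hh
    have hC' := hC.frame hF (by decide) (by decide)
    have hq : queue n k (h + 1) = queue n k h ++ children k (queue n k h)[h] := by
      rw [queue, List.getElem?_eq_getElem hhL]; rfl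
    refine ⟨?_, 50 + (children k (queue n k h)[h]).length * (150 + 60 * k + 60 * N) + 8, ?_, ?_⟩
    · simp only [Test.Holds, NExp.eval, hc, hT.length]; omega
    · rw [hq, List.length_append, add_mul, add_mul]
      simp only [Test.cost, NExp.cost]; omega
    · refine Runs.seq (runs_expandCode hC' hT hc hhL) (T₂ := 8) (fun σ'' hT' hF' => ?_) le_rfl
      refine Runs.straight trivial (by decide) ?_
      have e13 : σ''.nat 13 0 0 = h := by rw [hF'.nat _ (by decide), hc]
      simp only [Cmd.effect, NExp.eval, e13]
      rw [hq]
      exact ⟨hT'.setNat (Or.inl rfl) _ _ _, by simp [Store.nat_setNat]⟩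
  · rintro σ' hF ⟨hT, hc⟩
    simp only [Test.Holds, NExp.eval, hc, hT.length, hlen]; omega
  · rw [hlen]
    simp only [Test.cost, NExp.cost]
    have : m * (250 + 60 * k + 60 * N) = m * 100 + m * (150 + 60 * k + 60 * N) := by ring
    omega

/-- After training, the memory holds the constants and the table of all Pauli observables of weight
at most `k`. -/
theorem runs_trainCode {S : Shadow n N} {ε ε' : ℝ} {b : ℕ} (hε : 0 < ε) {m : ℕ}
    (hlen : (queue n (degree ε) m).length = m)
    (hlt : ∀ h < m, h < (queue n (degree ε) h).length) :
    Runs Ω (trainCode b) (trainInput ε ε' S)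
      (m * (250 + 60 * degree ε + 60 * N) + 600 + 140 * degree ε + 60 * N) fun σ =>
      Constants S (degree ε) (filterParam b n (degree ε) ε') σ ∧
        IsTable S σ (queue n (degree ε) m) := by
  set k := degree ε with hk
  set τ := filterParam b n k ε' with hτ
  set σ₀ := trainInput ε ε' S with hσ₀
  refine Runs.seq (runs_degreeCode (ε := ε) rfl hε) (fun σ₁ h₁ hF₁ => ?_)
    (T₂ := m * (250 + 60 * k + 60 * N) + 500 + 40 * k + 60 * N) (by rw [← hk]; omega)
  rw [← hk] at h₁
  refine Runs.seq (runs_filterCode (b := b) (n := n) (ε' := ε')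
    (by rw [hF₁.nat 0 (by decide)]; rfl) h₁ (by rw [hF₁.real 0 (by decide)]; rfl))
    (fun σ₂ h₂ hF₂ => ?_) (T₂ := m * (250 + 60 * k + 60 * N) + 300 + 60 * N) (by omega)
  have hr2 : ∀ a, a ≠ 4 → a ≠ 5 → a ≠ 7 → σ₂.real a = σ₀.real a := fun a h4 h5 h7 => by
    rw [hF₂.real a (by simp [filterCode, Cmd.realWrites, h4, h5, h7]),
      hF₁.real a (by simp [degreeCode, Cmd.realWrites, h5])]
  refine Runs.seq (runs_tableCode (σ := σ₂) ?_) (fun σ₃ h₃ hF₃ => ?_)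
    (T₂ := m * (250 + 60 * k + 60 * N) + 60 + 60 * N) (by omega)
  · intro i j
    rw [hr2 6 (by decide) (by decide) (by decide)]
    simp [hσ₀, trainInput]
  have hn3 : ∀ a, a ≠ 11 → a ≠ 15 → a ≠ 17 → σ₃.nat a = σ₀.nat a := fun a h11 h15 h17 => by
    rw [hF₃.nat a (by simp [tableCode, Cmd.natWrites]),
      hF₂.nat a (by simp [filterCode, Cmd.natWrites, h15]),
      hF₁.nat a (by simp [degreeCode, Cmd.natWrites, h11, h17])]
  have hC : Constants S k τ σ₃ := by
    refine ⟨?_, ?_, fun l j => ?_, fun l j => ?_, ?_, ?_, h₃⟩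
    · rw [hn3 0 (by decide) (by decide) (by decide)]; rfl
    · rw [hn3 0 (by decide) (by decide) (by decide)]; rfl
    · rw [hn3 1 (by decide) (by decide) (by decide)]
      simp [hσ₀, trainInput]
    · rw [hn3 2 (by decide) (by decide) (by decide)]
      simp [hσ₀, trainInput]
    · rw [hF₃.nat 11 (by decide), hF₂.nat 11 (by simp [filterCode, Cmd.natWrites]), h₁]
    · rw [hF₃.real 4 (by decide), h₂]
  refine Runs.mono (runs_searchCode hC ?_ ?_ hlen hlt).frame le_rfl fun σ h =>
    ⟨hC.frame h.2 (by decide) (by decide), h.1⟩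
  · rw [hn3 7 (by decide) (by decide) (by decide)]
    simp [hσ₀, trainInput]
  · rw [hn3 8 (by decide) (by decide) (by decide)]
    simp [hσ₀, trainInput]

end

section


/-! ### The prediction program -/

open RAM

variable {n N : ℕ} {Ω : Oracle}

/-- Computes the Pauli-1 norm of the observable into the real variable `8`. -/
def pauliL1Code : Cmd :=
  .letReal 8 (rlit 0) ;; .letNat 18 (.lit 0) ;;
  .forLt 18 (nv 3)
    (.ite (.realLe (rlit 0) (.get 1 (nv 18) (.lit 0)))
      (.letReal 8 (.add (rv 8) (.get 1 (nv 18) (.lit 0))))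
      (.letReal 8 (.sub (rv 8) (.get 1 (nv 18) (.lit 0)))))

/-- Adds to the real variable `10` the contribution of the term `18` of the observable to the
shadow of the experiment `16`. -/
def termCode : Cmd :=
  .letReal 11 (.get 1 (nv 18) (.lit 0)) ;; .letNat 15 (.lit 0) ;;
  .forLt 15 (.get 4 (nv 18) (.lit 0))
    (.letReal 11 (.mul (rv 11) (.mul (rlit 3)
      (.get 6 (.get 6 (nv 18) (nv 15)) (.get 2 (nv 16) (.get 5 (nv 18) (nv 15))))))) ;;
  .letReal 10 (.add (rv 10) (rv 11))

/-- Computes the shadows of the observable in all experiments into row `0` of the real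
array `9`. -/
def shadowCode : Cmd :=
  .letNat 16 (.lit 0) ;;
  .forLt 16 (.get 0 (.lit 0) (.lit 1))
    (.letReal 10 (rlit 0) ;; .letNat 18 (.lit 0) ;; .forLt 18 (nv 3) termCode ;;
      .setReal 9 (.lit 0) (nv 16) (rv 10))

/-- Computes the estimate for row `19` into the real variable `12`. -/
def estimateCode : Cmd :=
  .letReal 12 (rlit 0) ;; .letNat 16 (.lit 0) ;;
  .forLt 16 (.get 0 (.lit 0) (.lit 1))
    (.letReal 12 (.add (rv 12) (.mul (.get 3 (nv 19) (nv 16)) (.get 9 (.lit 0) (nv 16))))) ;;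
  .letReal 12 (.div (rv 12) (.cast (.get 0 (.lit 0) (.lit 1))))

/-- Queries the expectation value of row `19` in the state into the real variable `14`, and
computes `3^{-w}` for the weight `w` of the row into the real variable `13`. -/
def queryCode : Cmd :=
  .letReal 13 (rlit 1) ;; .letNat 15 (.lit 0) ;;
  .forLt 15 (.get 7 (nv 19) (.lit 0))
    (.letReal 13 (.div (rv 13) (rlit 3)) ;;
      .setNat 20 (.lit 0) (nv 15) (.get 9 (nv 19) (nv 15)) ;;
      .setNat 21 (.lit 0) (nv 15) (.get 10 (nv 19) (nv 15))) ;;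
  .query 20 21 (.get 7 (nv 19) (.lit 0)) 14 (.lit 0) (.lit 0)

/-- Applies the filter, in the form `2 τ < 3^{-w}` and `4 η² τ 3^{-w} < x²`, and adds the
contribution of the row to the output. -/
def filterRowCode : Cmd :=
  .ite (.realLe (rv 13) (.mul (rlit 2) (rv 4))) (.letReal 11 (rlit 0))
    (.ite (.realLe (.mul (rv 12) (rv 12))
        (.mul (rlit 4) (.mul (.mul (rv 8) (rv 8)) (.mul (rv 4) (rv 13)))))
      (.letReal 11 (rlit 0))
      (.letReal 2 (.add (rv 2) (.mul (.div (rv 12) (rv 13)) (rv 14)))))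

/-- The prediction program. -/
def predictCode : Cmd :=
  pauliL1Code ;; shadowCode ;; .letReal 2 (rlit 0) ;; .letNat 19 (.lit 0) ;;
  .forLt 19 (nv 12) (estimateCode ;; queryCode ;; filterRowCode)

theorem runs_pauliL1Code {σ : Store} {m : ℕ} (hm : σ.nat 3 0 0 = m) :
    Runs Ω pauliL1Code σ (60 * m + 30) fun σ' =>
      σ'.real 8 0 0 = ∑ i ∈ Finset.range m, |σ.real 1 i 0| := by
  refine Runs.seq (Runs.straight (T := 5) trivial (by decide)
    (Q := fun σ' => σ'.real 8 0 0 = 0) ?_) (fun σ₁ h₁ hF₁ => ?_) (T₂ := 60 * m + 20) (by omega)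
  · simp [Cmd.effect, NExp.eval, RExp.eval, Store.real_setReal]
  rw [← hF₁.nat 3 (by decide)] at hm
  rw [← hF₁.real 1 (by decide)]
  refine Runs.seq (Runs.straight (T := 4) trivial (by decide)
    (Q := fun σ' => σ'.nat 18 0 0 = 0) ?_) (fun σ₂ h₂ hF₂ => ?_) (T₂ := 60 * m + 10) (by omega)
  · simp [Cmd.effect, NExp.eval, Store.nat_setNat]
  rw [← hF₂.nat 3 (by decide)] at hm
  rw [← hF₂.real 8 (by decide)] at h₁
  rw [← hF₂.real 1 (by decide)]
  refine Runs.mono (Runs.forLt 0 m 30 (fun i σ' => σ'.real 8 0 0 =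
    ∑ i ∈ Finset.range i, |σ₂.real 1 i 0|) h₂ (by decide) ?_ ?_ ?_ le_rfl) ?_ fun σ' h => h.1
  · intro σ' hF
    simp [NExp.eval, hF.nat 3 (by decide), hm]
  · simpa using h₁
  · intro i hi σ' hF hc hI
    refine Runs.straight ⟨trivial, trivial⟩ (by decide) ?_
    simp only [Cmd.effect, Test.Holds, NExp.eval, RExp.eval, hc, zero_add,
      hF.real 1 (by decide), hI, Finset.sum_range_succ, Nat.cast_zero]
    split_ifs with h
    · simp [Store.real_setNat, Store.real_setReal, abs_of_nonneg h]
    · simp [Store.real_setNat, Store.real_setReal, abs_of_neg (not_le.mp h), sub_eq_add_neg]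
  · simp only [NExp.cost]; omega

/-- The contribution of the term `i` of the observable to the shadow of the experiment `l`, as the
program computes it. -/
def termValue (σ : Store) (l i : ℕ) : ℝ :=
  σ.real 1 i 0 * ∏ s ∈ Finset.range (σ.nat 4 i 0),
    3 * σ.real 6 (σ.nat 6 i s) (σ.nat 2 l (σ.nat 5 i s))

theorem termValue_frame {σ σ' : Store} {p : Cmd} (hF : Frame p σ σ')
    (hn : 2 ∉ p.natWrites ∧ 4 ∉ p.natWrites ∧ 5 ∉ p.natWrites ∧ 6 ∉ p.natWrites)
    (hr : 1 ∉ p.realWrites ∧ 6 ∉ p.realWrites) : termValue σ' = termValue σ := by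
  funext l i
  simp only [termValue, hF.nat 2 hn.1, hF.nat 4 hn.2.1, hF.nat 5 hn.2.2.1, hF.nat 6 hn.2.2.2,
    hF.real 1 hr.1, hF.real 6 hr.2]

theorem runs_termCode {σ : Store} {l i κ : ℕ} (hl : σ.nat 16 0 0 = l) (hi : σ.nat 18 0 0 = i)
    (hκ : σ.nat 4 i 0 ≤ κ) :
    Runs Ω termCode σ (60 + 80 * κ) fun σ' =>
      σ'.real 10 0 0 = σ.real 10 0 0 + termValue σ l i := by
  refine Runs.seq (Runs.straight (T := 10) trivial (by decide)
    (Q := fun σ' => σ'.real 11 0 0 = σ.real 1 i 0) ?_) (fun σ₁ h₁ hF₁ => ?_)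
    (T₂ := 50 + 80 * κ) (by omega)
  · simp [Cmd.effect, NExp.eval, RExp.eval, Store.real_setReal, hi]
  rw [← termValue_frame hF₁ (by decide) (by decide), ← hF₁.real 10 (by decide)]
  rw [← hF₁.nat 16 (by decide)] at hl
  rw [← hF₁.nat 18 (by decide)] at hi
  rw [← hF₁.nat 4 (by decide)] at hκ
  rw [← hF₁.real 1 (by decide)] at h₁
  refine Runs.seq (Runs.straight (T := 4) trivial (by decide)
    (Q := fun σ' => σ'.nat 15 0 0 = 0) ?_) (fun σ₂ h₂ hF₂ => ?_)
    (T₂ := 40 + 80 * κ) (by omega)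
  · simp [Cmd.effect, NExp.eval, Store.nat_setNat]
  rw [← termValue_frame hF₂ (by decide) (by decide), ← hF₂.real 10 (by decide)]
  rw [← hF₂.nat 16 (by decide)] at hl
  rw [← hF₂.nat 18 (by decide)] at hi
  rw [← hF₂.nat 4 (by decide)] at hκ
  rw [← hF₂.real 1 (by decide), ← hF₂.real 11 (by decide)] at h₁
  refine Runs.seq (Runs.forLt 0 (σ₂.nat 4 i 0) 40 (fun j σ' => σ'.real 11 0 0 =
    σ₂.real 1 i 0 * ∏ s ∈ Finset.range j,
      3 * σ₂.real 6 (σ₂.nat 6 i s) (σ₂.nat 2 l (σ₂.nat 5 i s))) h₂ (by decide) ?_ ?_ ?_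
    (T := 15 + 80 * κ) ?_) (fun σ₃ h₃ hF₃ => ?_) (T₂ := 20) (by omega)
  · intro σ' hF
    simp [NExp.eval, hF.nat 18 (by decide), hF.nat 4 (by decide), hi]
  · simpa using h₁
  · intro j hj σ' hF hc hI
    refine Runs.straight trivial (by decide) ?_
    simp only [Cmd.effect, NExp.eval, RExp.eval, hc, zero_add, hF.real 6 (by decide),
      hF.nat 18 (by decide), hF.nat 16 (by decide), hF.nat 6 (by decide), hF.nat 5 (by decide),
      hF.nat 2 (by decide), hI, Finset.prod_range_succ, hi, hl, Store.real_setNat,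
      Store.real_setReal, and_self, if_true]
    push_cast
    ring
  · simp only [NExp.cost, Nat.reduceAdd]
    have := Nat.mul_le_mul_right 60 hκ
    omega
  refine Runs.straight trivial (by decide) ?_
  simp [Cmd.effect, NExp.eval, RExp.eval, Store.real_setReal, h₃.1, hF₃.real 10 (by decide),
    termValue]

theorem runs_shadowCode {σ : Store} {m κ : ℕ} (hm : σ.nat 3 0 0 = m) (hN : σ.nat 0 0 1 = N)
    (hκ : ∀ i < m, σ.nat 4 i 0 ≤ κ) :
    Runs Ω shadowCode σ (20 + N * (100 + m * (100 + 80 * κ))) fun σ' =>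
      ∀ l < N, σ'.real 9 0 l = ∑ i ∈ Finset.range m, termValue σ l i := by
  refine Runs.seq (Runs.straight (T := 4) trivial (by decide)
    (Q := fun σ' => σ'.nat 16 0 0 = 0) ?_) (fun σ₁ h₁ hF₁ => ?_)
    (T₂ := 10 + N * (100 + m * (100 + 80 * κ))) (by omega)
  · simp [Cmd.effect, NExp.eval, Store.nat_setNat]
  rw [← termValue_frame hF₁ (by decide) (by decide)]
  rw [← hF₁.nat 3 (by decide)] at hm
  rw [← hF₁.nat 0 (by decide)] at hN
  rw [← hF₁.nat 4 (by decide)] at hκ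
  refine Runs.mono (Runs.forLt 0 N (50 + m * (100 + 80 * κ)) (fun j σ' => ∀ l < j,
    σ'.real 9 0 l = ∑ i ∈ Finset.range m, termValue σ₁ l i) h₁ (by decide) ?_ ?_ ?_ le_rfl) ?_
    fun σ' h => h.1
  · intro σ' hF
    simp [NExp.eval, hF.nat 0 (by decide), hN]
  · exact fun l hl => absurd hl (by omega)
  · intro l hl σ' hF hc hI
    rw [zero_add] at hc
    rw [← termValue_frame hF (by decide) (by decide)] at hI ⊢
    rw [← hF.nat 3 (by decide)] at hm
    rw [← hF.nat 4 (by decide)] at hκ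
    clear hF hF₁
    refine Runs.seq (Runs.straight (T := 5) trivial (by decide)
      (Q := fun σ' => σ'.real 10 0 0 = 0) ?_) (fun σ₂ h₂ hF₂ => ?_)
      (T₂ := 40 + m * (100 + 80 * κ)) (by omega)
    · simp [Cmd.effect, NExp.eval, RExp.eval, Store.real_setReal]
    rw [← termValue_frame hF₂ (by decide) (by decide)] at hI ⊢
    rw [← hF₂.nat 3 (by decide)] at hm
    rw [← hF₂.nat 4 (by decide)] at hκ
    rw [← hF₂.nat 16 (by decide)] at hc
    rw [← hF₂.real 9 (by decide)] at hI
    refine Runs.seq (Runs.straight (T := 4) trivial (by decide)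
      (Q := fun σ' => σ'.nat 18 0 0 = 0) ?_) (fun σ₃ h₃ hF₃ => ?_)
      (T₂ := 30 + m * (100 + 80 * κ)) (by omega)
    · simp [Cmd.effect, NExp.eval, Store.nat_setNat]
    rw [← termValue_frame hF₃ (by decide) (by decide)] at hI ⊢
    rw [← hF₃.nat 3 (by decide)] at hm
    rw [← hF₃.nat 4 (by decide)] at hκ
    rw [← hF₃.nat 16 (by decide)] at hc
    rw [← hF₃.real 9 (by decide)] at hI
    rw [← hF₃.real 10 (by decide)] at h₂
    refine Runs.seq (Runs.forLt 0 m (60 + 80 * κ) (fun j σ' => σ'.real 10 0 0 =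
      ∑ i ∈ Finset.range j, termValue σ₃ l i) h₃ (by decide) ?_ ?_ ?_
      (T := 10 + m * (100 + 80 * κ)) ?_) (fun σ₄ h₄ hF₄ => ?_) (T₂ := 10) (by omega)
    · intro σ' hF
      simp [NExp.eval, hF.nat 3 (by decide), hm]
    · simpa using h₂
    · intro i hi σ' hF hc' hI
      rw [zero_add] at hc'
      refine Runs.mono (runs_termCode (κ := κ) (by rw [hF.nat 16 (by decide), hc]) hc'
        (by rw [hF.nat 4 (by decide)]; exact hκ i hi)) le_rfl fun σ'' h => ?_
      rw [Store.real_setNat, h, hI, termValue_frame hF (by decide) (by decide),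
        Finset.sum_range_succ]
    · simp only [NExp.cost]
      have : m * (1 + 1 + 1 + 14 + (60 + 80 * κ)) ≤ m * (100 + 80 * κ) :=
        Nat.mul_le_mul_left _ (by omega)
      omega
    refine Runs.straight trivial (by decide) ?_
    have e16 : σ₄.nat 16 0 0 = l := by rw [hF₄.nat 16 (by decide), hc]
    rw [← hF₄.real 9 (by decide)] at hI
    simp only [Cmd.effect, NExp.eval, RExp.eval, Store.real_setNat, Store.real_setReal, e16, h₄.1]
    intro j hj
    rcases Nat.lt_succ_iff_lt_or_eq.mp hj with h' | rfl
    · have : j ≠ l := by omega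
      simp [this, hI j h']
    · simp
  · simp only [NExp.cost]
    have : N * (1 + 1 + 1 + 14 + (50 + m * (100 + 80 * κ))) ≤ N * (100 + m * (100 + 80 * κ)) :=
      Nat.mul_le_mul_left _ (by omega)
    omega

theorem runs_estimateCode {σ : Store} {p : ℕ} (hp : σ.nat 19 0 0 = p) (hN : σ.nat 0 0 1 = N) :
    Runs Ω estimateCode σ (60 + 60 * N) fun σ' =>
      σ'.real 12 0 0 = (∑ l ∈ Finset.range N, σ.real 3 p l * σ.real 9 0 l) / N := by
  refine Runs.seq (Runs.straight (T := 5) trivial (by decide)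
    (Q := fun σ' => σ'.real 12 0 0 = 0) ?_) (fun σ₁ h₁ hF₁ => ?_)
    (T₂ := 50 + 60 * N) (by omega)
  · simp [Cmd.effect, NExp.eval, RExp.eval, Store.real_setReal]
  rw [← hF₁.nat 19 (by decide)] at hp
  rw [← hF₁.nat 0 (by decide)] at hN
  rw [← hF₁.real 3 (by decide), ← hF₁.real 9 (by decide)]
  refine Runs.seq (Runs.straight (T := 4) trivial (by decide)
    (Q := fun σ' => σ'.nat 16 0 0 = 0) ?_) (fun σ₂ h₂ hF₂ => ?_)
    (T₂ := 40 + 60 * N) (by omega)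
  · simp [Cmd.effect, NExp.eval, Store.nat_setNat]
  rw [← hF₂.nat 19 (by decide)] at hp
  rw [← hF₂.nat 0 (by decide)] at hN
  rw [← hF₂.real 12 (by decide)] at h₁
  rw [← hF₂.real 3 (by decide), ← hF₂.real 9 (by decide)]
  refine Runs.seq (Runs.forLt 0 N 30 (fun j σ' => σ'.real 12 0 0 =
    ∑ l ∈ Finset.range j, σ₂.real 3 p l * σ₂.real 9 0 l) h₂ (by decide) ?_ ?_ ?_
    (T := 15 + 60 * N) ?_) (fun σ₃ h₃ hF₃ => ?_) (T₂ := 20) (by omega)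
  · intro σ' hF
    simp [NExp.eval, hF.nat 0 (by decide), hN]
  · simpa using h₁
  · intro l hl σ' hF hc hI
    refine Runs.straight trivial (by decide) ?_
    simp [Cmd.effect, NExp.eval, RExp.eval, Store.real_setNat, Store.real_setReal, hc, hI,
      hF.real 3 (by decide), hF.real 9 (by decide), hF.nat 19 (by decide), hp,
      Finset.sum_range_succ]
  · simp only [NExp.cost]; omega
  refine Runs.straight trivial (by decide) ?_
  simp [Cmd.effect, NExp.eval, RExp.eval, Store.real_setReal, h₃.1, hF₃.nat 0 (by decide), hN]

theorem runs_queryCode {S : Shadow n N} {σ : Store} {p k : ℕ} {P : PauliString n} {ρ : Op n}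
    (hp : σ.nat 19 0 0 = p) (hP : IsRow S σ p P) (hk : weight P ≤ k) :
    Runs (stateOracle ρ k) queryCode σ (50 + 60 * k) fun σ' =>
      σ'.real 13 0 0 = (1 / 3) ^ weight P ∧ σ'.real 14 0 0 = (pauliOp P * ρ).trace.re := by
  refine Runs.seq (Runs.straight (T := 5) trivial (by decide)
    (Q := fun σ' => σ'.real 13 0 0 = 1) ?_) (fun σ₁ h₁ hF₁ => ?_)
    (T₂ := 40 + 60 * k) (by omega)
  · simp [Cmd.effect, NExp.eval, RExp.eval, Store.real_setReal]
  replace hP : IsRow S σ₁ p P := hP.congr (by rw [hF₁.nat 7 (by decide)])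
    (by rw [hF₁.nat 8 (by decide)]) (by rw [hF₁.nat 9 (by decide)])
    (by rw [hF₁.nat 10 (by decide)]) (by rw [hF₁.real 3 (by decide)])
  rw [← hF₁.nat 19 (by decide)] at hp
  refine Runs.seq (Runs.straight (T := 4) trivial (by decide)
    (Q := fun σ' => σ'.nat 15 0 0 = 0) ?_) (fun σ₂ h₂ hF₂ => ?_)
    (T₂ := 30 + 60 * k) (by omega)
  · simp [Cmd.effect, NExp.eval, Store.nat_setNat]
  replace hP : IsRow S σ₂ p P := hP.congr (by rw [hF₂.nat 7 (by decide)])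
    (by rw [hF₂.nat 8 (by decide)]) (by rw [hF₂.nat 9 (by decide)])
    (by rw [hF₂.nat 10 (by decide)]) (by rw [hF₂.real 3 (by decide)])
  rw [← hF₂.nat 19 (by decide)] at hp
  rw [← hF₂.real 13 (by decide)] at h₁
  refine Runs.seq (Runs.forLt 0 (weight P) 38 (fun j σ' => σ'.real 13 0 0 = (1 / 3) ^ j ∧
    (∀ s < j, σ'.nat 20 0 s = σ₂.nat 9 p s) ∧ (∀ s < j, σ'.nat 21 0 s = σ₂.nat 10 p s))
    h₂ (by decide) ?_ ?_ ?_ (T := 14 + 58 * k) ?_) (fun σ₃ h₃ hF₃ => ?_)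
    (T₂ := 12 + k) (by omega)
  · intro σ' hF
    simp [NExp.eval, hF.nat 7 (by decide), hF.nat 19 (by decide), hp, hP.weight]
  · exact ⟨by simpa using h₁, fun s hs => absurd hs (by omega), fun s hs => absurd hs (by omega)⟩
  · rintro j hj σ' hF hc ⟨h13, h20, h21⟩
    refine Runs.straight ⟨trivial, trivial, trivial⟩ (by decide) ?_
    simp only [Cmd.effect, NExp.eval, RExp.eval, Store.real_setNat, Store.real_setReal,
      Store.nat_setNat, Store.nat_setReal, hc, hF.nat 9 (by decide), hF.nat 10 (by decide),
      hF.nat 19 (by decide), hp, h13, zero_add]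
    refine ⟨by simp [pow_succ, div_eq_mul_inv], fun s hs => ?_, fun s hs => ?_⟩
    · rcases Nat.lt_succ_iff_lt_or_eq.mp hs with h' | rfl
      · have : s ≠ j := by omega
        simp [this, h20 s h']
      · simp
    · rcases Nat.lt_succ_iff_lt_or_eq.mp hs with h' | rfl
      · have : s ≠ j := by omega
        simp [this, h21 s h']
      · simp
  · simp only [NExp.cost]; omega
  obtain ⟨⟨h13, h20, h21⟩, -⟩ := h₃
  have e7 : (NExp.get 7 (nv 19) (.lit 0)).eval σ₃ = weight P := by
    simp [NExp.eval, hF₃.nat 7 (by decide), hF₃.nat 19 (by decide), hp, hP.weight]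
  refine ⟨_, _, .query 20 21 (.get 7 (nv 19) (.lit 0)) 14 (.lit 0) (.lit 0) σ₃, ?_, ?_⟩
  · rw [e7]; simp only [NExp.cost]; omega
  rw [e7]
  have hdec : decode n (fun s : Fin (weight P) => (σ₃.nat 20 0 s, σ₃.nat 21 0 s)) = P := by
    have e : (fun s : Fin (weight P) => (σ₃.nat 20 0 s, σ₃.nat 21 0 s)) =
        fun s : Fin (weight P) => (σ₂.nat 9 p s, σ₂.nat 10 p s) :=
      funext fun s => by rw [h20 s s.2, h21 s s.2]
    rw [e, hP.factors]
  simp [Store.real_setReal, NExp.eval, h13, stateOracle, hdec, hk]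

theorem runs_filterRowCode {S : Shadow n N} {σ : Store} {τ : ℝ} {P : PauliString n}
    {O : Op n} {z : ℝ} (hτ : 0 < τ) (h4 : σ.real 4 0 0 = τ) (h8 : σ.real 8 0 0 = pauliL1 O)
    (h12 : σ.real 12 0 0 = xHat S P O) (h13 : σ.real 13 0 0 = (1 / 3) ^ weight P)
    (h14 : σ.real 14 0 0 = z) :
    Runs Ω filterRowCode σ 60 fun σ' =>
      σ'.real 2 0 0 = σ.real 2 0 0 + alphaHat S τ P O * z := by
  have hη : 0 ≤ pauliL1 O := Finset.sum_nonneg fun _ _ => norm_nonneg _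
  have hp : (0 : ℝ) < (1 / 3) ^ weight P := by positivity
  have hiff : 2 * pauliL1 O * √τ < |xHat S P O| / √((1 / 3) ^ weight P) ↔
      4 * (pauliL1 O * pauliL1 O * (τ * (1 / 3) ^ weight P)) < xHat S P O * xHat S P O := by
    rw [lt_div_iff₀ (Real.sqrt_pos.mpr hp), mul_assoc, ← Real.sqrt_mul hτ.le]
    have h0 : 0 ≤ 2 * pauliL1 O * √(τ * (1 / 3) ^ weight P) := by positivity
    rw [← abs_of_nonneg h0, ← sq_lt_sq, mul_pow, Real.sq_sqrt (by positivity)]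
    constructor <;> intro h <;> linarith
  refine Runs.straight ⟨trivial, trivial, trivial⟩ (by decide) ?_
  simp only [filterRowCode, Cmd.effect, Test.Holds, NExp.eval, RExp.eval, h4, h8, h12, h13, h14]
  rw [alphaHat]
  push_cast
  by_cases h1 : 2 * τ < (1 / 3) ^ weight P
  · rw [if_neg (not_le.mpr h1)]
    by_cases h2 : 2 * pauliL1 O * √τ < |xHat S P O| / √((1 / 3) ^ weight P)
    · rw [if_neg (not_le.mpr (hiff.mp h2)), if_pos ⟨h1, h2⟩]
      simp [Store.real_setReal]
    · rw [if_pos (not_lt.mp fun h => h2 (hiff.mpr h)), if_neg fun h => h2 h.2]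
      simp [Store.real_setReal]
  · rw [if_pos (not_lt.mp h1), if_neg fun h => h1 h.1]
    simp [Store.real_setReal]

end

section


/-! ### The output and the running time -/

open RAM

variable {n N : ℕ}

/-- The sparse Pauli expansion of `O`, listed by `Q`, is in the memory. -/
structure IsLoaded {m : ℕ} (O : Op n) (Q : Fin m → PauliString n) (σ : Store) : Prop where
  terms : σ.nat 3 0 0 = m
  weights : ∀ i : Fin m, σ.nat 4 i 0 = weight (Q i)
  coeffs : ∀ i : Fin m, σ.real 1 i 0 = (pauliCoeff (Q i) O).re
  factors : ∀ (i : Fin m) (f : ℕ → ℕ → ℝ),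
    ∏ s ∈ Finset.range (weight (Q i)), f (σ.nat 6 i s) (σ.nat 5 i s) =
      ∏ j ∈ dom (Q i), f (Q i j) j

theorem isLoaded_predictInput {m : ℕ} (σ : Store) (O : Op n) (Q : Fin m → PauliString n) :
    IsLoaded O Q (predictInput σ O Q) where
  terms := by simp [predictInput]
  weights i := by simp [predictInput]
  coeffs i := by simp [predictInput]
  factors i f := by
    set l := (dom (Q i)).sort (· ≤ ·) with hl
    have hlen : l.length = weight (Q i) := Finset.length_sort _
    have h : ∏ j ∈ dom (Q i), f (Q i j) j = (l.map fun j => f (Q i j) j).prod := by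
      rw [← Finset.prod_map_toList, ← Multiset.prod_coe, ← Multiset.prod_coe, ← Multiset.map_coe,
        ← Multiset.map_coe, Finset.coe_toList, hl, Finset.sort_eq]
    rw [h, ← Fin.prod_univ_fun_getElem, ← hlen, Finset.prod_range]
    refine Finset.prod_congr rfl fun s _ => ?_
    simp [predictInput, ← hl, ← List.map_eq_flatMap]

theorem frame_predictInput {m : ℕ} (σ : Store) (O : Op n) (Q : Fin m → PauliString n) :
    (∀ a, a ∉ [3, 4, 5, 6] → (predictInput σ O Q).nat a = σ.nat a) ∧
      ∀ a, a ≠ 1 → (predictInput σ O Q).real a = σ.real a := by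
  constructor
  · intro a ha
    simp only [List.mem_cons, List.not_mem_nil, or_false, not_or] at ha
    funext i j
    simp [predictInput, ha]
  · intro a ha
    funext i j
    simp [predictInput, ha]

theorem IsListing.sum_eq {m : ℕ} {O : Op n} {Q : Fin m → PauliString n} (hQ : IsListing O Q)
    (g : PauliString n → ℝ) (hg : ∀ P, pauliCoeff P O = 0 → g P = 0) :
    ∑ i, g (Q i) = ∑ P, g P := by
  refine Fintype.sum_of_injective Q hQ.1 _ g (fun P hP => hg P ?_) fun _ => rfl
  by_contra h
  exact hP (hQ.2 ▸ h)

theorem IsLoaded.sum_abs_eq {m : ℕ} {O : Op n} {Q : Fin m → PauliString n} {σ : Store}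
    (h : IsLoaded O Q σ) (hQ : IsListing O Q) (hO : O.IsHermitian) :
    ∑ i ∈ Finset.range m, |σ.real 1 i 0| = pauliL1 O := by
  rw [Finset.sum_range, pauliL1, ← hQ.sum_eq (fun P => ‖pauliCoeff P O‖) fun P hP => by
    rw [hP, norm_zero]]
  refine Finset.sum_congr rfl fun i _ => ?_
  rw [h.coeffs, pauliCoeff_eq_re hO (Q i), Complex.norm_real, Complex.ofReal_re, Real.norm_eq_abs]

theorem prod_dom_stabExp (P : PauliString n) (s : Fin n → Fin 6) :
    ∏ j ∈ dom P, 3 * stabExp (P j) (s j) = 3 ^ weight P * stabChar P s := by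
  rw [Finset.prod_mul_distrib, Finset.prod_const, stabChar, weight]
  congr 1
  refine Finset.prod_subset (Finset.subset_univ _) fun j _ hj => ?_
  have : P j = 0 := by simpa [dom] using hj
  rw [this, stabExp_zero]

theorem IsLoaded.sum_termValue {m : ℕ} {O : Op n} {Q : Fin m → PauliString n} {σ : Store}
    {S : Shadow n N} {k : ℕ} {τ : ℝ} (h : IsLoaded O Q σ) (hQ : IsListing O Q)
    (hC : Constants S k τ σ) (l : Fin N) :
    ∑ i ∈ Finset.range m, termValue σ l i =
      (O * tensorOp fun i => (3 : ℂ) • stabProj ((S l).2 i) - 1).trace.re := by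
  rw [trace_mul_shadow, Finset.sum_range, ← hQ.sum_eq (fun P => (pauliCoeff P O).re *
    (3 ^ weight P * stabChar P (S l).2)) fun P hP => by rw [hP, Complex.zero_re, zero_mul]]
  refine Finset.sum_congr rfl fun i _ => ?_
  rw [termValue, h.coeffs, h.weights, h.factors i fun a j => 3 * σ.real 6 a (σ.nat 2 l j),
    ← prod_dom_stabExp]
  congr 1
  refine Finset.prod_congr rfl fun j hj => ?_
  rw [hC.output, hC.table _ _ (by simpa [dom] using hj)]

theorem runs_predictCode {m k κ : ℕ} {τ : ℝ} {S : Shadow n N} {σ : Store} {O ρ : Op n}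
    {Q : Fin m → PauliString n} {L : List (PauliString n)} (hτ : 0 < τ) (hC : Constants S k τ σ)
    (hT : IsTable S σ L) (hL : L.Nodup) (hLk : ∀ P, P ∈ L ↔ weight P ≤ k) (hO : O.IsHermitian)
    (hl : IsLoaded O Q σ) (hQ : IsListing O Q) (hκ : ∀ i, weight (Q i) ≤ κ) :
    Runs (stateOracle ρ k) predictCode σ
      (100 + 60 * m + N * (100 + m * (100 + 80 * κ)) + L.length * (200 + 60 * N + 60 * k)) fun σ' =>
      output σ' = learned S k τ ρ O := by
  have hκ' : ∀ i < m, σ.nat 4 i 0 ≤ κ := fun i hi => by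
    have := hl.weights ⟨i, hi⟩
    simp only at this
    rw [this]; exact hκ _
  have hV := hl.sum_termValue hQ hC
  have hη := hl.sum_abs_eq hQ hO
  refine Runs.seq (runs_pauliL1Code hl.terms) (fun σ₁ h₁ hF₁ => ?_)
    (T₂ := 70 + N * (100 + m * (100 + 80 * κ)) + L.length * (200 + 60 * N + 60 * k)) (by omega)
  rw [hη] at h₁
  rw [← termValue_frame hF₁ (by decide) (by decide)] at hV
  rw [← hF₁.nat 4 (by decide)] at hκ'
  have hm : σ₁.nat 3 0 0 = m := by rw [hF₁.nat 3 (by decide), hl.terms]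
  replace hC := hC.frame hF₁ (by decide) (by decide)
  replace hT := hT.frame hF₁ (by decide) (by decide)
  refine Runs.seq (runs_shadowCode hm hC.experiments hκ') (fun σ₂ h₂ hF₂ => ?_)
    (T₂ := 50 + L.length * (200 + 60 * N + 60 * k)) (by omega)
  rw [← hF₂.real 8 (by decide)] at h₁
  replace hC := hC.frame hF₂ (by decide) (by decide)
  replace hT := hT.frame hF₂ (by decide) (by decide)
  replace h₂ : ∀ l : Fin N, σ₂.real 9 0 l =
      (O * tensorOp fun i => (3 : ℂ) • stabProj ((S l).2 i) - 1).trace.re := fun l => by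
    rw [h₂ l l.2, hV]
  clear hF₁ hF₂ hV
  refine Runs.seq (Runs.straight (T := 5) trivial (by decide)
    (Q := fun σ' => σ'.real 2 0 0 = 0) ?_) (fun σ₃ h₃ hF₃ => ?_)
    (T₂ := 40 + L.length * (200 + 60 * N + 60 * k)) (by omega)
  · simp [Cmd.effect, NExp.eval, RExp.eval, Store.real_setReal]
  replace hC := hC.frame hF₃ (by decide) (by decide)
  replace hT := hT.frame hF₃ (by decide) (by decide)
  rw [← hF₃.real 8 (by decide)] at h₁
  rw [← hF₃.real 9 (by decide)] at h₂
  refine Runs.seq (Runs.straight (T := 4) trivial (by decide)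
    (Q := fun σ' => σ'.nat 19 0 0 = 0) ?_) (fun σ₄ h₄ hF₄ => ?_)
    (T₂ := 30 + L.length * (200 + 60 * N + 60 * k)) (by omega)
  · simp [Cmd.effect, NExp.eval, Store.nat_setNat]
  replace hC := hC.frame hF₄ (by decide) (by decide)
  replace hT := hT.frame hF₄ (by decide) (by decide)
  rw [← hF₄.real 8 (by decide)] at h₁
  rw [← hF₄.real 9 (by decide)] at h₂
  rw [← hF₄.real 2 (by decide)] at h₃
  refine Runs.mono (Runs.forLt 0 L.length (180 + 60 * N + 60 * k) (fun j σ' => σ'.real 2 0 0 =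
    ((L.take j).map fun P => alphaHat S τ P O * (pauliOp P * ρ).trace.re).sum)
    h₄ (by decide) ?_ ?_ ?_ le_rfl) ?_ ?_
  · intro σ' hF
    simp [NExp.eval, (hT.frame hF (by decide) (by decide)).length]
  · simpa using h₃
  · intro p hp σ' hF hc hI
    rw [zero_add] at hc
    replace hC := hC.frame hF (by decide) (by decide)
    replace hT := hT.frame hF (by decide) (by decide)
    rw [← hF.real 8 (by decide)] at h₁
    rw [← hF.real 9 (by decide)] at h₂
    have hw : weight L[p] ≤ k := (hLk _).mp (List.getElem_mem hp)
    have hx : (∑ l ∈ Finset.range N, σ'.real 3 p l * σ'.real 9 0 l) / N = xHat S L[p] O := by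
      rw [xHat, Finset.sum_range, div_eq_inv_mul, one_div]
      congr 1
      refine Finset.sum_congr rfl fun l _ => ?_
      rw [(hT.row p hp).values, h₂, trace_pauliOp_mul_stabProd, Complex.ofReal_re]
    refine Runs.seq (runs_estimateCode hc hC.experiments) (fun σ₅ h₅ hF₅ => ?_)
      (T₂ := 110 + 60 * k) (by omega)
    rw [hx] at h₅
    replace hC := hC.frame hF₅ (by decide) (by decide)
    replace hT := hT.frame hF₅ (by decide) (by decide)
    rw [← hF₅.real 8 (by decide)] at h₁
    rw [← hF₅.real 2 (by decide)] at hI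
    rw [← hF₅.nat 19 (by decide)] at hc
    refine Runs.seq (runs_queryCode hc (hT.row p hp) hw) (fun σ₆ h₆ hF₆ => ?_)
      (T₂ := 60) (by omega)
    replace hC := hC.frame hF₆ (by decide) (by decide)
    rw [← hF₆.real 8 (by decide)] at h₁
    rw [← hF₆.real 2 (by decide)] at hI
    rw [← hF₆.real 12 (by decide)] at h₅
    refine Runs.mono (runs_filterRowCode hτ hC.filter h₁ h₅ h₆.1 h₆.2) le_rfl fun σ₇ h₇ => ?_
    rw [Store.real_setNat, h₇, hI, ← List.take_concat_get' L p hp, List.map_append,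
      List.sum_append]
    simp
  · simp only [NExp.cost, Nat.reduceAdd]
    have : L.length * (17 + (180 + 60 * N + 60 * k)) ≤ L.length * (200 + 60 * N + 60 * k) :=
      Nat.mul_le_mul_left _ (by omega)
    omega
  · rintro σ' ⟨h, -⟩
    classical
    rw [output, h, List.take_length, learned, ← List.sum_toFinset _ hL]
    refine Finset.sum_congr ?_ fun _ _ => rfl
    ext P
    simp [hLk]

theorem natCast_train_time_le {n N k m : ℕ} (hn : 1 ≤ n) (hN : 1 ≤ N) (hk : 1 ≤ k)
    (hm : (m : ℝ) ≤ 21 * (n : ℝ) ^ k) :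
    ((m * (250 + 60 * k + 60 * N) + 600 + 140 * k + 60 * N : ℕ) : ℝ) ≤
      10000 * (k * (n : ℝ) ^ k * N) := by
  have hn' : (1 : ℝ) ≤ (n : ℝ) ^ k := one_le_pow₀ (by exact_mod_cast hn)
  have hN' : (1 : ℝ) ≤ N := by exact_mod_cast hN
  have hk' : (1 : ℝ) ≤ k := by exact_mod_cast hk
  have h1 : (k : ℝ) ≤ k * N := le_mul_of_one_le_right (by positivity) hN'
  have h2 : (N : ℝ) ≤ k * N := le_mul_of_one_le_left (by positivity) hk'
  have h3 : (k * N : ℝ) ≤ k * N * (n : ℝ) ^ k := le_mul_of_one_le_right (by positivity) hn'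
  have h4 : (m : ℝ) * (250 + 60 * k + 60 * N) ≤ 21 * (n : ℝ) ^ k * (370 * (k * N)) := by
    gcongr
    linarith
  push_cast
  linarith

theorem natCast_predict_time_le {n N k m κ d M : ℕ} (hn : 1 ≤ n) (hN : 1 ≤ N) (hk : 1 ≤ k)
    (hM : (M : ℝ) ≤ 21 * (n : ℝ) ^ k) (hm : m ≤ 1 + n * (d * 4 ^ κ)) :
    ((100 + 60 * m + N * (100 + m * (100 + 80 * κ)) + M * (200 + 60 * N + 60 * k) : ℕ) : ℝ) ≤
      (10000 + (1 + d * 4 ^ κ) * (160 + 80 * κ)) * (k * (n : ℝ) ^ k * N) := by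
  have hn1 : (1 : ℝ) ≤ n := by exact_mod_cast hn
  have hn' : (1 : ℝ) ≤ (n : ℝ) ^ k := one_le_pow₀ hn1
  have hnk : (n : ℝ) ≤ (n : ℝ) ^ k := le_self_pow₀ hn1 (by omega)
  have hN' : (1 : ℝ) ≤ N := by exact_mod_cast hN
  have hk' : (1 : ℝ) ≤ k := by exact_mod_cast hk
  have h1 : (k : ℝ) ≤ k * N := le_mul_of_one_le_right (by positivity) hN'
  have h2 : (N : ℝ) ≤ k * N := le_mul_of_one_le_left (by positivity) hk'
  have h3 : (k * N : ℝ) ≤ k * N * (n : ℝ) ^ k := le_mul_of_one_le_right (by positivity) hn'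
  have h4 : (M : ℝ) * (200 + 60 * N + 60 * k) ≤ 21 * (n : ℝ) ^ k * (320 * (k * N)) := by
    gcongr
    linarith
  have hm' : (m : ℝ) ≤ (1 + d * 4 ^ κ) * (n : ℝ) ^ k := by
    have : (m : ℝ) ≤ 1 + n * (d * 4 ^ κ) := by exact_mod_cast hm
    calc (m : ℝ) ≤ 1 + n * (d * 4 ^ κ) := this
      _ ≤ (n : ℝ) ^ k + (n : ℝ) ^ k * (d * 4 ^ κ) := by gcongr
      _ = _ := by ring
  have h5 : (m : ℝ) * N ≤ (1 + d * 4 ^ κ) * (k * N * (n : ℝ) ^ k) := by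
    calc (m : ℝ) * N ≤ (1 + d * 4 ^ κ) * (n : ℝ) ^ k * (k * N) := by gcongr
      _ = _ := by ring
  have h6 : (m : ℝ) ≤ m * N := le_mul_of_one_le_right (by positivity) hN'
  have h7 : (m : ℝ) * N * (160 + 80 * κ) ≤
      (1 + d * 4 ^ κ) * (k * N * (n : ℝ) ^ k) * (160 + 80 * κ) := by gcongr
  push_cast
  linarith

end

end

end QEvo

theorem mainTheorem1 (κ d : ℕ) :
    ∃ (train predict : RAM.Cmd) (C : ℝ),
      ∀ (n : ℕ) (ε ε' : ℝ), 1 ≤ n → 0 < ε → ε < 1 → 0 < ε' →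
        ∃ (K : ℕ) (τ : ℝ), K ≤ degree ε ∧ 0 < τ ∧
          -- training and prediction compute the learned function in the stated time
          (∀ (N : ℕ) (S : Shadow n N), 1 ≤ N →
            ∃ (t : ℕ) (σ : RAM.Store),
              RAM.Exec noOracle train (trainInput ε ε' S) t σ ∧
              (t : ℝ) ≤ timeBound C n N ε ∧
              ∀ (O : Op n), IsBoundedDegree κ d O →
                ∀ (m : ℕ) (Q : Fin m → PauliString n), IsListing O Q →
                  ∀ ρ : Op n, IsState ρ →
                    ∃ (t' : ℕ) (σ' : RAM.Store),
                      RAM.Exec (stateOracle ρ (degree ε)) predict (predictInput σ O Q) t' σ' ∧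
                      (t' : ℝ) ≤ timeBound C n N ε ∧
                      output σ' = learned S K τ ρ O) ∧
          -- the learned function is accurate with probability at least `1 - δ`
          (∀ (δ : ℝ) (N : ℕ), 0 < δ → sampleSize C n ε ε' δ ≤ N →
            ∀ E : Op n →ₗ[ℂ] Op n, IsCPTP E →
              1 - δ ≤ shadowProb E {S : Shadow n N |
                ∀ (D : MeasureTheory.Measure (Op n)) (O : Op n),
                  IsLocallyFlat D → IsBoundedDegree κ d O →
                    MeasureTheory.Integrable
                      (fun ρ => |learned S K τ ρ O - (O * E ρ).trace.re| ^ 2) D ∧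
                    ∫ ρ, |learned S K τ ρ O - (O * E ρ).trace.re| ^ 2 ∂D ≤
                      (ε + ε' * (opNorm (lowDegree (degree ε) (heisenberg E O)) / opNorm O) ^
                        exponent ε) * opNorm O ^ 2}) := by
  refine ⟨trainCode (filterBase κ d), predictCode,
    4 * ((sampleBase κ d : ℝ) + 60) + 10000 + (1 + d * 4 ^ κ) * (160 + 80 * κ), ?_⟩
  intro n ε ε' hn hε hε1 hε'
  have hk := one_le_degree hε hε1
  have hb := filterBase_ge κ d
  have hτ := filterParam_pos (b := filterBase κ d) (by omega) hn hk hε'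
  refine ⟨degree ε, filterParam (filterBase κ d) n (degree ε) ε', le_rfl, hτ, ?_, ?_⟩
  · intro N S hN
    obtain ⟨m, hlen, hlt, hmem⟩ := exists_queue_complete n (degree ε)
    have hnodup := (queue_spec n (degree ε) m).1
    have hm : (m : ℝ) ≤ 21 * (n : ℝ) ^ degree ε := by
      refine le_trans (le_of_eq ?_) (card_weight_le hn (degree ε))
      rw [← hlen, ← List.toFinset_card_of_nodup hnodup]
      congr 2
      ext P
      simp [hmem]
    have hpos : (0 : ℝ) ≤ degree ε * (n : ℝ) ^ degree ε * N := by positivity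
    obtain ⟨t, σ, hex, ht, hC, hT⟩ := runs_trainCode (Ω := noOracle) (S := S)
      (ε' := ε') (b := filterBase κ d) hε hlen hlt
    refine ⟨t, σ, hex, ?_, ?_⟩
    · calc (t : ℝ) ≤ _ := Nat.cast_le.mpr ht
        _ ≤ _ := natCast_train_time_le hn hN hk hm
        _ ≤ _ := mul_le_mul_of_nonneg_right (by
          have : (0 : ℝ) ≤ (1 + d * 4 ^ κ) * (160 + 80 * κ) := by positivity
          have : (0 : ℝ) ≤ sampleBase κ d := by positivity
          linarith) hpos
    · intro O hO M Q hQ ρ _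
      obtain ⟨hFn, hFr⟩ := frame_predictInput σ O Q
      -- loading the observable changes the arrays of this program only
      have hF : RAM.Frame (.letNat 3 (.lit 0) ;; .letNat 4 (.lit 0) ;; .letNat 5 (.lit 0) ;;
          .letNat 6 (.lit 0) ;; .letReal 1 (RAM.rlit 0)) σ (predictInput σ O Q) :=
        ⟨fun a ha => hFn a (by simpa [RAM.Cmd.natWrites] using ha),
          fun a ha => hFr a (by simpa [RAM.Cmd.realWrites] using ha)⟩
      obtain ⟨t', σ', hex', ht', hout⟩ := runs_predictCode (ρ := ρ) hτ
        (hC.frame hF (by decide) (by decide)) (hT.frame hF (by decide) (by decide)) hnodup hmem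
        hO.isHermitian (isLoaded_predictInput σ O Q) hQ fun i => hO.weight_le (by
          have : Q i ∈ Set.range Q := ⟨i, rfl⟩
          rwa [hQ.2] at this)
      refine ⟨t', σ', hex', ?_, hout⟩
      have hM : M ≤ 1 + n * (d * 4 ^ κ) := by
        refine le_trans ?_ hO.card_support_le
        rw [← Fintype.card_fin M, ← Finset.card_univ, ← Finset.card_image_of_injective _ hQ.1]
        refine Finset.card_le_card fun P hP => ?_
        obtain ⟨i, -, rfl⟩ := Finset.mem_image.mp hP
        have : Q i ∈ Set.range Q := ⟨i, rfl⟩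
        rw [hQ.2] at this
        simpa using this
      calc (t' : ℝ) ≤ _ := Nat.cast_le.mpr ht'
        _ ≤ _ := natCast_predict_time_le hn hN hk (by rw [hlen]; exact hm) hM
        _ ≤ _ := mul_le_mul_of_nonneg_right (by
          have : (0 : ℝ) ≤ sampleBase κ d := by positivity
          linarith) hpos
  · intro δ N hδ hN E hE
    refine accuracy hn hε hε1 hε' ?_ hδ hN hE
    have : (0 : ℝ) ≤ (1 + d * 4 ^ κ) * (160 + 80 * κ) := by positivity
    linarith
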